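/- Let $k\ge 1$ be divisible by $6$; indices $i$ are taken in $\mathbb Z/k\mathbb Z$. Write $\mathbb T^3=\mathbb T^2\times S^1$ with coordinates $(x,t)$ and its flat metric; $B_r(z)$ is the open ball of radius $r$. The stable (unstable) set of a fixed point is the set of points whose forward (backward) orbit converges to it; for a hyperbolic fixed point it is the stable (unstable) manifold. **The map $f_0$.** Let $A\in SL(2,\mathbb Z)$ have eigenvalues $\lambda>5$ and $\lambda^{-1}$, let $g_A$ be the induced automorphism of $\mathbb T^2$, $W^s_A$ its stable foliation, and $W^s_A(x,r)$ the interval of length $r$ centred at $x$ in $W^s_A(x)$. Let $t_1,\dots,t_k\in S^1$ be circularly ordered points. Let $f_0(x,t)=(g_A(x),\varphi_x(t))$ be a $C^\infty$ diffeomorphism of $\mathbb T^3$ such that: 1. $\varphi_x(t_i)=t_i$ for all $x$ and $i$; 2. $\frac12<|\varphi_x'(t)|<\frac32$ for all $(x,t)$; 3. for each $i$ there are five distinct fixed points $\hat p^i,\hat q^i,\hat r^i_{-1},\hat r^i_0,\hat r^i_1$ of $g_A$ with $\hat p^i=\hat q^{i+1}=\hat p^{i+2}$ and $\hat r^i_1=\hat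 r^{i+1}_0=\hat r^{i+2}_{-1}=\hat r^{i+3}_1$; write $p^i=(\hat p^i,t_i)$, $q^i=(\hat q^i,t_i)$, $r^i_j=(\hat r^i_j,t_i)$; moreover $|\varphi'_{\hat p^i}(t_i)|>1$, $|\varphi'_{\hat r^i_1}(t_i)|>1$, $|\varphi'_{\hat q^i}(t_i)|<1$, $|\varphi'_{\hat r^i_{-1}}(t_i)|<1$; 4. for every $t$ in the arc $(t_i,t_{i+1})$: $(\hat p^i,t)$ is in the unstable set of $p^i$ and the stable set of $q^{i+1}$; $(\hat q^i,t)$ is in the stable set of $q^i$ and the unstable set of $p^{i+1}$; $(\hat r^i_0,t)$ is in the unstable set of $r^i_0$ and the stable set of $r^{i+1}_{-1}$; $(\hat r^i_1,t)$ is in the unstable set of $r^i_1$ and the stable set of $r^{i+1}_0$; 5. there are $\nu>0$ and $\sigma>0$, with $2\sigma$ smaller than the distance between any two of the five points of item 3, such that for every $i$, $\log|\varphi_x'(t_i)|\le\nu/2$ for all $x$, and $\log|\varphi_x'(t_i)|<-\nu$ for all $x$ outside the disks of radius $\sigma$ around $\hat p^i,\hat r^i_1,\hat r^i_0$. **The map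 $f_1$.** Let $\varepsilon>0$ be such that $10\varepsilon$ is smaller than the distance between any two of the tori $\mathbb T^2\times\{t_i\}$ and between any two of the five points of item 3, and let $0<\varepsilon'\le\varepsilon/2$. Let $f_1$ be a $C^\infty$ diffeomorphism of $\mathbb T^3$ that coincides with $f_0$ outside $\bigcup_iB_\varepsilon(r^i_0)$ and such that: 1. $f_1$ preserves the foliation $\mathcal W^{cs}$ with leaves $W^s_A(x)\times S^1$; 2. $f_1$ preserves each torus $\mathbb T^2\times\{t_i\}$, and $f_1=f_0$ on each circle $\{\hat r^i_0\}\times S^1$; 3. there is a continuous $Df_1$-invariant cone field (around a one-dimensional direction) transverse to $\mathcal W^{cs}$ whose vectors are expanded by $Df_1$ by a factor at least $3$, and there is $L>0$ such that every regular curve tangent to it of length $\ge L$ meets $W^s_A(x,2\varepsilon)\times S^1$ for every $x\in\mathbb T^2$, while no such curve of length $<L$ joins $\mathbb T^2\times\{t_i+\varepsilon\}$ to $\mathbb T^2\times\{t_{i+1}-\varepsilon\}$; 4. the maximal invariant set of $f_1$ in $B_\varepsilon(r^i_0)\cap(\mathbb T^2\times\{t_i\})$ consists of two segments of $W^s_A(\hat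 r^i_0)\times\{t_i\}$ which join $r^i_0$ to two fixed points, one on each side, lying outside $B_{\varepsilon'}(r^i_0)$; for the restriction of $f_1$ to $\mathbb T^2\times\{t_i\}$, $r^i_0$ is a hyperbolic source and these two fixed points are hyperbolic saddles; and the maximal invariant set of $f_1$ in $(\mathbb T^2\times\{t_i\})\setminus B_{\varepsilon'}(r^i_0)$ is the complement in $\mathbb T^2\times\{t_i\}$ of the unstable set of $r^i_0$. **The map $f$.** For $j=1,\dots,k$ let $\eta^j:\mathbb T^3\to[0,1]$ be a $C^\infty$ function equal to $1$ in $B_{\varepsilon'/2}(r^j_0)$ and to $0$ outside $B_{\varepsilon'}(r^j_0)$. For $\delta>0$ let $\rho$ be the composition of the time-one maps $\rho^j$ of the flows of $\delta\eta^j\,\partial/\partial t$ (they have disjoint supports), and let $f=\rho\circ f_1$ or $f=f_1\circ\rho$. **Proposition.** There is $\delta_0>0$ such that for every $0<\delta<\delta_0$ and every $i=1,\dots,k$, the stable manifold of $q^i$ for $f$ is dense in $\mathbb T^3$. -/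

import Mathlib

open Set Filter Topology
open scoped ContDiff Matrix

noncomputable section

namespace IntermingledBasins

/-! ### The flat torus and its diffeomorphisms -/

/-- The circle `ℝ / ℤ`. -/
abbrev S1 := UnitAddCircle

/-- The 2-torus. -/
abbrev T2 := Fin 2 → S1

/-- The 3-torus `T² × S¹`, with coordinates `(x, t)`. -/
abbrev T3 := T2 × S1

/-- The universal cover of `T2`. -/
abbrev E2 := Fin 2 → ℝ

/-- The universal cover of `T3`; it also serves as the tangent space of `T3` at every point. -/
abbrev E3 := E2 × ℝ

/-- The covering map `ℝ² → T²`. -/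
def proj2 (v : E2) : T2 := fun i => (v i : S1)

/-- The covering map `ℝ³ → T³`. -/
def proj (v : E3) : T3 := (proj2 v.1, (v.2 : S1))

/-- The flat Riemannian distance of `T²`. -/
def dist2 (x y : T2) : ℝ := √(∑ i, ‖x i - y i‖ ^ 2)

/-- The flat Riemannian distance of `T³`. -/
def dist3 (z w : T3) : ℝ := √((∑ i, ‖z.1 i - w.1 i‖ ^ 2) + ‖z.2 - w.2‖ ^ 2)

/-- The open ball of the flat metric of `T³`. -/
def ball3 (z : T3) (r : ℝ) : Set T3 := {w | dist3 w z < r}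

/-- The Euclidean norm of a tangent vector of `T³`. -/
def norm3 (v : E3) : ℝ := √((∑ i, v.1 i ^ 2) + v.2 ^ 2)

/-- A `C^∞` diffeomorphism of `T³`, with a smooth lift to `ℝ³`. The lift is determined up to an
integer translation, so its derivative at `v` is the derivative of the diffeomorphism at
`proj v`. -/
structure TorusDiffeo where
  /-- the underlying bijection -/
  toPerm : Equiv.Perm T3
  /-- a lift to the universal cover -/
  lift : E3 → E3
  lift_smooth : ContDiff ℝ ∞ lift
  proj_lift : ∀ v, proj (lift v) = toPerm (proj v)
  inv_smooth : ∃ G : E3 → E3, ContDiff ℝ ∞ G ∧ ∀ v, proj (G v) = toPerm.symm (proj v)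

instance : CoeFun TorusDiffeo (fun _ => T3 → T3) := ⟨fun f => f.toPerm⟩

/-- The derivative at `proj v`, in the coordinates given by the covering map. -/
def TorusDiffeo.D (f : TorusDiffeo) (v : E3) : E3 →L[ℝ] E3 := fderiv ℝ f.lift v

/-- The derivative along the circle `{x} × S¹`: for a map `(x, t) ↦ (g x, φ_x t)`, this is
`φ_x'(t)` at `(x, t) = proj v`. -/
def TorusDiffeo.fiberDeriv (f : TorusDiffeo) (v : E3) : ℝ := (f.D v (0, 1)).2

/-- The derivative at `proj v` of the restriction to the torus `T² × {t}` through `proj v`, for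
a diffeomorphism that preserves this torus. -/
def TorusDiffeo.horizDeriv (f : TorusDiffeo) (v : E3) : E2 →ₗ[ℝ] E2 :=
  LinearMap.fst ℝ E2 ℝ ∘ₗ (f.D v : E3 →ₗ[ℝ] E3) ∘ₗ LinearMap.inl ℝ E2 ℝ

/-- The stable set (the stable manifold, for a hyperbolic fixed point) of the fixed point `q`. -/
def stableSet (f : T3 → T3) (q : T3) : Set T3 :=
  {z | Tendsto (fun n : ℕ => f^[n] z) atTop (𝓝 q)}

/-- The unstable set of the fixed point `q`. -/
def unstableSet (f : TorusDiffeo) (q : T3) : Set T3 := stableSet f.toPerm.symm q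

/-- The maximal invariant set of `f` in `S`. -/
def maxInvariant (f : TorusDiffeo) (S : Set T3) : Set T3 :=
  {z | ∀ n : ℤ, (f.toPerm ^ n) z ∈ S}

/-- The fixed point `z` is a hyperbolic source of the restriction to the horizontal torus. -/
def IsHorizSource (f : TorusDiffeo) (z : T3) : Prop :=
  f z = z ∧ ∀ v, proj v = z →
    ∀ μ ∈ spectrum ℂ ((LinearMap.toMatrix' (f.horizDeriv v)).map (algebraMap ℝ ℂ)), 1 < ‖μ‖

/-- The fixed point `z` is a hyperbolic saddle of the restriction to the horizontal torus. -/
def IsHorizSaddle (f : TorusDiffeo) (z : T3) : Prop :=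
  f z = z ∧ ∀ v, proj v = z → ∃ a b : ℝ, |a| < 1 ∧ 1 < |b| ∧
    Module.End.HasEigenvalue (f.horizDeriv v) a ∧ Module.End.HasEigenvalue (f.horizDeriv v) b

/-! ### The linear Anosov map -/

/-- A hyperbolic matrix of `SL(2, ℤ)` with unstable eigenvalue `lam > 5`, and unit vectors
`es`, `eu` spanning its stable and unstable lines. -/
structure ToralAnosov where
  A : Matrix.SpecialLinearGroup (Fin 2) ℤ
  lam : ℝ
  eu : E2
  es : E2
  lam_gt : 5 < lam
  eu_unit : ∑ i, eu i ^ 2 = 1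
  es_unit : ∑ i, es i ^ 2 = 1
  A_eu : (A.1.map (Int.cast : ℤ → ℝ)) *ᵥ eu = lam • eu
  A_es : (A.1.map (Int.cast : ℤ → ℝ)) *ᵥ es = lam⁻¹ • es

namespace ToralAnosov

variable (N : ToralAnosov)

/-- The induced automorphism `g_A` of `T²`. -/
def g (x : T2) : T2 := fun i => ∑ j, N.A.1 i j • x j

/-- The point at signed distance `s` from `x` on the stable leaf of `x`. -/
def along (x : T2) (s : ℝ) : T2 := x + proj2 (s • N.es)

/-- The interval of length `r` centred at `x` in the stable leaf `W^s_A(x)`. -/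
def stableInterval (x : T2) (r : ℝ) : Set T2 := {y | ∃ s : ℝ, |s| ≤ r / 2 ∧ y = N.along x s}

/-- The leaf `W^s_A(x) × S¹` through `z = (x, t)` of the centre-stable foliation. -/
def csLeaf (z : T3) : Set T3 := {w | ∃ s : ℝ, w.1 = N.along z.1 s}

end ToralAnosov

/-! ### The fibered map with several invariant tori -/

/-- The positively oriented open arc of the circle between the images of `a` and `b`, for
`a < b ≤ a + 1`. -/
def arc (a b : ℝ) : Set S1 := (fun s : ℝ => (s : S1)) '' Ioo a b

/-- The fibered diffeomorphism `f₀ (x, t) = (g_A x, φ_x t)`. The circularly ordered points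
`t_i`, `i ∈ ℤ/k`, are the images in the circle of a strictly increasing sequence `τ` with
`τ (i + k) = τ i + 1`. All families are indexed by `ℤ`; the relations `p_q`, `q_p`, `r1_r0`,
`r0_rm`, `rm_r1` make the families of points of `T²` periodic of period 6, hence indexed by
`ℤ/k` when 6 divides `k`. The letters `p`, `q`, `rm`, `r0`, `r1` are the points of `T²` below the
fixed points `p^i`, `q^i`, `r^i_{-1}`, `r^i_0`, `r^i_1`. -/
structure KanMap (k : ℕ) where
  N : ToralAnosov
  τ : ℤ → ℝ
  τ_strictMono : StrictMono τ
  τ_period : ∀ i, τ (i + k) = τ i + 1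
  f₀ : TorusDiffeo
  φ : T2 → S1 → S1
  fibered : ∀ x t, f₀ (x, t) = (N.g x, φ x t)
  /-- the tori `T² × {t_i}` are invariant -/
  φ_fix : ∀ x i, φ x (τ i : S1) = (τ i : S1)
  fiberDeriv_bounds : ∀ v, 1 / 2 < |f₀.fiberDeriv v| ∧ |f₀.fiberDeriv v| < 3 / 2
  p : ℤ → T2
  q : ℤ → T2
  rm : ℤ → T2
  r0 : ℤ → T2
  r1 : ℤ → T2
  named_fixed : ∀ i, ∀ x ∈ [p i, q i, rm i, r0 i, r1 i], N.g x = x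
  named_distinct : ∀ i, [p i, q i, rm i, r0 i, r1 i].Nodup
  p_q : ∀ i, p i = q (i + 1)
  q_p : ∀ i, q (i + 1) = p (i + 2)
  r1_r0 : ∀ i, r1 i = r0 (i + 1)
  r0_rm : ∀ i, r0 (i + 1) = rm (i + 2)
  rm_r1 : ∀ i, rm (i + 2) = r1 (i + 3)
  deriv_p : ∀ i v, proj v = (p i, (τ i : S1)) → 1 < |f₀.fiberDeriv v|
  deriv_r1 : ∀ i v, proj v = (r1 i, (τ i : S1)) → 1 < |f₀.fiberDeriv v|
  deriv_q : ∀ i v, proj v = (q i, (τ i : S1)) → |f₀.fiberDeriv v| < 1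
  deriv_rm : ∀ i v, proj v = (rm i, (τ i : S1)) → |f₀.fiberDeriv v| < 1
  connect_a : ∀ i, ∀ t ∈ arc (τ i) (τ (i + 1)),
    (p i, t) ∈ unstableSet f₀ (p i, (τ i : S1)) ∩ stableSet f₀ (q (i + 1), (τ (i + 1) : S1))
  connect_b : ∀ i, ∀ t ∈ arc (τ i) (τ (i + 1)),
    (q i, t) ∈ stableSet f₀ (q i, (τ i : S1)) ∩ unstableSet f₀ (p (i + 1), (τ (i + 1) : S1))
  connect_c : ∀ i, ∀ t ∈ arc (τ i) (τ (i + 1)),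
    (r0 i, t) ∈ unstableSet f₀ (r0 i, (τ i : S1)) ∩ stableSet f₀ (rm (i + 1), (τ (i + 1) : S1))
  connect_d : ∀ i, ∀ t ∈ arc (τ i) (τ (i + 1)),
    (r1 i, t) ∈ unstableSet f₀ (r1 i, (τ i : S1)) ∩ stableSet f₀ (r0 (i + 1), (τ (i + 1) : S1))
  /-- contraction along the circles at `T² × {t_i}`, outside small disjoint disks of radius `σ`
  around `p i`, `r1 i`, `r0 i` -/
  mostly_contracting : ∃ ν > 0, ∃ σ > 0,
    (∀ i, [p i, q i, rm i, r0 i, r1 i].Pairwise (fun x y => 2 * σ < dist2 x y)) ∧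
    ∀ i v, (v.2 : S1) = (τ i : S1) →
      ((∀ x ∈ [p i, r1 i, r0 i], σ ≤ dist2 (proj2 v.1) x) →
        Real.log |f₀.fiberDeriv v| < -ν) ∧
      Real.log |f₀.fiberDeriv v| ≤ ν / 2

namespace KanMap

variable {k : ℕ} (K : KanMap k)

/-- The point `t_i` of the circle. -/
def t (i : ℤ) : S1 := (K.τ i : S1)

/-- The fixed point `q^i`. -/
def Q (i : ℤ) : T3 := (K.q i, K.t i)

/-- The fixed point `r^i_0`. -/
def R0 (i : ℤ) : T3 := (K.r0 i, K.t i)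

/-- The torus `T² × {t_i}`. -/
def torus (i : ℤ) : Set T3 := {z | z.2 = K.t i}

end KanMap

/-! ### Cone fields -/

/-- A continuous cone field `C(z) = {w | 0 ≤ B z w w}` around a one-dimensional direction,
transverse to the planes spanned by `(es, 0)` and `(0, 1)` (the tangent planes of the
centre-stable foliation), given by a continuous field of quadratic forms. -/
def IsConeField (N : ToralAnosov) (B : T3 → E3 →L[ℝ] E3 →L[ℝ] ℝ) : Prop :=
  Continuous B ∧ (∀ z v w, B z v w = B z w v) ∧
  (∀ z, ∀ a c : ℝ, (a, c) ≠ 0 → B z (a • N.es, c) (a • N.es, c) < 0) ∧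
  ∀ z, ∃ w, 0 < B z w w

/-- A regular `C¹` curve `proj ∘ γ`, parametrized by `[0, 1]`, tangent to the cone field `B`. -/
def IsTangentCurve (B : T3 → E3 →L[ℝ] E3 →L[ℝ] ℝ) (γ : ℝ → E3) : Prop :=
  ContDiff ℝ 1 γ ∧ ∀ s ∈ Icc (0 : ℝ) 1,
    deriv γ s ≠ 0 ∧ 0 ≤ B (proj (γ s)) (deriv γ s) (deriv γ s)

/-- The length of the curve `γ` on `[0, 1]`. -/
def curveLength (γ : ℝ → E3) : ℝ := ∫ s in (0 : ℝ)..1, norm3 (deriv γ s)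

/-! ### The modification of DA type -/

/-- The diffeomorphism `f₁`, which differs from `f₀` only in the balls of radius `ε` around the
points `r^i_0`. The radius `ε'` is that of the smaller balls in which the final perturbation will
be supported. -/
structure FirstModification {k : ℕ} (K : KanMap k) where
  ε : ℝ
  ε' : ℝ
  ε'_pos : 0 < ε'
  ε'_le : ε' ≤ ε / 2
  ε_tori : ∀ i, 10 * ε < K.τ (i + 1) - K.τ i
  ε_points : ∀ i,
    [K.p i, K.q i, K.rm i, K.r0 i, K.r1 i].Pairwise (fun x y => 10 * ε < dist2 x y)
  f₁ : TorusDiffeo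
  eq_outside : ∀ z, (∀ i, z ∉ ball3 (K.R0 i) ε) → f₁ z = K.f₀ z
  /-- the foliation by the leaves `W^s_A(x) × S¹` is preserved -/
  leaf : ∀ z, f₁ '' K.N.csLeaf z = K.N.csLeaf (f₁ z)
  torus_inv : ∀ i, f₁ '' K.torus i = K.torus i
  circle : ∀ i t, f₁ (K.r0 i, t) = K.f₀ (K.r0 i, t)
  /-- the invariant, expanded, narrow cone field -/
  cone : ∃ B, IsConeField K.N B ∧
    (∀ v w, 0 ≤ B (proj v) w w →
      0 ≤ B (f₁ (proj v)) (f₁.D v w) (f₁.D v w) ∧ 3 * norm3 w ≤ norm3 (f₁.D v w)) ∧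
    ∃ L > 0,
      (∀ x γ, IsTangentCurve B γ → L ≤ curveLength γ →
        ∃ s ∈ Icc (0 : ℝ) 1, (proj (γ s)).1 ∈ K.N.stableInterval x (2 * ε)) ∧
      ∀ i γ, IsTangentCurve B γ → curveLength γ < L →
        ¬ ((proj (γ 0)).2 = ((K.τ i + ε : ℝ) : S1) ∧
          (proj (γ 1)).2 = ((K.τ (i + 1) - ε : ℝ) : S1))
  /-- The maximal invariant set in the horizontal disk of radius `ε` around `r^i_0` consists of
  two segments of the leaf through `r^i_0`, which join this hyperbolic source to two hyperbolic
  saddles, outside the ball of radius `ε'`. -/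
  local_invariant : ∀ i, ∃ a b : ℝ, a < 0 ∧ 0 < b ∧
    maxInvariant f₁ (ball3 (K.R0 i) ε ∩ K.torus i) =
      (fun s : ℝ => ((K.N.along (K.r0 i) s, K.t i) : T3)) '' Icc a b ∧
    IsHorizSource f₁ (K.R0 i) ∧
    ∀ c ∈ [a, b], IsHorizSaddle f₁ (K.N.along (K.r0 i) c, K.t i) ∧
      (K.N.along (K.r0 i) c, K.t i) ∉ ball3 (K.R0 i) ε'
  /-- The maximal invariant set in the torus minus the ball of radius `ε'` (the DA attractor) is
  the complement of the basin of repulsion of `r^i_0` in the torus. -/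
  attractor : ∀ i, maxInvariant f₁ (K.torus i \ ball3 (K.R0 i) ε') =
    K.torus i \ unstableSet f₁ (K.R0 i)

/-! ### The final perturbation -/

/-- A smooth function `T³ → [0, 1]`, equal to `1` in the ball of radius `r / 2` around `c` and
to `0` outside the ball of radius `r`. -/
def IsBump (c : T3) (r : ℝ) (η : T3 → ℝ) : Prop :=
  ContDiff ℝ ∞ (fun v : E3 => η (proj v)) ∧ (∀ z, η z ∈ Icc (0 : ℝ) 1) ∧
  (∀ z ∈ ball3 c (r / 2), η z = 1) ∧ ∀ z, z ∉ ball3 c r → η z = 0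

/-- `ρ` is the time-one map of the flow of the vector field `X ∂/∂t` on `T³`. -/
def IsVerticalTimeOneMap (X : T3 → ℝ) (ρ : T3 → T3) : Prop :=
  ∀ (x : T2) (s : ℝ), ∃ c : ℝ → ℝ, c 0 = s ∧
    (∀ u, HasDerivAt c (X (x, (c u : S1))) u) ∧ ρ (x, (s : S1)) = (x, (c 1 : S1))

end IntermingledBasins

end

/-!
Lift everything to `T² × ℝ`, so that the tori become the levels `τ i` and the lift of `f` never
moves a point from above a level to below it. On the base, `f` differs from `g_A` only by a drift
along stable leaves which is small compared with `ε`. Hence the strip of half-width `2ε` over the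
stable leaf of `q^i`, between the levels `τ (i - 1)` and `τ (i + 1)`, is contained in the stable
set of `q^i`, and it suffices that the iterates of every open set `U` meet all these strips.

Stable leaves being dense, the iterates of `U` meet some strip. If they meet that of `q^j`, they
accumulate on the unstable leaf of the sink `q^j`, and so they meet the stable leaf of every fixed
point of `g_A` near the `j`-th torus. Points of the leaf of `r^j_1` above this torus are expelled
upwards, and follow the circle through `r^{j+1}_0`, where the push `ρ` carries them across the
torus `j + 1` to the sink `r^{j+2}_{-1}`; there they meet the strip of `q^{j+2}`. Together with
`p^j = q^{j±1}` on the base, this takes `U` from the strip of `q^j` to that of `q^{j+1}`.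
-/

noncomputable section

namespace IntermingledBasins

/-! ### The flat distances -/

theorem sqrt_sum_sq_le_add {ι : Type*} [Fintype ι] {a b c : ι → ℝ} (hc : ∀ i, 0 ≤ c i)
    (h : ∀ i, c i ≤ a i + b i) :
    √(∑ i, c i ^ 2) ≤ √(∑ i, a i ^ 2) + √(∑ i, b i ^ 2) := by
  have hnorm := norm_add_le (WithLp.toLp 2 a : EuclideanSpace ℝ ι) (WithLp.toLp 2 b)
  simp only [EuclideanSpace.norm_eq, PiLp.add_apply, Real.norm_eq_abs, sq_abs] at hnorm
  refine le_trans (Real.sqrt_le_sqrt (Finset.sum_le_sum fun i _ => ?_)) hnorm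
  have := hc i
  have := h i
  gcongr

theorem dist2_self (x : T2) : dist2 x x = 0 := by simp [dist2]

theorem dist2_comm (x y : T2) : dist2 x y = dist2 y x := by
  simp only [dist2, norm_sub_rev]

theorem dist2_triangle (x y z : T2) : dist2 x z ≤ dist2 x y + dist2 y z :=
  sqrt_sum_sq_le_add (fun _ => norm_nonneg _) fun _ => norm_sub_le_norm_sub_add_norm_sub _ _ _

theorem continuous_dist2 (y : T2) : Continuous fun x => dist2 x y := by
  unfold dist2; fun_prop

theorem dist3_eq_sqrt_sum (z w : T3) :
    dist3 z w = √(∑ i : Fin 3, (![‖z.1 0 - w.1 0‖, ‖z.1 1 - w.1 1‖, ‖z.2 - w.2‖] i) ^ 2) := by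
  simp [dist3, Fin.sum_univ_three]

theorem dist3_self (z : T3) : dist3 z z = 0 := by simp [dist3]

theorem dist3_comm (z w : T3) : dist3 z w = dist3 w z := by
  simp only [dist3, norm_sub_rev]

theorem dist3_triangle (x y z : T3) : dist3 x z ≤ dist3 x y + dist3 y z := by
  simp only [dist3_eq_sqrt_sum]
  refine sqrt_sum_sq_le_add (fun i => ?_) fun i => ?_
  · fin_cases i <;> exact norm_nonneg _
  · fin_cases i <;> exact norm_sub_le_norm_sub_add_norm_sub _ _ _

theorem dist2_le_dist3 (z w : T3) : dist2 z.1 w.1 ≤ dist3 z w :=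
  Real.sqrt_le_sqrt (le_add_of_nonneg_right (sq_nonneg _))

theorem norm_snd_sub_le_dist3 (z w : T3) : ‖z.2 - w.2‖ ≤ dist3 z w :=
  Real.le_sqrt_of_sq_le (le_add_of_nonneg_left (Finset.sum_nonneg fun _ _ => sq_nonneg _))

theorem dist3_mk_mk (x y : T2) (t : S1) : dist3 (x, t) (y, t) = dist2 x y := by
  simp [dist3, dist2]

theorem continuous_dist3 (w : T3) : Continuous fun z => dist3 z w := by
  unfold dist3; fun_prop

/-! ### The covering maps -/

theorem isOpenQuotientMap_coe : IsOpenQuotientMap (fun a : ℝ => (a : S1)) :=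
  QuotientAddGroup.isOpenQuotientMap_mk

theorem isOpenQuotientMap_proj2 : IsOpenQuotientMap proj2 :=
  IsOpenQuotientMap.piMap (fun _ : Fin 2 => isOpenQuotientMap_coe)

theorem isOpenQuotientMap_proj : IsOpenQuotientMap proj :=
  isOpenQuotientMap_proj2.prodMap isOpenQuotientMap_coe

/-- The cyclic covering `T² × ℝ → T³`, in which heights become real numbers. -/
def cyc (z : T2 × ℝ) : T3 := (z.1, (z.2 : S1))

theorem isOpenQuotientMap_cyc : IsOpenQuotientMap cyc :=
  IsOpenQuotientMap.id.prodMap isOpenQuotientMap_coe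

theorem continuous_proj2 : Continuous proj2 := isOpenQuotientMap_proj2.continuous

theorem continuous_cyc : Continuous cyc := isOpenQuotientMap_cyc.continuous

theorem proj2_zero : proj2 0 = 0 := by
  ext; simp [proj2]

theorem proj2_add (v w : E2) : proj2 (v + w) = proj2 v + proj2 w := by
  ext; simp [proj2]

theorem coe_eq_coe_iff {a b : ℝ} : (a : S1) = (b : S1) ↔ ∃ n : ℤ, a = b + n := by
  rw [← sub_eq_zero, ← AddCircle.coe_sub, AddCircle.coe_eq_zero_iff]
  simp only [zsmul_eq_mul, mul_one, eq_comm (b := a - b), sub_eq_iff_eq_add']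

theorem proj2_eq_proj2_iff {v w : E2} :
    proj2 v = proj2 w ↔ ∃ n : Fin 2 → ℤ, v = w + fun i => (n i : ℝ) := by
  simp only [funext_iff, proj2, coe_eq_coe_iff, Pi.add_apply, Classical.skolem]

theorem eq_of_coe_eq_coe {a b : ℝ} (h : (a : S1) = (b : S1)) (hab : |a - b| < 1) : a = b := by
  obtain ⟨n, rfl⟩ := coe_eq_coe_iff.1 h
  have hn : |n| < 1 := by
    rw [add_sub_cancel_left] at hab
    exact_mod_cast hab
  simp [Int.abs_lt_one_iff.1 hn]

theorem norm_coe_le_abs (a : ℝ) : ‖(a : S1)‖ ≤ |a| :=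
  QuotientAddGroup.norm_mk_le_norm

theorem norm_coe_of_abs_le {a : ℝ} (h : |a| ≤ 1 / 2) : ‖(a : S1)‖ = |a| :=
  (AddCircle.norm_coe_eq_abs_iff (p := (1 : ℝ)) one_ne_zero).2 (by simpa using h)

theorem continuous_add_proj2_smul (e : E2) : Continuous fun z : T2 × ℝ => z.1 + proj2 (z.2 • e) :=
  continuous_fst.add (continuous_proj2.comp (by fun_prop))

theorem abs_eq_sqrt_sum_sq {e : E2} (he : ∑ i, e i ^ 2 = 1) (s : ℝ) :
    |s| = √(∑ i, |s * e i| ^ 2) := by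
  simp only [sq_abs, mul_pow, ← Finset.mul_sum, he, mul_one, Real.sqrt_sq_eq_abs]

theorem dist2_add_proj2_smul (x : T2) (e : E2) (s : ℝ) :
    dist2 (x + proj2 (s • e)) x = √(∑ i, ‖((s * e i : ℝ) : S1)‖ ^ 2) := by
  simp [dist2, proj2]

theorem dist2_add_proj2_smul_le {e : E2} (he : ∑ i, e i ^ 2 = 1) (x : T2) (s : ℝ) :
    dist2 (x + proj2 (s • e)) x ≤ |s| := by
  rw [dist2_add_proj2_smul, abs_eq_sqrt_sum_sq he]
  gcongr
  exact norm_coe_le_abs _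

theorem dist2_add_proj2_smul_eq {e : E2} (he : ∑ i, e i ^ 2 = 1) (x : T2) {s : ℝ}
    (hs : |s| ≤ 1 / 2) : dist2 (x + proj2 (s • e)) x = |s| := by
  rw [dist2_add_proj2_smul, abs_eq_sqrt_sum_sq he]
  congr! 3 with i
  have hei : |e i| ≤ 1 := by
    rw [← sq_le_one_iff_abs_le_one, ← he]
    exact Finset.single_le_sum (f := fun i => e i ^ 2) (fun _ _ => sq_nonneg _) (Finset.mem_univ i)
  refine norm_coe_of_abs_le ?_
  rw [abs_mul]
  exact (mul_le_of_le_one_right (abs_nonneg s) hei).trans hs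

theorem dense_setOf_isOfFinAddOrder : Dense {x : T2 | IsOfFinAddOrder x} := by
  have hrat : Dense (pi univ fun _ : Fin 2 => range ((↑) : ℚ → ℝ)) :=
    dense_pi univ fun _ _ => Rat.denseRange_cast
  refine (isOpenQuotientMap_proj2.surjective.denseRange.dense_image continuous_proj2 hrat).mono ?_
  rintro _ ⟨v, hv, rfl⟩
  refine IsOfFinAddOrder.pi fun i => ?_
  obtain ⟨a, ha⟩ := hv i (mem_univ i)
  exact AddCircle.isOfFinAddOrder_iff_exists_rat_eq_div.2 ⟨a, by simp [ha]⟩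

theorem TorusDiffeo.continuous (f : TorusDiffeo) : Continuous f := by
  rw [isOpenQuotientMap_proj.isQuotientMap.continuous_iff]
  have : (f : T3 → T3) ∘ proj = proj ∘ f.lift := funext fun v => (f.proj_lift v).symm
  rw [this]
  exact isOpenQuotientMap_proj.continuous.comp f.lift_smooth.continuous

theorem TorusDiffeo.isOpenMap (f : TorusDiffeo) : IsOpenMap f :=
  (f.continuous.homeoOfEquivCompactToT2 (f := f.toPerm)).isOpenMap

theorem TorusDiffeo.continuous_symm (f : TorusDiffeo) : Continuous f.toPerm.symm :=
  (f.continuous.homeoOfEquivCompactToT2 (f := f.toPerm)).symm.continuous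

/-! ### The linear Anosov map -/

namespace ToralAnosov

variable (N : ToralAnosov)

theorem lam_pos : 0 < N.lam := by linarith [N.lam_gt]

theorem lam_inv_pos : 0 < N.lam⁻¹ := inv_pos.2 N.lam_pos

theorem lam_inv_lt : N.lam⁻¹ < 1 / 5 := by
  have := N.lam_gt
  rw [one_div]; gcongr

/-- The point at signed distance `u` from `x` on the unstable leaf of `x`. -/
def alongU (x : T2) (u : ℝ) : T2 := x + proj2 (u • N.eu)

theorem g_proj2 (v : E2) : N.g (proj2 v) = proj2 ((N.A.1.map (Int.cast : ℤ → ℝ)) *ᵥ v) := by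
  ext i
  simp [g, proj2, Matrix.mulVec, dotProduct]

theorem g_add (x y : T2) : N.g (x + y) = N.g x + N.g y := by
  ext i
  simp [g, Finset.sum_add_distrib]

theorem g_add_proj2_smul {e : E2} {μ : ℝ} (he : (N.A.1.map (Int.cast : ℤ → ℝ)) *ᵥ e = μ • e)
    (x : T2) (s : ℝ) : N.g (x + proj2 (s • e)) = N.g x + proj2 ((μ * s) • e) := by
  rw [g_add, g_proj2, Matrix.mulVec_smul, he, smul_smul, mul_comm]

theorem iterate_g_add_proj2_smul {e : E2} {μ : ℝ}
    (he : (N.A.1.map (Int.cast : ℤ → ℝ)) *ᵥ e = μ • e) (x : T2) (s : ℝ) (n : ℕ) :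
    N.g^[n] (x + proj2 (s • e)) = N.g^[n] x + proj2 ((μ ^ n * s) • e) := by
  induction n with
  | zero => simp
  | succ n ih =>
    simp only [Function.iterate_succ_apply', ih, N.g_add_proj2_smul he, pow_succ', mul_assoc]

theorem g_along (x : T2) (s : ℝ) : N.g (N.along x s) = N.along (N.g x) (N.lam⁻¹ * s) :=
  N.g_add_proj2_smul N.A_es x s

theorem g_alongU (x : T2) (u : ℝ) : N.g (N.alongU x u) = N.alongU (N.g x) (N.lam * u) :=
  N.g_add_proj2_smul N.A_eu x u

theorem iterate_g_along (x : T2) (s : ℝ) (n : ℕ) :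
    N.g^[n] (N.along x s) = N.along (N.g^[n] x) (N.lam⁻¹ ^ n * s) :=
  N.iterate_g_add_proj2_smul N.A_es x s n

theorem iterate_g_alongU (x : T2) (u : ℝ) (n : ℕ) :
    N.g^[n] (N.alongU x u) = N.alongU (N.g^[n] x) (N.lam ^ n * u) :=
  N.iterate_g_add_proj2_smul N.A_eu x u n

theorem along_zero (x : T2) : N.along x 0 = x := by simp [along, proj2_zero]

theorem alongU_zero (x : T2) : N.alongU x 0 = x := by simp [alongU, proj2_zero]

theorem along_along (x : T2) (s r : ℝ) : N.along (N.along x s) r = N.along x (s + r) := by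
  simp [along, add_smul, proj2_add, add_assoc]

theorem continuous_along : Continuous fun z : T2 × ℝ => N.along z.1 z.2 :=
  continuous_add_proj2_smul N.es

theorem continuous_alongU : Continuous fun z : T2 × ℝ => N.alongU z.1 z.2 :=
  continuous_add_proj2_smul N.eu

theorem dist2_along_le (x : T2) (s : ℝ) : dist2 (N.along x s) x ≤ |s| :=
  dist2_add_proj2_smul_le N.es_unit x s

theorem dist2_along (x : T2) {s : ℝ} (hs : |s| ≤ 1 / 2) : dist2 (N.along x s) x = |s| :=
  dist2_add_proj2_smul_eq N.es_unit x hs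

theorem dist3_along_le (z : T3) (s : ℝ) : dist3 (N.along z.1 s, z.2) z ≤ |s| :=
  (dist3_mk_mk _ z.1 z.2).trans_le (N.dist2_along_le z.1 s)

theorem dist3_along (z : T3) {s : ℝ} (hs : |s| ≤ 1 / 2) : dist3 (N.along z.1 s, z.2) z = |s| :=
  (dist3_mk_mk _ z.1 z.2).trans (N.dist2_along z.1 hs)

theorem dist2_alongU_le (x : T2) (u : ℝ) : dist2 (N.alongU x u) x ≤ |u| :=
  dist2_add_proj2_smul_le N.eu_unit x u

theorem linearIndependent_eu_es : LinearIndependent ℝ ![N.eu, N.es] := by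
  have hlam : N.lam ≠ N.lam⁻¹ := by linarith [N.lam_gt, N.lam_inv_lt]
  refine Module.End.eigenvectors_linearIndependent'
    (Matrix.toLin' (N.A.1.map (Int.cast : ℤ → ℝ))) ![N.lam, N.lam⁻¹] ?_ _ fun i => ?_
  · simpa [Function.Injective, Fin.forall_fin_two] using ⟨hlam, hlam.symm⟩
  · have hu : N.eu ≠ 0 := by intro h; simpa [h] using N.eu_unit
    have hs : N.es ≠ 0 := by intro h; simpa [h] using N.es_unit
    fin_cases i
    · exact ⟨Module.End.mem_eigenspace_iff.2 (by simp [N.A_eu]), hu⟩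
    · exact ⟨Module.End.mem_eigenspace_iff.2 (by simp [N.A_es]), hs⟩

/-- The basis `(eu, es)` of `ℝ²`. -/
def eigenbasis : Module.Basis (Fin 2) ℝ E2 :=
  basisOfLinearIndependentOfCardEqFinrank N.linearIndependent_eu_es (by simp)

theorem eigenbasis_eq : ⇑N.eigenbasis = ![N.eu, N.es] :=
  coe_basisOfLinearIndependentOfCardEqFinrank ..

/-- The component of a vector along the unstable line, parallel to the stable line. -/
def uCoord : E2 →ₗ[ℝ] ℝ := N.eigenbasis.coord 0

/-- The component of a vector along the stable line, parallel to the unstable line. -/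
def sCoord : E2 →ₗ[ℝ] ℝ := N.eigenbasis.coord 1

theorem uCoord_es : N.uCoord N.es = 0 := by
  have : N.es = N.eigenbasis 1 := by simp [eigenbasis_eq]
  simp [uCoord, this]

theorem uCoord_smul_add_sCoord_smul (v : E2) : N.uCoord v • N.eu + N.sCoord v • N.es = v := by
  simpa [uCoord, sCoord, Fin.sum_univ_two, eigenbasis_eq] using N.eigenbasis.sum_repr v

theorem exists_alongU_eq_along (x y : T2) : ∃ u s : ℝ, N.alongU x u = N.along y s := by
  obtain ⟨v, rfl⟩ := isOpenQuotientMap_proj2.surjective x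
  obtain ⟨w, rfl⟩ := isOpenQuotientMap_proj2.surjective y
  refine ⟨N.uCoord (w - v), -N.sCoord (w - v), ?_⟩
  rw [alongU, along, ← proj2_add, ← proj2_add, neg_smul, ← sub_eq_add_neg]
  congr 1
  rw [eq_sub_iff_add_eq, add_assoc, uCoord_smul_add_sCoord_smul, add_sub_cancel]

theorem countable_uCoord_of_proj2_mem_leaf (x : T2) :
    (N.uCoord '' {v | ∃ s, proj2 v = N.along x s}).Countable := by
  obtain ⟨w, rfl⟩ := isOpenQuotientMap_proj2.surjective x
  refine (countable_range fun n : Fin 2 → ℤ => N.uCoord (w + fun i => (n i : ℝ))).mono ?_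
  rintro _ ⟨v, ⟨s, hs⟩, rfl⟩
  rw [along, ← proj2_add, proj2_eq_proj2_iff] at hs
  obtain ⟨n, rfl⟩ := hs
  exact ⟨n, by simp [uCoord_es]⟩

-- A path in a leaf has constant unstable coordinate, as this coordinate takes countably many
-- values on the leaf.
theorem exists_continuous_along {P : ℝ → E2} (hP : Continuous P) {x : T2}
    (hleaf : ∀ r, ∃ s, proj2 (P r) = N.along x s) {r₀ s₀ : ℝ}
    (h₀ : proj2 (P r₀) = N.along x s₀) :
    ∃ μ : ℝ → ℝ, Continuous μ ∧ μ r₀ = s₀ ∧ ∀ r, proj2 (P r) = N.along x (μ r) := by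
  have hconst : ∀ r, N.uCoord (P r) = N.uCoord (P r₀) := fun r =>
    (N.countable_uCoord_of_proj2_mem_leaf x).isTotallyDisconnected
      (range fun r => N.uCoord (P r)) (range_subset_iff.2 fun r => ⟨P r, hleaf r, rfl⟩)
      (isPreconnected_range (N.uCoord.continuous_of_finiteDimensional.comp hP)) ⟨r, rfl⟩ ⟨r₀, rfl⟩
  refine ⟨fun r => s₀ + N.sCoord (P r - P r₀),
    continuous_const.add (N.sCoord.continuous_of_finiteDimensional.comp (hP.sub continuous_const)),
    by simp, fun r => ?_⟩
  have hdiff := N.uCoord_smul_add_sCoord_smul (P r - P r₀)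
  rw [map_sub, hconst r, sub_self, zero_smul, zero_add] at hdiff
  rw [← along_along, ← h₀, along, hdiff, ← proj2_add, add_sub_cancel]

theorem g_injective : Function.Injective N.g := by
  refine Function.LeftInverse.injective (g := fun x i => ∑ j, N.A⁻¹.1 i j • x j) fun x => ?_
  ext i
  have hmul : N.A⁻¹.1 * N.A.1 = 1 := congrArg Subtype.val (inv_mul_cancel N.A)
  calc ∑ j, N.A⁻¹.1 i j • N.g x j = ∑ l, (N.A⁻¹.1 * N.A.1) i l • x l := by
        simp only [g, Finset.smul_sum, smul_smul, Matrix.mul_apply, Finset.sum_smul]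
        exact Finset.sum_comm
    _ = x i := by rw [hmul]; simp [Matrix.one_apply]

theorem mem_periodicPts_g {x : T2} (hx : IsOfFinAddOrder x) : x ∈ Function.periodicPts N.g := by
  obtain ⟨D, hD, hDx⟩ := isOfFinAddOrder_iff_nsmul_eq_zero.1 hx
  let S : Set T2 := {y | D • y = 0}
  have hfin : S.Finite := by
    have hcircle : {u : S1 | D • u = 0}.Finite := AddCircle.finite_torsion (p := (1 : ℝ)) hD
    exact (Set.Finite.pi fun _ : Fin 2 => hcircle).subset fun y hy i _ => congrFun hy i
  have hmaps : MapsTo N.g S S := fun y hy => by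
    have hyj : ∀ j, D • y j = 0 := congrFun hy
    ext i
    simp [g, smul_comm D, hyj]
  have : Finite S := hfin
  obtain ⟨n, hn, hper⟩ := Function.Injective.mem_periodicPts
    (hmaps.restrict_inj.2 N.g_injective.injOn) ⟨x, hDx⟩
  refine ⟨n, hn, ?_⟩
  have := congrArg Subtype.val hper.eq
  rwa [hmaps.iterate_restrict] at this

theorem tendsto_alongU_pow_mul (x : T2) (u : ℝ) {a : ℝ} (ha : 0 ≤ a) (ha' : a < 1) :
    Tendsto (fun m : ℕ => N.alongU x (a ^ m * u)) atTop (𝓝 x) := by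
  have hzero := (tendsto_pow_atTop_nhds_zero_of_lt_one ha ha').mul_const u
  have := (N.continuous_alongU.tendsto (x, 0 * u)).comp (tendsto_const_nhds.prodMk_nhds hzero)
  simpa [alongU_zero, Function.comp_def] using this

-- The leaf meets the unstable leaf of a periodic point `x ∈ U`; backward iterates along the period
-- bring the intersection point close to `x`.
theorem exists_along_mem {y : T2} (hy : N.g y = y) {U : Set T2} (hU : IsOpen U)
    (hne : U.Nonempty) : ∃ s : ℝ, N.along y s ∈ U := by
  obtain ⟨x, hxU, hx⟩ := dense_setOf_isOfFinAddOrder.inter_open_nonempty U hU hne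
  obtain ⟨P, hP, hPx⟩ := N.mem_periodicPts_g hx
  obtain ⟨u, s, hus⟩ := N.exists_alongU_eq_along x y
  have hpow : N.lam⁻¹ ^ P < 1 :=
    pow_lt_one₀ N.lam_inv_pos.le (by linarith [N.lam_inv_lt]) hP.ne'
  obtain ⟨m, hm⟩ := ((N.tendsto_alongU_pow_mul x u (pow_nonneg N.lam_inv_pos.le P) hpow).eventually
    (hU.mem_nhds hxU)).exists
  have hxm : N.g^[P * m] x = x := hPx.mul_const m
  have hym : N.g^[P * m] y = y := Function.iterate_fixed hy _
  have heq : N.along y (N.lam ^ (P * m) * s) = N.alongU x ((N.lam⁻¹ ^ P) ^ m * u) := by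
    apply N.g_injective.iterate (P * m)
    have hlam : N.lam ^ (P * m) ≠ 0 := (pow_pos N.lam_pos _).ne'
    rw [iterate_g_along, iterate_g_alongU, hxm, hym, ← pow_mul, inv_pow,
      inv_mul_cancel_left₀ hlam, mul_inv_cancel_left₀ hlam, hus]
  exact ⟨_, heq ▸ hm⟩

end ToralAnosov

/-! ### Lifting the height -/

namespace KanMap

variable {k : ℕ} (K : KanMap k)

theorem τ_lt_succ (i : ℤ) : K.τ i < K.τ (i + 1) := K.τ_strictMono (by omega)

theorem τ_add_mul (i n : ℤ) : K.τ (i + n * k) = K.τ i + n := by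
  induction n using Int.induction_on with
  | zero => simp
  | succ n ih =>
    have := K.τ_period (i + n * k)
    rw [ih] at this
    rw [show i + (n + 1 : ℤ) * k = i + n * k + k by ring, this]
    push_cast; ring
  | pred n ih =>
    have := K.τ_period (i + (-n - 1) * k)
    rw [show i + (-n - 1 : ℤ) * k + k = i + -n * k by ring, ih] at this
    push_cast at this ⊢
    linarith

theorem t_add_mul (i n : ℤ) : K.t (i + n * k) = K.t i :=
  coe_eq_coe_iff.2 ⟨n, K.τ_add_mul i n⟩

theorem coe_eq_t_iff {a : ℝ} {i : ℤ} : (a : S1) = K.t i ↔ ∃ n : ℤ, a = K.τ (i + n * k) := by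
  unfold t
  simp_rw [coe_eq_coe_iff, K.τ_add_mul]

theorem exists_mem_Ico_τ (a : ℝ) : ∃ i, a ∈ Ico (K.τ i) (K.τ (i + 1)) := by
  have hbdd : ∃ b : ℤ, ∀ z : ℤ, K.τ z ≤ a → z ≤ b := by
    refine ⟨0 + ⌈a - K.τ 0⌉ * k, fun z hz => ?_⟩
    rw [← K.τ_strictMono.le_iff_le, K.τ_add_mul]
    linarith [Int.le_ceil (a - K.τ 0)]
  have hne : ∃ z : ℤ, K.τ z ≤ a := by
    refine ⟨0 + ⌊a - K.τ 0⌋ * k, ?_⟩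
    rw [K.τ_add_mul]
    linarith [Int.floor_le (a - K.τ 0)]
  obtain ⟨i, hi, hmax⟩ := Int.exists_greatest_of_bdd hbdd hne
  exact ⟨i, hi, not_le.1 fun h => by linarith [hmax _ h]⟩

theorem τ_succ_lt_add_one (hk : 1 < k) (i : ℤ) : K.τ (i + 1) < K.τ i + 1 := by
  rw [← K.τ_period]
  exact K.τ_strictMono (by omega)

theorem eq_of_coe_eq_of_mem_Ico (hk : 1 < k) {a b : ℝ} {i : ℤ}
    (ha : a ∈ Ico (K.τ i) (K.τ (i + 1))) (hb : b ∈ Ico (K.τ i) (K.τ (i + 1)))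
    (h : (a : S1) = (b : S1)) : a = b := by
  have := K.τ_succ_lt_add_one hk i
  exact eq_of_coe_eq_coe h (abs_lt.2 ⟨by linarith [ha.1, hb.2], by linarith [ha.2, hb.1]⟩)

section Levels

variable {H : ℝ → ℝ}

theorem notMem_range_τ_of_mem_Ioo (hrange : ∀ a, H a ∈ range K.τ → a ∈ range K.τ) {a : ℝ}
    {i : ℤ} (ha : a ∈ Ioo (K.τ i) (K.τ (i + 1))) (l : ℤ) : H a ≠ K.τ l := by
  intro h
  obtain ⟨m, rfl⟩ := hrange a ⟨l, h.symm⟩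
  have := K.τ_strictMono.lt_iff_lt.1 ha.1
  have := K.τ_strictMono.lt_iff_lt.1 ha.2
  omega

-- By the intermediate value theorem there is no level strictly between `H (τ i)` and
-- `H (τ (i + 1))`.
theorem exists_forall_eq_add_int (hc : Continuous H)
    (hrange : ∀ a, H a ∈ range K.τ → a ∈ range K.τ)
    (hk : 2 < k) (hτ : ∀ i, ∃ n : ℤ, H (K.τ i) = K.τ i + n) :
    ∃ n : ℤ, ∀ i, H (K.τ i) = K.τ i + n := by
  choose n hn using hτ
  have hstep : ∀ i, n (i + 1) = n i := fun i => by
    have hbetween : ∀ l ∈ uIcc (i + n i * k) (i + 1 + n (i + 1) * k),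
        l = i + n i * k ∨ l = i + 1 + n (i + 1) * k := fun l hl => by
      have hmem : K.τ l ∈ uIcc (H (K.τ i)) (H (K.τ (i + 1))) := by
        rw [hn, hn, ← K.τ_add_mul, ← K.τ_add_mul]
        exact K.τ_strictMono.monotone.mapsTo_uIcc hl
      obtain ⟨a, ha, hal⟩ := intermediate_value_uIcc hc.continuousOn hmem
      rw [uIcc_of_le (K.τ_lt_succ i).le] at ha
      rcases ha.1.eq_or_lt with rfl | ha1
      · exact .inl (K.τ_strictMono.injective (by rw [← hal, hn, K.τ_add_mul]))
      rcases ha.2.eq_or_lt with rfl | ha2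
      · exact .inr (K.τ_strictMono.injective (by rw [← hal, hn, K.τ_add_mul]))
      · exact absurd hal (K.notMem_range_τ_of_mem_Ioo hrange ⟨ha1, ha2⟩ l)
    rcases lt_trichotomy (n (i + 1)) (n i) with h | h | h
    · have : n (i + 1) * k + k ≤ n i * k := by nlinarith
      have := hbetween (i + n i * k - 1) (mem_uIcc.2 (.inr ⟨by omega, by omega⟩))
      omega
    · exact h
    · have : n i * k + k ≤ n (i + 1) * k := by nlinarith
      have := hbetween (i + n i * k + 1) (mem_uIcc.2 (.inl ⟨by omega, by omega⟩))
      omega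
  have hall : ∀ i, n i = n 0 := fun i => by
    induction i using Int.induction_on with
    | zero => rfl
    | succ i ih => rw [hstep, ih]
    | pred i ih => rw [← ih, ← hstep, sub_add_cancel]
  exact ⟨n 0, fun i => by rw [hn, hall]⟩

theorem τ_lt_apply_of_τ_lt (hc : Continuous H)
    (hrange : ∀ a, H a ∈ range K.τ → a ∈ range K.τ)
    (hfix : ∀ i, H (K.τ i) = K.τ i) {a : ℝ} {i : ℤ} (h : K.τ i < a) :
    K.τ i < H a := by
  obtain ⟨l, hl, hl'⟩ := K.exists_mem_Ico_τ a
  rcases hl.eq_or_lt with rfl | hla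
  · rwa [hfix]
  by_contra! hle
  have hil : K.τ i ≤ K.τ l :=
    K.τ_strictMono.monotone (Int.lt_add_one_iff.1 (K.τ_strictMono.lt_iff_lt.1 (h.trans hl')))
  have hmem : K.τ l ∈ Ico (H a) (H (K.τ (l + 1))) :=
    ⟨hle.trans hil, by rw [hfix]; exact K.τ_lt_succ l⟩
  obtain ⟨b, hb, hbl⟩ := intermediate_value_Ico hl'.le hc.continuousOn hmem
  exact K.notMem_range_τ_of_mem_Ioo hrange ⟨hla.trans_le hb.1, hb.2⟩ l hbl

theorem apply_lt_τ_of_lt_τ (hc : Continuous H)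
    (hrange : ∀ a, H a ∈ range K.τ → a ∈ range K.τ)
    (hfix : ∀ i, H (K.τ i) = K.τ i) {a : ℝ} {i : ℤ} (h : a < K.τ i) :
    H a < K.τ i := by
  obtain ⟨l, hl, hl'⟩ := K.exists_mem_Ico_τ a
  by_contra! hle
  have hil : K.τ (l + 1) ≤ K.τ i :=
    K.τ_strictMono.monotone (Int.add_one_le_iff.2 (K.τ_strictMono.lt_iff_lt.1 (hl.trans_lt h)))
  have hmem : K.τ (l + 1) ∈ Ioc (H (K.τ l)) (H a) :=
    ⟨by rw [hfix]; exact K.τ_lt_succ l, hil.trans hle⟩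
  obtain ⟨b, hb, hbl⟩ := intermediate_value_Ioc hl hc.continuousOn hmem
  exact K.notMem_range_τ_of_mem_Ioo hrange ⟨hb.1, hb.2.trans_lt hl'⟩ (l + 1) hbl

end Levels

end KanMap

/-- `h` is a lift to `T² × ℝ` of the second coordinate of `f`, normalized to fix the levels `τ i`
and to preserve the order with respect to them. -/
structure IsHeightLift {k : ℕ} (K : KanMap k) (f : T3 → T3) (h : T2 × ℝ → ℝ) : Prop where
  continuous : Continuous h
  coe_eq : ∀ z, (h z : S1) = (f (cyc z)).2
  fix : ∀ x i, h (x, K.τ i) = K.τ i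
  lt_of_lt : ∀ z i, z.2 < K.τ i → h z < K.τ i
  lt_of_gt : ∀ z i, K.τ i < z.2 → K.τ i < h z

section HeightLift

variable {k : ℕ} {K : KanMap k}

theorem IsHeightLift.mem_Ico {f : T3 → T3} {h : T2 × ℝ → ℝ} (H : IsHeightLift K f h)
    {z : T2 × ℝ} {i : ℤ} (hz : z.2 ∈ Ico (K.τ i) (K.τ (i + 1))) :
    h z ∈ Ico (K.τ i) (K.τ (i + 1)) := by
  obtain ⟨x, a⟩ := z
  refine ⟨?_, H.lt_of_lt _ _ hz.2⟩
  rcases hz.1.eq_or_lt with rfl | hlt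
  · exact (H.fix x i).ge
  · exact (H.lt_of_gt _ _ hlt).le

theorem IsHeightLift.apply_eq_of_eq (hk : 1 < k) {f f' : T3 → T3} {h h' : T2 × ℝ → ℝ}
    (H : IsHeightLift K f h) (H' : IsHeightLift K f' h') {z : T2 × ℝ}
    (e : f (cyc z) = f' (cyc z)) : h z = h' z := by
  obtain ⟨i, hi⟩ := K.exists_mem_Ico_τ z.2
  exact K.eq_of_coe_eq_of_mem_Ico hk (H.mem_Ico hi) (H'.mem_Ico hi) (by rw [H.coe_eq, H'.coe_eq, e])

theorem exists_isHeightLift_of_lift (hk : 1 < k) {F : T3 → T3} {H : E3 → ℝ} (hc : Continuous H)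
    (hcoe : ∀ v, (H v : S1) = (F (proj v)).2) (hfix : ∀ v i, H (v, K.τ i) = K.τ i)
    (hrange : ∀ v a, H (v, a) ∈ range K.τ → a ∈ range K.τ) :
    ∃ h : T2 × ℝ → ℝ, IsHeightLift K F h ∧ ∀ v a, h (proj2 v, a) = H (v, a) := by
  have hcv : ∀ v, Continuous fun a => H (v, a) := fun v => hc.comp (by fun_prop)
  have hlt : ∀ v i, v.2 < K.τ i → H v < K.τ i := fun v _ =>
    K.apply_lt_τ_of_lt_τ (hcv v.1) (hrange v.1) (hfix v.1)
  have hgt : ∀ v i, K.τ i < v.2 → K.τ i < H v := fun v _ =>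
    K.τ_lt_apply_of_τ_lt (hcv v.1) (hrange v.1) (hfix v.1)
  have hIco : ∀ v a i, a ∈ Ico (K.τ i) (K.τ (i + 1)) → H (v, a) ∈ Ico (K.τ i) (K.τ (i + 1)) :=
    fun v a i ha => ⟨ha.1.eq_or_lt.elim (fun h => h ▸ (hfix v i).ge) fun h => (hgt (v, a) i h).le,
      hlt (v, a) _ ha.2⟩
  have hq : IsOpenQuotientMap (Prod.map proj2 (id : ℝ → ℝ)) :=
    isOpenQuotientMap_proj2.prodMap IsOpenQuotientMap.id
  let q : C(E3, T2 × ℝ) := ⟨Prod.map proj2 id, hq.continuous⟩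
  have hinv : ∀ v w, q v = q w → H v = H w := fun ⟨v, a⟩ ⟨w, b⟩ hvw => by
    obtain ⟨hv : proj2 v = proj2 w, rfl : a = b⟩ := Prod.mk.inj hvw
    obtain ⟨i, hi⟩ := K.exists_mem_Ico_τ a
    refine K.eq_of_coe_eq_of_mem_Ico hk (hIco v a i hi) (hIco w a i hi) ?_
    rw [hcoe, hcoe, proj, proj, hv]
  let h := Topology.IsQuotientMap.lift (f := q) hq.isQuotientMap ⟨H, hc⟩ hinv
  have hh : ∀ v, h (q v) = H v :=
    DFunLike.congr_fun (Topology.IsQuotientMap.lift_comp (f := q) hq.isQuotientMap ⟨H, hc⟩ hinv)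
  refine ⟨h, ⟨h.continuous, ?_, ?_, ?_, ?_⟩, fun v a => hh (v, a)⟩
  · exact hq.surjective.forall.2 fun v => (congrArg _ (hh v)).trans (hcoe v)
  · exact isOpenQuotientMap_proj2.surjective.forall.2 fun v i => (hh _).trans (hfix v i)
  · exact hq.surjective.forall.2 fun v i hv => (hh v).trans_lt (hlt v i hv)
  · exact hq.surjective.forall.2 fun v i hv => (hgt v i hv).trans_eq (hh v).symm

variable {f : TorusDiffeo}

theorem apply_mem_torus_iff (hf : ∀ i, f '' K.torus i = K.torus i) (z : T3) (i : ℤ) :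
    f z ∈ K.torus i ↔ z ∈ K.torus i := by
  nth_rw 1 [← hf i]
  exact f.toPerm.injective.mem_set_image

theorem exists_lift_eq_τ_iff (hf : ∀ i, f '' K.torus i = K.torus i) (v : E3) (i : ℤ) :
    (∃ n : ℤ, (f.lift v).2 = K.τ (i + n * k)) ↔ ∃ n : ℤ, v.2 = K.τ (i + n * k) := by
  have := apply_mem_torus_iff hf (proj v) i
  rw [← f.proj_lift] at this
  rwa [← K.coe_eq_t_iff, ← K.coe_eq_t_iff]

theorem mem_range_τ_of_lift_sub_int (hf : ∀ i, f '' K.torus i = K.torus i) {v : E3} {n : ℤ}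
    (h : (f.lift v).2 - n ∈ range K.τ) :
    v.2 ∈ range K.τ := by
  obtain ⟨l, hl⟩ := h
  obtain ⟨m, hm⟩ := (exists_lift_eq_τ_iff hf v l).1 ⟨n, by rw [K.τ_add_mul, hl, sub_add_cancel]⟩
  exact ⟨_, hm.symm⟩

theorem exists_lift_eq_add_int (hf : ∀ i, f '' K.torus i = K.torus i) (hk : 2 < k) :
    ∃ n : ℤ, ∀ x i, (f.lift (x, K.τ i)).2 = K.τ i + n := by
  have hvert : ∀ x : E2, ∃ n : ℤ, ∀ i, (f.lift (x, K.τ i)).2 = K.τ i + n := fun x => by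
    refine K.exists_forall_eq_add_int (H := fun a => (f.lift (x, a)).2)
      (continuous_snd.comp (f.lift_smooth.continuous.comp (by fun_prop))) (fun a ha => ?_) hk
      fun i => ?_
    · exact mem_range_τ_of_lift_sub_int hf (v := (x, a)) (n := 0) (by simpa using ha)
    · obtain ⟨n, hn⟩ := (exists_lift_eq_τ_iff hf (x, K.τ i) i).2 ⟨0, by simp⟩
      exact ⟨n, by rw [hn, K.τ_add_mul]⟩
  choose n hn using hvert
  have hcont : Continuous fun x : E2 => (n x : ℝ) := by
    have : (fun x : E2 => (n x : ℝ)) = fun x => (f.lift (x, K.τ 0)).2 - K.τ 0 := by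
      ext x; rw [hn]; ring
    rw [this]
    exact (continuous_snd.comp (f.lift_smooth.continuous.comp (by fun_prop))).sub continuous_const
  have hconst : ∀ x, n x = n 0 := fun x => by
    have := (countable_range ((↑) : ℤ → ℝ)).isTotallyDisconnected (range fun x => (n x : ℝ))
      (range_subset_iff.2 fun x => ⟨n x, rfl⟩) (isPreconnected_range hcont) ⟨x, rfl⟩ ⟨0, rfl⟩
    exact Int.cast_injective this
  exact ⟨n 0, fun x i => by rw [hn, hconst]⟩

theorem exists_isHeightLift (hf : ∀ i, f '' K.torus i = K.torus i) (hk : 2 < k) :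
    ∃ h : T2 × ℝ → ℝ, IsHeightLift K f h ∧
      ∃ n : ℤ, ∀ (v : E2) (a : ℝ), h (proj2 v, a) = (f.lift (v, a)).2 - n := by
  obtain ⟨n, hn⟩ := exists_lift_eq_add_int hf hk
  obtain ⟨h, H, hh⟩ := exists_isHeightLift_of_lift (by omega) (F := f)
    (H := fun v => (f.lift v).2 - n)
    ((continuous_snd.comp f.lift_smooth.continuous).sub continuous_const)
    (fun v => by
      rw [← f.proj_lift]
      exact coe_eq_coe_iff.2 ⟨-n, by simp [sub_eq_add_neg]⟩)
    (fun v i => by simp [hn]) (fun v a => mem_range_τ_of_lift_sub_int hf (v := (v, a)))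
  exact ⟨h, H, n, hh⟩

end HeightLift

/-! ### Periodicity of the named points and separation of the balls -/

namespace KanMap

theorem two_lt {k : ℕ} (K : KanMap k) (hk6 : 6 ∣ k) : 2 < k := by
  have hk : k ≠ 0 := by
    rintro rfl
    simpa using K.τ_period 0
  have := Nat.le_of_dvd (Nat.pos_of_ne_zero hk) hk6
  omega

variable {k : ℕ} (K : KanMap k)

theorem periodic_q : Function.Periodic K.q 2 := fun i => by
  have h₀ := K.p_q (i - 1)
  have h₁ := K.q_p (i - 1)
  have h₂ := K.p_q (i + 1)
  ring_nf at h₀ h₁ h₂ ⊢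
  rw [← h₂, ← h₁]

theorem periodic_r0 : Function.Periodic K.r0 3 := fun i => by
  have h₀ := K.r1_r0 (i + 2)
  have h₁ := K.rm_r1 (i - 1)
  have h₂ := K.r0_rm (i - 1)
  ring_nf at h₀ h₁ h₂ ⊢
  rw [← h₀, ← h₁, ← h₂]

theorem q_add_mul (hk6 : 6 ∣ k) (i n : ℤ) : K.q (i + n * k) = K.q i := by
  obtain ⟨m, rfl⟩ := hk6
  rw [← K.periodic_q.int_mul (n * (3 * m)) i]
  congr 1; push_cast; ring

theorem r0_add_mul (hk6 : 6 ∣ k) (i n : ℤ) : K.r0 (i + n * k) = K.r0 i := by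
  obtain ⟨m, rfl⟩ := hk6
  rw [← K.periodic_r0.int_mul (n * (2 * m)) i]
  congr 1; push_cast; ring

theorem R0_add_mul (hk6 : 6 ∣ k) (i n : ℤ) : K.R0 (i + n * k) = K.R0 i := by
  simp only [R0, K.r0_add_mul hk6, K.t_add_mul]

theorem Q_add_mul (hk6 : 6 ∣ k) (i n : ℤ) : K.Q (i + n * k) = K.Q i := by
  simp only [Q, K.q_add_mul hk6, K.t_add_mul]

theorem q_eq_q_or_eq_p (i l : ℤ) : K.q i = K.q l ∨ K.q i = K.p l := by
  rcases Int.even_or_odd' (i - l) with ⟨n, hn | hn⟩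
  · left
    rw [← K.periodic_q.int_mul n l]
    congr 1; push_cast; linarith
  · right
    rw [K.p_q, ← K.periodic_q.int_mul n (l + 1)]
    congr 1; push_cast; linarith

theorem g_p (i : ℤ) : K.N.g (K.p i) = K.p i := K.named_fixed i _ (by simp)

theorem g_q (i : ℤ) : K.N.g (K.q i) = K.q i := K.named_fixed i _ (by simp)

theorem g_rm (i : ℤ) : K.N.g (K.rm i) = K.rm i := K.named_fixed i _ (by simp)

theorem g_r0 (i : ℤ) : K.N.g (K.r0 i) = K.r0 i := K.named_fixed i _ (by simp)

theorem g_r1 (i : ℤ) : K.N.g (K.r1 i) = K.r1 i := K.named_fixed i _ (by simp)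

theorem fst_f₀ (z : T3) : (K.f₀ z).1 = K.N.g z.1 := by
  rw [← Prod.mk.eta (p := z), K.fibered]

theorem image_torus (i : ℤ) : K.f₀ '' K.torus i = K.torus i := by
  have hmk : ∀ x, K.f₀ (x, K.t i) = (K.N.g x, K.t i) := fun x => by
    rw [K.fibered, t, K.φ_fix]
  refine Subset.antisymm ?_ ?_
  · rintro _ ⟨⟨x, _⟩, rfl, rfl⟩
    exact congrArg Prod.snd (hmk x)
  · rintro ⟨x, _⟩ rfl
    obtain ⟨y, hy⟩ := K.f₀.toPerm.surjective (x, K.t i)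
    exact ⟨(y.1, K.t i), rfl, by rw [hmk, ← K.fst_f₀, hy]⟩

end KanMap

namespace FirstModification

variable {k : ℕ} {K : KanMap k} (M : FirstModification K)

theorem ε_pos : 0 < M.ε := by linarith [M.ε'_pos, M.ε'_le]

theorem ε_lt (hk : 1 < k) : M.ε < 1 / 10 := by
  linarith [M.ε_tori 0, K.τ_succ_lt_add_one hk 0]

theorem lt_abs_τ_sub {a b : ℤ} (h : a ≠ b) : 10 * M.ε < |K.τ a - K.τ b| := by
  wlog hab : b < a generalizing a b
  · rw [abs_sub_comm]; exact this h.symm (by omega)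
  have hle : K.τ (b + 1) ≤ K.τ a := K.τ_strictMono.monotone (by omega)
  rw [abs_of_pos (by linarith [K.τ_lt_succ b])]
  linarith [M.ε_tori b]

theorem eq_add_mul_or_lt_norm_t_sub (l i : ℤ) :
    (∃ n : ℤ, l = i + n * k) ∨ 10 * M.ε < ‖K.t l - K.t i‖ := by
  unfold KanMap.t
  rw [← AddCircle.coe_sub, UnitAddCircle.norm_eq, sub_sub, ← K.τ_add_mul]
  by_cases h : l = i + round (K.τ l - K.τ i) * k
  · exact .inl ⟨_, h⟩
  · exact .inr (M.lt_abs_τ_sub h)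

theorem R0_eq_or_lt_dist3 (hk6 : 6 ∣ k) (l i : ℤ) :
    K.R0 l = K.R0 i ∨ 10 * M.ε < dist3 (K.R0 l) (K.R0 i) := by
  rcases M.eq_add_mul_or_lt_norm_t_sub l i with ⟨n, rfl⟩ | h
  · exact .inl (K.R0_add_mul hk6 i n)
  · exact .inr (h.trans_le (norm_snd_sub_le_dist3 (K.R0 l) (K.R0 i)))

theorem lt_dist2_p_r0 (i : ℤ) : 10 * M.ε < dist2 (K.p i) (K.r0 i) :=
  List.rel_of_pairwise_cons (M.ε_points i) (by simp)

theorem lt_dist2_q_r0 (i : ℤ) : 10 * M.ε < dist2 (K.q i) (K.r0 i) :=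
  List.rel_of_pairwise_cons (M.ε_points i).of_cons (by simp)

theorem lt_dist2_rm_r0 (i : ℤ) : 10 * M.ε < dist2 (K.rm i) (K.r0 i) :=
  List.rel_of_pairwise_cons (M.ε_points i).of_cons.of_cons (by simp)

theorem lt_dist2_r1_r0 (i : ℤ) : 10 * M.ε < dist2 (K.r1 i) (K.r0 i) := by
  rw [dist2_comm]
  exact List.rel_of_pairwise_cons (M.ε_points i).of_cons.of_cons.of_cons (by simp)

theorem lt_dist2_q_r0' (i l : ℤ) : 10 * M.ε < dist2 (K.q i) (K.r0 l) := by
  rcases K.q_eq_q_or_eq_p i l with h | h <;> rw [h]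
  · exact M.lt_dist2_q_r0 l
  · exact M.lt_dist2_p_r0 l

/-- The point `z` is outside the balls in which `f₁` differs from `f₀`. -/
def Far (z : T3) : Prop := ∀ i, z ∉ ball3 (K.R0 i) M.ε

theorem not_far_iff {z : T3} : ¬ M.Far z ↔ ∃ i, dist3 z (K.R0 i) < M.ε := by
  simp [Far, ball3]

theorem le_dist3_of_far {z : T3} (h : M.Far z) (i : ℤ) : M.ε ≤ dist3 z (K.R0 i) := not_lt.1 (h i)

theorem f₁_eq {z : T3} (h : M.Far z) : M.f₁ z = K.f₀ z := M.eq_outside z h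

theorem far_of_le_dist2 {z : T3} (h : ∀ l, M.ε ≤ dist2 z.1 (K.r0 l)) : M.Far z := fun l hl =>
  ((h l).trans (dist2_le_dist3 z (K.R0 l))).not_gt hl

theorem far_of_near_torus (hk6 : 6 ∣ k) {z : T3} {j : ℤ} (hz : M.ε ≤ dist2 z.1 (K.r0 j))
    (ht : ‖z.2 - K.t j‖ ≤ 5 * M.ε) : M.Far z := by
  intro l hl
  rcases M.eq_add_mul_or_lt_norm_t_sub l j with ⟨n, rfl⟩ | hlj
  · rw [K.R0_add_mul hk6] at hl
    exact (hz.trans (dist2_le_dist3 z (K.R0 j))).not_gt hl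
  · have hzl : ‖z.2 - K.t l‖ < M.ε := (norm_snd_sub_le_dist3 z (K.R0 l)).trans_lt hl
    have htri := norm_sub_le_norm_sub_add_norm_sub (K.t l) z.2 (K.t j)
    rw [norm_sub_rev (K.t l) z.2] at htri
    linarith [M.ε_pos]

theorem dist3_lt_or_lt_of_not_far (hk6 : 6 ∣ k) {z : T3} (h : ¬ M.Far z) (i : ℤ) :
    dist3 z (K.R0 i) < M.ε ∨ 9 * M.ε < dist3 z (K.R0 i) := by
  obtain ⟨l, hl⟩ := M.not_far_iff.1 h
  rcases M.R0_eq_or_lt_dist3 hk6 l i with hli | hli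
  · exact .inl (hli ▸ hl)
  · have := dist3_triangle (K.R0 l) z (K.R0 i)
    rw [dist3_comm _ z] at this
    exact .inr (by linarith)

/-! ### The drift of the modified map along the stable direction -/

theorem far_along_two_mul (hk6 : 6 ∣ k) {z : T3} {i : ℤ} (hz : dist3 z (K.R0 i) < M.ε) :
    M.Far (K.N.along z.1 (2 * M.ε), z.2) := by
  have hε := M.ε_pos
  have hε' := M.ε_lt ((K.two_lt hk6).trans' one_lt_two)
  set w : T3 := (K.N.along z.1 (2 * M.ε), z.2)
  have habs : |2 * M.ε| = 2 * M.ε := abs_of_pos (by linarith)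
  have hwz : dist3 w z = 2 * M.ε := by rw [K.N.dist3_along z (by linarith), habs]
  have hlow := dist3_triangle w (K.R0 i) z
  have hupp := dist3_triangle w z (K.R0 i)
  rw [dist3_comm (K.R0 i)] at hlow
  by_contra hfar
  rcases M.dist3_lt_or_lt_of_not_far hk6 hfar i with h | h <;> linarith

/-- The map `f₀⁻¹ ∘ f₁`, which is the identity outside the balls of radius `ε` around the points
`r^i_0` and preserves the leaves of the centre-stable foliation. -/
def slide (z : T3) : T3 := K.f₀.toPerm.symm (M.f₁ z)

theorem continuous_slide : Continuous M.slide :=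
  K.f₀.continuous_symm.comp M.f₁.continuous

theorem f₀_slide (z : T3) : K.f₀ (M.slide z) = M.f₁ z := K.f₀.toPerm.apply_symm_apply _

theorem slide_eq_self {z : T3} (h : M.Far z) : M.slide z = z := by
  rw [slide, M.f₁_eq h, Equiv.symm_apply_apply]

theorem not_far_slide {z : T3} (h : ¬ M.Far z) : ¬ M.Far (M.slide z) := fun hs => by
  have hfix : M.slide z = z :=
    M.f₁.toPerm.injective ((M.f₁_eq hs).trans (M.f₀_slide z))
  exact h (hfix ▸ hs)

theorem exists_fst_slide_eq_along (hk6 : 6 ∣ k) (z : T3) :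
    ∃ s, (M.slide z).1 = K.N.along z.1 s := by
  obtain ⟨r, hr⟩ : ∃ r, M.Far (K.N.along z.1 r, z.2) := by
    by_cases h : M.Far z
    · exact ⟨0, by rwa [K.N.along_zero]⟩
    · obtain ⟨i, hi⟩ := M.not_far_iff.1 h
      exact ⟨_, M.far_along_two_mul hk6 hi⟩
  have hmem : M.f₁ (K.N.along z.1 r, z.2) ∈ K.N.csLeaf (M.f₁ z) := by
    rw [← M.leaf]; exact mem_image_of_mem _ ⟨r, rfl⟩
  rw [M.f₁_eq hr, K.fibered, ← M.f₀_slide] at hmem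
  obtain ⟨s, hs⟩ := hmem
  simp only [K.N.g_along, K.fst_f₀] at hs
  refine ⟨r - K.N.lam * s, K.N.g_injective ?_⟩
  rw [K.N.g_along, mul_sub, inv_mul_cancel_left₀ K.N.lam_pos.ne', sub_eq_add_neg,
    ← K.N.along_along, hs, K.N.along_along, add_neg_cancel, K.N.along_zero]

theorem exists_leaf_path (hk6 : 6 ∣ k) (z : T3) {r₀ : ℝ} (h₀ : M.Far (K.N.along z.1 r₀, z.2)) :
    ∃ μ : ℝ → ℝ, Continuous μ ∧ μ r₀ = r₀ ∧
      ∀ r, (M.slide (K.N.along z.1 r, z.2)).1 = K.N.along z.1 (μ r) := by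
  obtain ⟨⟨v, a⟩, rfl⟩ := isOpenQuotientMap_proj.surjective z
  obtain ⟨G, hG, hGp⟩ := K.f₀.inv_smooth
  let P : ℝ → E2 := fun r => (G (M.f₁.lift (v + r • K.N.es, a))).1
  have hP : Continuous P :=
    continuous_fst.comp (hG.continuous.comp (M.f₁.lift_smooth.continuous.comp (by fun_prop)))
  have hPslide : ∀ r, proj2 (P r) = (M.slide (K.N.along (proj2 v) r, (a : S1))).1 := fun r => by
    rw [slide, ToralAnosov.along, ← proj2_add]
    exact congrArg Prod.fst ((hGp _).trans (congrArg _ (M.f₁.proj_lift _)))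
  obtain ⟨μ, hμ, hμ₀, hμP⟩ := K.N.exists_continuous_along hP (x := proj2 v) (r₀ := r₀) (s₀ := r₀)
    (fun r => by
      obtain ⟨s, hs⟩ := M.exists_fst_slide_eq_along hk6 (K.N.along (proj2 v) r, (a : S1))
      exact ⟨r + s, by rw [hPslide, hs, K.N.along_along]⟩)
    ((hPslide r₀).trans (congrArg Prod.fst (M.slide_eq_self h₀)))
  exact ⟨μ, hμ, hμ₀, fun r => (hPslide r).symm.trans (hμP r)⟩

theorem dist3_slide_along_le_or_lt (hk6 : 6 ∣ k) {z : T3} {i : ℤ} (hz : dist3 z (K.R0 i) < M.ε)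
    {r : ℝ} (hr : r ∈ Icc 0 (2 * M.ε)) :
    dist3 (M.slide (K.N.along z.1 r, z.2)) (K.R0 i) ≤ 3 * M.ε ∨
      9 * M.ε < dist3 (M.slide (K.N.along z.1 r, z.2)) (K.R0 i) := by
  by_cases h : M.Far (K.N.along z.1 r, z.2)
  · left
    rw [M.slide_eq_self h]
    have := dist3_triangle (K.N.along z.1 r, z.2) z (K.R0 i)
    have := K.N.dist3_along_le z r
    rw [abs_of_nonneg hr.1] at this
    linarith [hr.2]
  · exact (M.dist3_lt_or_lt_of_not_far hk6 (M.not_far_slide h) i).imp_left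
      fun h => by linarith [M.ε_pos]

-- The image of the path from `z` to the fixed point at distance `2 ε` cannot jump over the gap
-- between the balls.
theorem dist3_slide_along_le (hk6 : 6 ∣ k) {z : T3} {i : ℤ} (hz : dist3 z (K.R0 i) < M.ε)
    {r : ℝ} (hr : r ∈ Icc 0 (2 * M.ε)) :
    dist3 (M.slide (K.N.along z.1 r, z.2)) (K.R0 i) ≤ 3 * M.ε := by
  have hε := M.ε_pos
  let d : ℝ → ℝ := fun r => dist3 (M.slide (K.N.along z.1 r, z.2)) (K.R0 i)
  have hd : Continuous d := (continuous_dist3 _).comp (M.continuous_slide.comp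
    ((K.N.continuous_along.comp (by fun_prop : Continuous fun r : ℝ => (z.1, r))).prodMk
      continuous_const))
  have hend : d (2 * M.ε) ≤ 3 * M.ε := by
    have htri := dist3_triangle (K.N.along z.1 (2 * M.ε), z.2) z (K.R0 i)
    have hle := K.N.dist3_along_le z (2 * M.ε)
    rw [abs_of_pos (by linarith)] at hle
    simp only [d, M.slide_eq_self (M.far_along_two_mul hk6 hz)]
    linarith
  refine (M.dist3_slide_along_le_or_lt hk6 hz hr).resolve_right fun h => ?_
  obtain ⟨r', hr', he⟩ := intermediate_value_Icc' hr.2 hd.continuousOn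
    (show 5 * M.ε ∈ Icc (d (2 * M.ε)) (d r) from ⟨by linarith, by simp only [d]; linarith⟩)
  rcases M.dist3_slide_along_le_or_lt hk6 hz ⟨hr.1.trans hr'.1, hr'.2⟩ with h | h <;>
    linarith [show dist3 (M.slide (K.N.along z.1 r', z.2)) (K.R0 i) = 5 * M.ε from he]

theorem dist3_slide_lt (hk6 : 6 ∣ k) {z : T3} {i : ℤ} (hz : dist3 z (K.R0 i) < M.ε) :
    dist3 (M.slide z) (K.R0 i) < M.ε := by
  have hε := M.ε_pos
  have hle := M.dist3_slide_along_le hk6 hz (r := 0) ⟨le_rfl, by linarith⟩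
  rw [K.N.along_zero] at hle
  have hslide := M.not_far_slide (M.not_far_iff.2 ⟨i, hz⟩)
  exact (M.dist3_lt_or_lt_of_not_far hk6 hslide i).resolve_right
    (by linarith)

theorem exists_abs_le_five_mul_fst_slide_eq_along (hk6 : 6 ∣ k) {z : T3} {i : ℤ}
    (hz : dist3 z (K.R0 i) < M.ε) :
    ∃ s, |s| ≤ 5 * M.ε ∧ (M.slide z).1 = K.N.along z.1 s := by
  have hε := M.ε_pos
  have hε' := M.ε_lt ((K.two_lt hk6).trans' one_lt_two)
  obtain ⟨μ, hμ, hμ₀, hμs⟩ := M.exists_leaf_path hk6 z (M.far_along_two_mul hk6 hz)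
  refine ⟨μ 0, ?_, by rw [← hμs, K.N.along_zero]⟩
  have hdist : ∀ r ∈ Icc 0 (2 * M.ε), dist2 (K.N.along z.1 (μ r)) z.1 ≤ 4 * M.ε := fun r hr => by
    have hle := M.dist3_slide_along_le hk6 hz hr
    have htri := dist3_triangle (M.slide (K.N.along z.1 r, z.2)) (K.R0 i) z
    rw [dist3_comm (K.R0 i)] at htri
    rw [← hμs r]
    linarith [dist2_le_dist3 (M.slide (K.N.along z.1 r, z.2)) z]
  by_contra! h
  have hend : |μ (2 * M.ε)| ≤ 5 * M.ε := by rw [hμ₀, abs_of_pos] <;> linarith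
  obtain ⟨r, hr, he : |μ r| = 5 * M.ε⟩ := intermediate_value_Icc' (by linarith : 0 ≤ 2 * M.ε)
    hμ.abs.continuousOn ⟨hend, h.le⟩
  have := hdist r hr
  rw [K.N.dist2_along _ (by linarith), he] at this
  linarith

theorem exists_abs_le_two_mul_fst_slide_eq_along (hk6 : 6 ∣ k) (z : T3) :
    ∃ s, |s| ≤ 2 * M.ε ∧ (M.slide z).1 = K.N.along z.1 s := by
  have hε := M.ε_pos
  by_cases hfar : M.Far z
  · exact ⟨0, by rw [abs_zero]; linarith, by rw [M.slide_eq_self hfar, K.N.along_zero]⟩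
  obtain ⟨i, hz⟩ := M.not_far_iff.1 hfar
  obtain ⟨s, hs, hslide⟩ := M.exists_abs_le_five_mul_fst_slide_eq_along hk6 hz
  refine ⟨s, ?_, hslide⟩
  have hε' := M.ε_lt ((K.two_lt hk6).trans' one_lt_two)
  have htri := dist3_triangle (M.slide z) (K.R0 i) z
  rw [dist3_comm (K.R0 i)] at htri
  rw [← K.N.dist2_along z.1 (by linarith), ← hslide]
  linarith [dist2_le_dist3 (M.slide z) z, M.dist3_slide_lt hk6 hz]

theorem exists_drift (hk6 : 6 ∣ k) (z : T3) :
    ∃ e : ℝ, |e| ≤ 2 / 5 * M.ε ∧ (M.f₁ z).1 = K.N.along (K.N.g z.1) e := by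
  obtain ⟨s, hs, hslide⟩ := M.exists_abs_le_two_mul_fst_slide_eq_along hk6 z
  refine ⟨K.N.lam⁻¹ * s, ?_, by rw [← K.N.g_along, ← hslide, ← K.fst_f₀, M.f₀_slide]⟩
  have := K.N.lam_inv_lt
  rw [abs_mul, abs_of_pos K.N.lam_inv_pos]
  nlinarith [abs_nonneg s]

end FirstModification

/-! ### Time-one maps of vertical vector fields -/

section Vertical

variable {X : T3 → ℝ}

/-- `c` is an integral curve of `X ∂/∂t` on the line above `x`. -/
def IsVertCurve (X : T3 → ℝ) (x : T2) (c : ℝ → ℝ) : Prop :=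
  ∀ u, HasDerivAt c (X (x, (c u : S1))) u

theorem exists_lipschitzWith_vertical (hX : ContDiff ℝ ∞ fun v : E3 => X (proj v)) (x : T2) :
    ∃ C, LipschitzWith C fun a : ℝ => X (x, (a : S1)) := by
  obtain ⟨v, rfl⟩ := isOpenQuotientMap_proj2.surjective x
  set Ψ : ℝ → ℝ := fun a => X (proj2 v, (a : S1)) with hΨ
  have hsmooth : ContDiff ℝ ∞ Ψ := hX.comp (contDiff_const.prodMk contDiff_id)
  have hper : Function.Periodic Ψ 1 := fun a => by simp [hΨ]
  have hper' : Function.Periodic (deriv Ψ) 1 := fun a => by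
    rw [← deriv_comp_add_const]
    congr 1
    exact funext hper
  have hcont : Continuous (deriv Ψ) := hsmooth.continuous_deriv (by simp)
  obtain ⟨C, hC⟩ :=
    isCompact_Icc.exists_bound_of_continuousOn (hcont.continuousOn (s := Icc (0 : ℝ) 1))
  refine ⟨C.toNNReal,
    lipschitzWith_of_nnnorm_deriv_le (hsmooth.differentiable (by simp)) fun a => ?_⟩
  obtain ⟨b, hb, hab⟩ := hper'.exists_mem_Ico₀ one_pos a
  rw [hab, ← NNReal.coe_le_coe]
  exact (hC b ⟨hb.1, hb.2.le⟩).trans (Real.le_coe_toNNReal C)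

theorem continuous_of_contDiff_comp_proj (hX : ContDiff ℝ ∞ fun v : E3 => X (proj v)) :
    Continuous X :=
  isOpenQuotientMap_proj.isQuotientMap.continuous_iff.2 hX.continuous

namespace IsVertCurve

variable {x y : T2} {c c' : ℝ → ℝ}

theorem eq (hX : ContDiff ℝ ∞ fun v : E3 => X (proj v)) (hc : IsVertCurve X x c)
    (hc' : IsVertCurve X x c') {u : ℝ} (h : c u = c' u) : c = c' := by
  obtain ⟨C, hC⟩ := exists_lipschitzWith_vertical hX x
  exact ODE_solution_unique_univ (v := fun _ a => X (x, (a : S1))) (s := fun _ => univ) (K := C)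
    (fun _ => hC.lipschitzOnWith) (fun t => ⟨hc t, mem_univ _⟩) (fun t => ⟨hc' t, mem_univ _⟩) h

theorem add_int (hc : IsVertCurve X x c) (n : ℤ) : IsVertCurve X x fun u => c u + n := fun u => by
  have h : ((c u + n : ℝ) : S1) = (c u : S1) := coe_eq_coe_iff.2 ⟨n, rfl⟩
  rw [h]
  exact (hc u).add_const _

theorem comp_add (hc : IsVertCurve X x c) (r : ℝ) : IsVertCurve X x fun u => c (u + r) :=
  fun u => (hc (u + r)).comp_add_const u r

theorem const {a : ℝ} (h : X (x, (a : S1)) = 0) : IsVertCurve X x fun _ => a := fun u => by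
  rw [h]
  exact hasDerivAt_const _ _

theorem monotone (h0 : ∀ z, 0 ≤ X z) (hc : IsVertCurve X x c) : Monotone c :=
  monotone_of_deriv_nonneg (fun u => (hc u).differentiableAt) fun u => (hc u).deriv ▸ h0 _

theorem dist_le_gronwallBound (hc : IsVertCurve X x c) (hc' : IsVertCurve X y c') {C : NNReal}
    (hC : LipschitzWith C fun a : ℝ => X (y, (a : S1))) {r : ℝ}
    (hr : ∀ s, dist (X (x, s)) (X (y, s)) ≤ r) :
    dist (c 1) (c' 1) ≤ gronwallBound (dist (c 0) (c' 0)) C r 1 := by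
  have := dist_le_of_approx_trajectories_ODE (v := fun _ a => X (y, (a : S1)))
    (f := c) (g := c') (a := 0) (b := 1) (f' := fun u => X (x, (c u : S1)))
    (g' := fun u => X (y, (c' u : S1))) (fun _ => hC)
    (fun u _ => (hc u).continuousAt.continuousWithinAt) (fun u _ => (hc u).hasDerivWithinAt)
    (fun u _ => hr _) (fun u _ => (hc' u).continuousAt.continuousWithinAt)
    (fun u _ => (hc' u).hasDerivWithinAt) (fun u _ => (dist_self _).le) le_rfl 1 (by simp)
  rwa [add_zero, sub_zero] at this

theorem lt_of_pos (h0 : ∀ z, 0 ≤ X z) (hc : IsVertCurve X x c) (hpos : 0 < X (x, (c 0 : S1))) :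
    c 0 < c 1 := by
  have hmono := hc.monotone h0
  refine (hmono zero_le_one).lt_of_ne fun h => ?_
  have hconst : ∀ u ∈ Icc (0 : ℝ) 1, c u = c 0 := fun u hu =>
    le_antisymm ((hmono hu.2).trans h.ge) (hmono hu.1)
  have hmid : (1 / 2 : ℝ) ∈ Icc (0 : ℝ) 1 := by norm_num
  have hderiv : HasDerivAt c 0 (1 / 2) := (hasDerivAt_const (1 / 2 : ℝ) (c 0)).congr_of_eventuallyEq
    (eventually_of_mem (Icc_mem_nhds (by norm_num) (by norm_num)) hconst)
  have hzero := hderiv.unique (hc (1 / 2))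
  rw [hconst _ hmid] at hzero
  exact hpos.ne hzero

end IsVertCurve

/-- `h` is the second coordinate of the time-one map of the lift of `X ∂/∂t` to `T² × ℝ`. -/
def IsTimeOneLift (X : T3 → ℝ) (h : T2 × ℝ → ℝ) : Prop :=
  ∀ x a, ∃ c, IsVertCurve X x c ∧ c 0 = a ∧ c 1 = h (x, a)

theorem exists_isTimeOneLift {ρ : T3 → T3} (hρ : IsVerticalTimeOneMap X ρ) :
    ∃ h, IsTimeOneLift X h ∧ ∀ z, ρ (cyc z) = cyc (z.1, h z) := by
  choose c hc₀ hc hcρ using fun z : T2 × ℝ => hρ z.1 z.2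
  exact ⟨fun z => c z 1, fun x a => ⟨c (x, a), hc _, hc₀ _, rfl⟩, hcρ⟩

namespace IsTimeOneLift

variable {h : T2 × ℝ → ℝ}

theorem continuous (hX : ContDiff ℝ ∞ fun v : E3 => X (proj v)) (hh : IsTimeOneLift X h) :
    Continuous h := by
  refine continuous_iff_continuousAt.2 fun z₀ => tendsto_iff_dist_tendsto_zero.2 ?_
  obtain ⟨C, hC⟩ := exists_lipschitzWith_vertical hX z₀.1
  have hC' : LipschitzWith (C + 1) fun a : ℝ => X (z₀.1, (a : S1)) := hC.weaken (by simp)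
  have hC0 : ((C + 1 : NNReal) : ℝ) ≠ 0 := NNReal.coe_ne_zero.2 (by simp)
  let F : C(T2, C(S1, ℝ)) := (ContinuousMap.mk X (continuous_of_contDiff_comp_proj hX)).curry
  set bound : T2 × ℝ → ℝ := fun z =>
    gronwallBound (dist z.2 z₀.2) (C + 1 : NNReal) (dist (F z.1) (F z₀.1)) 1
  have hbound : ∀ z, dist (h z) (h z₀) ≤ bound z := fun z => by
    obtain ⟨c, hc, hc₀, hc₁⟩ := hh z.1 z.2
    obtain ⟨c', hc', hc'₀, hc'₁⟩ := hh z₀.1 z₀.2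
    rw [← hc₁, ← hc'₁]
    refine (hc.dist_le_gronwallBound hc' hC' fun s => ?_).trans_eq (by rw [hc₀, hc'₀])
    exact ContinuousMap.dist_apply_le_dist (f := F z.1) (g := F z₀.1) s
  have hcont : Continuous bound := by
    simp only [bound, gronwallBound_of_K_ne_0 hC0]
    fun_prop
  have hzero : bound z₀ = 0 := by simp only [bound, dist_self, gronwallBound_ε0_δ0]
  exact squeeze_zero (fun _ => dist_nonneg) hbound (hzero ▸ hcont.tendsto z₀)

theorem injective (hX : ContDiff ℝ ∞ fun v : E3 => X (proj v)) (hh : IsTimeOneLift X h) (x : T2) :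
    Function.Injective fun a => h (x, a) := fun a b hab => by
  obtain ⟨c, hc, rfl, hc₁⟩ := hh x a
  obtain ⟨c', hc', rfl, hc'₁⟩ := hh x b
  exact congrFun (hc.eq hX hc' (hc₁.trans (hab.trans hc'₁.symm))) 0

theorem surjective (hX : ContDiff ℝ ∞ fun v : E3 => X (proj v)) (hh : IsTimeOneLift X h) (x : T2) :
    Function.Surjective fun a => h (x, a) := fun a => by
  obtain ⟨c, hc, rfl, -⟩ := hh x a
  obtain ⟨c', hc', hc'₀, hc'₁⟩ := hh x (c (0 + -1))
  have heq := congrFun (hc'.eq hX (hc.comp_add (-1)) hc'₀) 1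
  rw [hc'₁, add_neg_cancel, zero_add] at heq
  exact ⟨_, heq⟩

theorem apply_add_int (hX : ContDiff ℝ ∞ fun v : E3 => X (proj v)) (hh : IsTimeOneLift X h)
    (x : T2) (a : ℝ) (n : ℤ) : h (x, a + n) = h (x, a) + n := by
  obtain ⟨c, hc, rfl, hc₁⟩ := hh x a
  obtain ⟨c', hc', hc'₀, hc'₁⟩ := hh x (c 0 + n)
  rw [← hc₁, ← hc'₁]
  exact congrFun (hc'.eq hX (hc.add_int n) hc'₀) 1

theorem strictMono (hX : ContDiff ℝ ∞ fun v : E3 => X (proj v)) (hh : IsTimeOneLift X h) (x : T2) :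
    StrictMono fun a => h (x, a) := by
  have hcont : Continuous fun a => h (x, a) := (hh.continuous hX).comp (by fun_prop)
  refine (hcont.strictMono_of_inj (hh.injective hX x)).resolve_right fun hanti => ?_
  have hlt := hanti (zero_lt_one (α := ℝ))
  have hadd := hh.apply_add_int hX x 0 1
  simp only [zero_add, Int.cast_one] at hlt hadd
  linarith

theorem le_apply (h0 : ∀ z, 0 ≤ X z) (hh : IsTimeOneLift X h) (z : T2 × ℝ) : z.2 ≤ h z := by
  obtain ⟨c, hc, hc₀, hc₁⟩ := hh z.1 z.2
  exact hc₀.ge.trans ((hc.monotone h0 zero_le_one).trans_eq hc₁)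

theorem apply_eq_snd (hX : ContDiff ℝ ∞ fun v : E3 => X (proj v)) (hh : IsTimeOneLift X h)
    {z : T2 × ℝ} (hz : X (cyc z) = 0) : h z = z.2 := by
  obtain ⟨c, hc, hc₀, hc₁⟩ := hh z.1 z.2
  exact hc₁.symm.trans (congrFun (hc.eq hX (IsVertCurve.const hz) hc₀) 1)

theorem lt_apply (h0 : ∀ z, 0 ≤ X z) (hh : IsTimeOneLift X h) {z : T2 × ℝ} (hz : 0 < X (cyc z)) :
    z.2 < h z := by
  obtain ⟨c, hc, hc₀, hc₁⟩ := hh z.1 z.2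
  rw [← hc₀]
  exact (hc.lt_of_pos h0 (hc₀.symm ▸ hz)).trans_eq hc₁

end IsTimeOneLift

theorem isOpenMap_of_isVerticalTimeOneMap {ρ : T3 → T3}
    (hX : ContDiff ℝ ∞ fun v : E3 => X (proj v)) (hρ : IsVerticalTimeOneMap X ρ) :
    IsOpenMap ρ := by
  obtain ⟨h, hh, hρh⟩ := exists_isTimeOneLift hρ
  have hcont : Continuous ρ := by
    rw [isOpenQuotientMap_cyc.isQuotientMap.continuous_iff, show ρ ∘ cyc = _ from funext hρh]
    exact continuous_cyc.comp (continuous_fst.prodMk (hh.continuous hX))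
  have hinj : Function.Injective ρ := fun z w hzw => by
    obtain ⟨⟨x, a⟩, rfl⟩ := isOpenQuotientMap_cyc.surjective z
    obtain ⟨⟨y, b⟩, rfl⟩ := isOpenQuotientMap_cyc.surjective w
    rw [hρh, hρh] at hzw
    obtain rfl : x = y := congrArg Prod.fst hzw
    obtain ⟨n, hn⟩ := coe_eq_coe_iff.1 (congrArg Prod.snd hzw)
    rw [← hh.apply_add_int hX] at hn
    exact Prod.ext rfl (coe_eq_coe_iff.2 ⟨n, hh.injective hX x hn⟩)
  have hsurj : Function.Surjective ρ := fun z => by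
    obtain ⟨⟨x, a⟩, rfl⟩ := isOpenQuotientMap_cyc.surjective z
    obtain ⟨b, rfl⟩ := hh.surjective hX x a
    exact ⟨cyc (x, b), hρh _⟩
  exact (hcont.homeoOfEquivCompactToT2 (f := Equiv.ofBijective ρ ⟨hinj, hsurj⟩)).isOpenMap

end Vertical

/-! ### The lift of the fibered map -/

theorem tendsto_of_tendsto_coe {ι : Type*} {l : Filter ι} {α β b : ℝ} (hαβ : β - α < 1)
    (hb : b ∈ Icc α β) {a : ι → ℝ} (ha : ∀ n, a n ∈ Icc α β)
    (h : Tendsto (fun n => (a n : S1)) l (𝓝 (b : S1))) : Tendsto a l (𝓝 b) := by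
  refine isCompact_Icc.tendsto_nhds_of_unique_mapClusterPt (Eventually.of_forall ha)
    fun y hy hcl => ?_
  have hcl' : MapClusterPt (y : S1) l (fun n => (a n : S1)) :=
    hcl.continuousAt_comp isOpenQuotientMap_coe.continuous.continuousAt
  have hyb : (y : S1) = (b : S1) := by
    by_contra hne
    have := hcl'.clusterPt.mono h
    rw [ClusterPt, (disjoint_nhds_nhds.2 hne).eq_bot] at this
    exact this.ne rfl
  exact eq_of_coe_eq_coe hyb (abs_lt.2 ⟨by linarith [hy.1, hb.2], by linarith [hy.2, hb.1]⟩)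

theorem lt_apply_of_tendsto_iterate {g : ℝ → ℝ} (hg : Monotone g) {a b : ℝ} (hab : a < b)
    (h : Tendsto (fun n => g^[n] a) atTop (𝓝 b)) : a < g a := by
  by_contra! hle
  exact hab.not_ge (le_of_tendsto' h fun n => hg.antitone_iterate_of_map_le hle n.zero_le)

theorem coe_mem_arc {a α β : ℝ} (h : a ∈ Ioo α β) : (a : S1) ∈ arc α β := mem_image_of_mem _ h

namespace KanMap

variable {k : ℕ} (K : KanMap k)

theorem τ_sub_one_lt (i : ℤ) : K.τ (i - 1) < K.τ i := K.τ_strictMono (sub_one_lt i)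

theorem p_sub_one (i : ℤ) : K.p (i - 1) = K.q i := by rw [K.p_q, sub_add_cancel]

theorem q_eq_p_add_one (i : ℤ) : K.q i = K.p (i + 1) := by
  simpa [show i - 1 + 2 = i + 1 by ring] using K.q_p (i - 1)

theorem r1_sub_one (i : ℤ) : K.r1 (i - 1) = K.r0 i := by rw [K.r1_r0, sub_add_cancel]

theorem rm_add_one (i : ℤ) : K.rm (i + 1) = K.r0 i := by
  have := K.r0_rm (i - 1)
  rwa [sub_add_cancel, show i - 1 + 2 = i + 1 by ring, eq_comm] at this

theorem q_mem_stableSet_of_lt {i : ℤ} {a : ℝ} (ha : a ∈ Ioo (K.τ (i - 1)) (K.τ i)) :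
    (K.q i, (a : S1)) ∈ stableSet K.f₀ (K.q i, (K.τ i : S1)) := by
  have h := K.connect_a (i - 1) a (coe_mem_arc (by rwa [sub_add_cancel]))
  rw [p_sub_one, sub_add_cancel] at h
  exact h.2

theorem q_mem_stableSet_of_gt {i : ℤ} {a : ℝ} (ha : a ∈ Ioo (K.τ i) (K.τ (i + 1))) :
    (K.q i, (a : S1)) ∈ stableSet K.f₀ (K.q i, (K.τ i : S1)) :=
  (K.connect_b i a (coe_mem_arc ha)).1

theorem r0_mem_stableSet_of_lt {i : ℤ} {a : ℝ} (ha : a ∈ Ioo (K.τ (i - 1)) (K.τ i)) :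
    (K.r0 i, (a : S1)) ∈ stableSet K.f₀ (K.r0 i, (K.τ i : S1)) := by
  have h := K.connect_d (i - 1) a (coe_mem_arc (by rwa [sub_add_cancel]))
  rw [r1_sub_one, sub_add_cancel] at h
  exact h.2

theorem r0_mem_stableSet_of_gt {i : ℤ} {a : ℝ} (ha : a ∈ Ioo (K.τ i) (K.τ (i + 1))) :
    (K.r0 i, (a : S1)) ∈ stableSet K.f₀ (K.r0 i, (K.τ (i + 1) : S1)) := by
  have h := K.connect_c i a (coe_mem_arc ha)
  rw [rm_add_one] at h
  exact h.2

end KanMap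

/-- `h` is a height lift of `f₀` whose derivative along the fibers is that of `f₀`. -/
structure IsFiberLift {k : ℕ} (K : KanMap k) (h : T2 × ℝ → ℝ) : Prop extends
    IsHeightLift K K.f₀ h where
  hasDerivAt : ∀ (v : E2) (a : ℝ), HasDerivAt (fun a => h (proj2 v, a)) (K.f₀.fiberDeriv (v, a)) a

theorem KanMap.exists_isFiberLift {k : ℕ} (K : KanMap k) (hk : 2 < k) : ∃ h, IsFiberLift K h := by
  obtain ⟨h, hh, n, hn⟩ := exists_isHeightLift K.image_torus hk
  refine ⟨h, hh, fun v a => ?_⟩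
  have hlift : HasFDerivAt K.f₀.lift (K.f₀.D (v, a)) (v, a) :=
    (K.f₀.lift_smooth.differentiable (by simp)).differentiableAt.hasFDerivAt
  have hline : HasDerivAt (fun a : ℝ => ((v, a) : E3)) (0, 1) a :=
    (hasDerivAt_const a v).prodMk (hasDerivAt_id a)
  rw [funext (hn v)]
  exact ((ContinuousLinearMap.snd ℝ E2 ℝ).hasFDerivAt.comp_hasDerivAt a
    (hlift.comp_hasDerivAt a hline)).sub_const _

namespace IsFiberLift

variable {k : ℕ} {K : KanMap k} {h : T2 × ℝ → ℝ}

theorem injective (H : IsFiberLift K h) (x : T2) : Function.Injective fun a => h (x, a) := by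
  obtain ⟨v, rfl⟩ := isOpenQuotientMap_proj2.surjective x
  refine Function.Injective.of_lt_imp_ne fun a b hab heq => ?_
  obtain ⟨c, -, hc⟩ := exists_hasDerivAt_eq_zero hab
    (fun x _ => (H.hasDerivAt v x).continuousAt.continuousWithinAt) heq fun x _ => H.hasDerivAt v x
  have := (K.fiberDeriv_bounds (v, c)).1
  rw [hc, abs_zero] at this
  linarith

theorem strictMono (H : IsFiberLift K h) (x : T2) : StrictMono fun a => h (x, a) := by
  have hcont : Continuous fun a => h (x, a) := H.continuous.comp (by fun_prop)
  refine (hcont.strictMono_of_inj (H.injective x)).resolve_right fun hanti => ?_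
  have hlt := hanti (K.τ_lt_succ 0)
  simp only [H.fix] at hlt
  exact (K.τ_lt_succ 0).not_gt hlt

theorem cyc_eq (H : IsFiberLift K h) (z : T2 × ℝ) : cyc (K.N.g z.1, h z) = K.f₀ (cyc z) :=
  Prod.ext (K.fst_f₀ (cyc z)).symm (H.coe_eq z)

theorem iterate_f₀_eq (H : IsFiberLift K h) {x : T2} (hx : K.N.g x = x) (a : ℝ) (n : ℕ) :
    K.f₀^[n] (x, (a : S1)) = (x, (((fun a => h (x, a))^[n] a : ℝ) : S1)) := by
  have hsemi : Function.Semiconj (fun a : ℝ => (x, (a : S1))) (fun a => h (x, a)) K.f₀ :=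
      fun a => by
    have := H.cyc_eq (x, a)
    simpa only [cyc, hx] using this
  exact (hsemi.iterate_right n a).symm

theorem iterate_mem_Ioo (H : IsFiberLift K h) (x : T2) {i l : ℤ} {a : ℝ}
    (ha : a ∈ Ioo (K.τ i) (K.τ l)) (n : ℕ) : (fun a => h (x, a))^[n] a ∈ Ioo (K.τ i) (K.τ l) :=
  have hmaps : MapsTo (fun a => h (x, a)) (Ioo (K.τ i) (K.τ l)) (Ioo (K.τ i) (K.τ l)) :=
    fun b hb => ⟨H.lt_of_gt (x, b) _ hb.1, H.lt_of_lt (x, b) _ hb.2⟩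
  hmaps.iterate n ha

theorem tendsto_iterate (H : IsFiberLift K h) (hk : 1 < k) {x : T2} (hx : K.N.g x = x) {i l : ℤ}
    {a : ℝ} (ha : a ∈ Ioo (K.τ i) (K.τ (i + 1))) (hl : K.τ l ∈ Icc (K.τ i) (K.τ (i + 1)))
    (hs : (x, (a : S1)) ∈ stableSet K.f₀ (x, (K.τ l : S1))) :
    Tendsto (fun n => (fun a => h (x, a))^[n] a) atTop (𝓝 (K.τ l)) := by
  have hlt := K.τ_succ_lt_add_one hk i
  refine tendsto_of_tendsto_coe (by linarith) hl
    (fun n => Ioo_subset_Icc_self (H.iterate_mem_Ioo x ha n)) ?_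
  have hsnd : Tendsto (fun n => (K.f₀^[n] (x, (a : S1))).2) atTop (𝓝 (K.τ l : S1)) :=
    (continuous_snd.tendsto _).comp hs
  simpa only [H.iterate_f₀_eq hx] using hsnd

theorem tendsto_iterate_q (H : IsFiberLift K h) (hk : 1 < k) {i : ℤ} {a : ℝ}
    (ha : a ∈ Ioo (K.τ (i - 1)) (K.τ (i + 1))) :
    Tendsto (fun n => (fun a => h (K.q i, a))^[n] a) atTop (𝓝 (K.τ i)) := by
  rcases lt_trichotomy a (K.τ i) with hlt | rfl | hgt
  · exact H.tendsto_iterate (i := i - 1) hk (K.g_q i) (by simpa using ⟨ha.1, hlt⟩)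
      (by simpa using (K.τ_sub_one_lt i).le) (K.q_mem_stableSet_of_lt ⟨ha.1, hlt⟩)
  · have hfix : Function.IsFixedPt (fun a => h (K.q i, a)) (K.τ i) := H.fix _ _
    simp only [(hfix.iterate _).eq, tendsto_const_nhds]
  · exact H.tendsto_iterate hk (K.g_q i) ⟨hgt, ha.2⟩ (left_mem_Icc.2 (K.τ_lt_succ i).le)
      (K.q_mem_stableSet_of_gt ⟨hgt, ha.2⟩)

theorem lt_apply_r0 (H : IsFiberLift K h) (hk : 1 < k) {i : ℤ} {a : ℝ}
    (ha : a ∈ Ioo (K.τ (i - 1)) (K.τ (i + 1))) (hne : a ≠ K.τ i) : a < h (K.r0 i, a) := by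
  have hmono := (H.strictMono (K.r0 i)).monotone
  rcases lt_or_gt_of_ne hne with hlt | hgt
  · exact lt_apply_of_tendsto_iterate hmono hlt (H.tendsto_iterate (i := i - 1) hk (K.g_r0 i)
      (by simpa using ⟨ha.1, hlt⟩) (by simpa using (K.τ_sub_one_lt i).le)
      (K.r0_mem_stableSet_of_lt ⟨ha.1, hlt⟩))
  · exact lt_apply_of_tendsto_iterate hmono ha.2 (H.tendsto_iterate hk (K.g_r0 i) ⟨hgt, ha.2⟩
      (right_mem_Icc.2 (K.τ_lt_succ i).le) (K.r0_mem_stableSet_of_gt ⟨hgt, ha.2⟩))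

theorem le_apply_r0 (H : IsFiberLift K h) (hk : 1 < k) {i : ℤ} {a : ℝ}
    (ha : a ∈ Ioo (K.τ (i - 1)) (K.τ (i + 1))) : a ≤ h (K.r0 i, a) := by
  by_cases hne : a = K.τ i
  · rw [hne, H.fix]
  · exact (H.lt_apply_r0 hk ha hne).le

end IsFiberLift

/-! ### The lift of the perturbed map -/

/-- `X ∂/∂t` is a smooth vertical field that points upwards, vanishes outside the balls of radius
`ε'` around the points `r^i_0` and does not vanish at these points. -/
structure IsUpwardField {k : ℕ} {K : KanMap k} (M : FirstModification K) (X : T3 → ℝ) : Prop where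
  contDiff : ContDiff ℝ ∞ fun v : E3 => X (proj v)
  nonneg : ∀ z, 0 ≤ X z
  eq_zero : ∀ z, (∀ i, z ∉ ball3 (K.R0 i) M.ε') → X z = 0
  pos : ∀ i, 0 < X (K.R0 i)

/-- `F` is a lift to `T² × ℝ` of the perturbed map `f`. The fields are the only properties of `F`
on which the density argument relies; `h` is the height lift of `f₀`. -/
structure IsLift {k : ℕ} {K : KanMap k} (M : FirstModification K) (h : T2 × ℝ → ℝ)
    (f : T3 → T3) (F : T2 × ℝ → T2 × ℝ) : Prop where
  isOpenMap : IsOpenMap f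
  continuous : Continuous F
  cyc_eq : ∀ z, cyc (F z) = f (cyc z)
  drift : ∀ z, ∃ e : ℝ, |e| ≤ 2 / 5 * M.ε ∧ (F z).1 = K.N.along (K.N.g z.1) e
  above : ∀ z i, K.τ i < z.2 → K.τ i < (F z).2
  far : ∀ z, M.Far (cyc z) → M.Far (K.f₀ (cyc z)) → F z = (K.N.g z.1, h z)
  attractor : ∀ j x (n : ℕ), (x, K.t j) ∉ unstableSet M.f₁ (K.R0 j) → (F^[n] (x, K.τ j)).2 = K.τ j
  circle : ∀ j a, a ∈ Ioo (K.τ (j - 1)) (K.τ (j + 1)) →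
    (F (K.r0 j, a)).1 = K.r0 j ∧ a < (F (K.r0 j, a)).2 ∧ (F (K.r0 j, a)).2 < K.τ (j + 1)

section Perturbation

variable {k : ℕ} {K : KanMap k} {M : FirstModification K}

theorem exists_R0_natCast_eq (hk6 : 6 ∣ k) (i : ℤ) : ∃ j : Fin k, K.R0 ((j : ℕ) : ℤ) = K.R0 i := by
  have hk0 : (0 : ℤ) < k := by exact_mod_cast (K.two_lt hk6).trans' two_pos
  have hnonneg := Int.emod_nonneg i hk0.ne'
  have hlt := Int.emod_lt_of_pos i hk0
  refine ⟨⟨(i % k).toNat, by omega⟩, ?_⟩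
  rw [Int.toNat_of_nonneg hnonneg, ← K.R0_add_mul hk6 (i % k) (i / k)]
  congr 1
  linarith [Int.mul_ediv_add_emod i k]

theorem isUpwardField_sum_bump (hk6 : 6 ∣ k) {η : Fin k → T3 → ℝ}
    (hη : ∀ j : Fin k, IsBump (K.R0 (j : ℕ)) M.ε' (η j)) {δ : ℝ} (hδ : 0 < δ) :
    IsUpwardField M fun z => δ * ∑ j, η j z where
  contDiff := contDiff_const.mul (ContDiff.sum fun j _ => (hη j).1)
  nonneg z := mul_nonneg hδ.le (Finset.sum_nonneg fun j _ => ((hη j).2.1 z).1)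
  eq_zero z hz := by
    rw [Finset.sum_eq_zero fun j _ => (hη j).2.2.2 z (hz _), mul_zero]
  pos i := by
    obtain ⟨j, hj⟩ := exists_R0_natCast_eq (K := K) hk6 i
    have hmem : K.R0 i ∈ ball3 (K.R0 (j : ℕ)) (M.ε' / 2) := by
      rw [hj]
      exact (dist3_self _).trans_lt (half_pos M.ε'_pos)
    refine mul_pos hδ (Finset.sum_pos' (fun l _ => ((hη l).2.1 _).1) ⟨j, Finset.mem_univ _, ?_⟩)
    rw [(hη j).2.2.1 _ hmem]
    exact one_pos

theorem FirstModification.Far.notMem_ball3 {z : T3} (h : M.Far z) (i : ℤ) :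
    z ∉ ball3 (K.R0 i) M.ε' := fun hi => by
  have hlt : dist3 z (K.R0 i) < M.ε' := hi
  linarith [M.ε'_le, M.ε'_pos, M.le_dist3_of_far h i]

theorem notMem_ball3_of_mem_torus (hk6 : 6 ∣ k) {z : T3} {j : ℤ}
    (hz : z ∈ K.torus j \ ball3 (K.R0 j) M.ε') (i : ℤ) : z ∉ ball3 (K.R0 i) M.ε' := fun hi => by
  rcases M.eq_add_mul_or_lt_norm_t_sub j i with ⟨n, rfl⟩ | h
  · rw [K.R0_add_mul hk6] at hz
    exact hz.2 hi
  · have hlt : dist3 z (K.R0 i) < M.ε' := hi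
    have hle : ‖K.t j - K.t i‖ ≤ dist3 z (K.R0 i) := by
      rw [← show z.2 = K.t j from hz.1]
      exact norm_snd_sub_le_dist3 z (K.R0 i)
    linarith [M.ε'_le, M.ε'_pos]

theorem far_r0_t_succ (M : FirstModification K) (hk6 : 6 ∣ k) (j : ℤ) :
    M.Far (K.r0 j, K.t (j + 1)) := by
  refine M.far_of_near_torus hk6 (j := j + 1) ?_ ?_
  · rw [← K.r1_r0, dist2_comm]
    linarith [M.lt_dist2_r1_r0 j, M.ε_pos]
  · rw [sub_self, norm_zero]
    linarith [M.ε_pos]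

theorem iterate_f₁_mem {j : ℤ} {x : T2} (hx : (x, K.t j) ∉ unstableSet M.f₁ (K.R0 j)) (n : ℕ) :
    M.f₁^[n] (x, K.t j) ∈ K.torus j \ ball3 (K.R0 j) M.ε' := by
  have hmem : (x, K.t j) ∈ maxInvariant M.f₁ (K.torus j \ ball3 (K.R0 j) M.ε') := by
    rw [M.attractor]
    exact ⟨rfl, hx⟩
  have := hmem n
  rwa [zpow_natCast, ← Equiv.Perm.iterate_eq_pow] at this

theorem iterate_eq_iterate_f₁ {j : ℤ} {x : T2} (hx : (x, K.t j) ∉ unstableSet M.f₁ (K.R0 j))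
    {F : T2 × ℝ → T2 × ℝ}
    (hF : ∀ y, (y, K.t j) ∈ K.torus j \ ball3 (K.R0 j) M.ε' →
      M.f₁ (y, K.t j) ∈ K.torus j \ ball3 (K.R0 j) M.ε' →
      F (y, K.τ j) = ((M.f₁ (y, K.t j)).1, K.τ j)) (n : ℕ) :
    F^[n] (x, K.τ j) = ((M.f₁^[n] (x, K.t j)).1, K.τ j) := by
  induction n with
  | zero => rfl
  | succ n ih =>
    have hn := iterate_f₁_mem hx n
    have hsucc := iterate_f₁_mem hx (n + 1)
    have heta : M.f₁^[n] (x, K.t j) = ((M.f₁^[n] (x, K.t j)).1, K.t j) := Prod.ext rfl hn.1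
    rw [Function.iterate_succ_apply', heta] at hsucc
    rw [heta] at hn
    rw [Function.iterate_succ_apply', ih, hF _ hn hsucc, ← heta, Function.iterate_succ_apply']

/-- The lift of `f₁` to `T² × ℝ` with second coordinate `h₁`. -/
def f₁Lift (M : FirstModification K) (h₁ : T2 × ℝ → ℝ) (z : T2 × ℝ) : T2 × ℝ :=
  ((M.f₁ (cyc z)).1, h₁ z)

variable {h h₁ w : T2 × ℝ → ℝ} {X : T3 → ℝ}

theorem cyc_f₁Lift (H₁ : IsHeightLift K M.f₁ h₁) (z : T2 × ℝ) :
    cyc (f₁Lift M h₁ z) = M.f₁ (cyc z) := Prod.ext rfl (H₁.coe_eq z)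

theorem continuous_f₁Lift (H₁ : IsHeightLift K M.f₁ h₁) : Continuous (f₁Lift M h₁) :=
  (continuous_fst.comp (M.f₁.continuous.comp continuous_cyc)).prodMk H₁.continuous

theorem f₁Lift_eq (hk : 1 < k) (H : IsFiberLift K h) (H₁ : IsHeightLift K M.f₁ h₁) {z : T2 × ℝ}
    (hz : M.f₁ (cyc z) = K.f₀ (cyc z)) : f₁Lift M h₁ z = (K.N.g z.1, h z) := by
  rw [f₁Lift, H₁.apply_eq_of_eq hk H.toIsHeightLift hz, hz, ← H.cyc_eq]
  rfl

theorem f₁Lift_r0 (hk : 1 < k) (H : IsFiberLift K h) (H₁ : IsHeightLift K M.f₁ h₁) (j : ℤ)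
    (a : ℝ) : f₁Lift M h₁ (K.r0 j, a) = (K.r0 j, h (K.r0 j, a)) := by
  rw [f₁Lift_eq hk H H₁ (z := (K.r0 j, a)) (M.circle j _), K.g_r0]

theorem IsUpwardField.timeOneLift_r0_lt (hX : IsUpwardField M X) (hk6 : 6 ∣ k)
    (hw : IsTimeOneLift X w) {j : ℤ} {a : ℝ} (ha : a < K.τ (j + 1)) :
    w (K.r0 j, a) < K.τ (j + 1) :=
  (hw.strictMono hX.contDiff (K.r0 j) ha).trans_eq
    (hw.apply_eq_snd hX.contDiff (hX.eq_zero _ (far_r0_t_succ M hk6 j).notMem_ball3))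

theorem IsUpwardField.lt_timeOneLift_r0 (hX : IsUpwardField M X) (hw : IsTimeOneLift X w) (j : ℤ) :
    K.τ j < w (K.r0 j, K.τ j) :=
  hw.lt_apply hX.nonneg (z := (K.r0 j, K.τ j)) (hX.pos j)

theorem isLift_push_comp_f₁ (hk6 : 6 ∣ k) (hX : IsUpwardField M X) (H : IsFiberLift K h)
    (H₁ : IsHeightLift K M.f₁ h₁) (hw : IsTimeOneLift X w) {ρ : T3 → T3}
    (hρ : IsVerticalTimeOneMap X ρ) (hρw : ∀ z, ρ (cyc z) = cyc (z.1, w z)) :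
    IsLift M h (ρ ∘ M.f₁) fun z => ((f₁Lift M h₁ z).1, w (f₁Lift M h₁ z)) where
  isOpenMap := (isOpenMap_of_isVerticalTimeOneMap hX.contDiff hρ).comp M.f₁.isOpenMap
  continuous := (continuous_fst.prodMk (hw.continuous hX.contDiff)).comp (continuous_f₁Lift H₁)
  cyc_eq z := by rw [Function.comp_apply, ← cyc_f₁Lift H₁, hρw]
  drift z := M.exists_drift hk6 (cyc z)
  above z i hz := (H₁.lt_of_gt z i hz).trans_le (hw.le_apply hX.nonneg (f₁Lift M h₁ z))
  far z hz hfz := by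
    have hzero : X (cyc (K.N.g z.1, h z)) = 0 := hX.eq_zero _ (H.cyc_eq z ▸ hfz.notMem_ball3)
    simp only [f₁Lift_eq ((K.two_lt hk6).trans' one_lt_two) H H₁ (M.f₁_eq hz),
      hw.apply_eq_snd hX.contDiff hzero]
  attractor j x n hx := by
    refine congrArg Prod.snd (iterate_eq_iterate_f₁ hx (fun y _ hy => Prod.ext rfl ?_) n)
    have hlift : f₁Lift M h₁ (y, K.τ j) = ((M.f₁ (y, K.t j)).1, K.τ j) :=
      Prod.ext rfl (H₁.fix y j)
    have hcyc : cyc (f₁Lift M h₁ (y, K.τ j)) = M.f₁ (y, K.t j) := cyc_f₁Lift H₁ _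
    have hzero := hX.eq_zero _ (notMem_ball3_of_mem_torus hk6 hy)
    exact (hw.apply_eq_snd hX.contDiff (hcyc ▸ hzero)).trans (congrArg Prod.snd hlift)
  circle j a ha := by
    have hk : 1 < k := (K.two_lt hk6).trans' one_lt_two
    rw [f₁Lift_r0 hk H H₁]
    refine ⟨rfl, ?_, hX.timeOneLift_r0_lt hk6 hw (H.lt_of_lt (K.r0 j, a) _ ha.2)⟩
    by_cases hne : a = K.τ j
    · rw [hne, H.fix]
      exact hX.lt_timeOneLift_r0 hw j
    · exact (H.lt_apply_r0 hk ha hne).trans_le (hw.le_apply hX.nonneg (K.r0 j, h (K.r0 j, a)))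

theorem isLift_f₁_comp_push (hk6 : 6 ∣ k) (hX : IsUpwardField M X) (H : IsFiberLift K h)
    (H₁ : IsHeightLift K M.f₁ h₁) (hw : IsTimeOneLift X w) {ρ : T3 → T3}
    (hρ : IsVerticalTimeOneMap X ρ) (hρw : ∀ z, ρ (cyc z) = cyc (z.1, w z)) :
    IsLift M h (M.f₁ ∘ ρ) fun z => f₁Lift M h₁ (z.1, w z) where
  isOpenMap := M.f₁.isOpenMap.comp (isOpenMap_of_isVerticalTimeOneMap hX.contDiff hρ)
  continuous := (continuous_f₁Lift H₁).comp (continuous_fst.prodMk (hw.continuous hX.contDiff))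
  cyc_eq z := by rw [Function.comp_apply, hρw, cyc_f₁Lift H₁]
  drift z := M.exists_drift hk6 (cyc (z.1, w z))
  above z i hz := H₁.lt_of_gt _ i (hz.trans_le (hw.le_apply hX.nonneg z))
  far z hz _ := by
    rw [hw.apply_eq_snd hX.contDiff (hX.eq_zero _ hz.notMem_ball3)]
    exact f₁Lift_eq ((K.two_lt hk6).trans' one_lt_two) H H₁ (M.f₁_eq hz)
  attractor j x n hx := by
    refine congrArg Prod.snd (iterate_eq_iterate_f₁ hx (fun y hy _ => ?_) n)
    have hzero : X (cyc (y, K.τ j)) = 0 := hX.eq_zero _ (notMem_ball3_of_mem_torus hk6 hy)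
    rw [hw.apply_eq_snd hX.contDiff hzero]
    exact Prod.ext rfl (H₁.fix y j)
  circle j a ha := by
    have hk : 1 < k := (K.two_lt hk6).trans' one_lt_two
    have hlt := hX.timeOneLift_r0_lt hk6 hw ha.2
    have hle : a ≤ w (K.r0 j, a) := hw.le_apply hX.nonneg (K.r0 j, a)
    rw [f₁Lift_r0 hk H H₁]
    refine ⟨rfl, ?_, H.lt_of_lt (K.r0 j, w (K.r0 j, a)) _ hlt⟩
    rcases hle.eq_or_lt with heq | hlt'
    · have hne : a ≠ K.τ j := by
        rintro rfl
        exact heq.not_lt (hX.lt_timeOneLift_r0 hw j)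
      rw [← heq]
      exact H.lt_apply_r0 hk ha hne
    · exact hlt'.trans_le (H.le_apply_r0 hk ⟨ha.1.trans hlt', hlt⟩)

theorem IsUpwardField.exists_isLift (hX : IsUpwardField M X) (hk6 : 6 ∣ k) {ρ f : T3 → T3}
    (hρ : IsVerticalTimeOneMap X ρ) (hf : f = ρ ∘ M.f₁ ∨ f = M.f₁ ∘ ρ) (H : IsFiberLift K h) :
    ∃ F, IsLift M h f F := by
  obtain ⟨w, hw, hρw⟩ := exists_isTimeOneLift hρ
  obtain ⟨h₁, H₁, -⟩ := exists_isHeightLift M.torus_inv (K.two_lt hk6)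
  rcases hf with rfl | rfl
  · exact ⟨_, isLift_push_comp_f₁ hk6 hX H H₁ hw hρ hρw⟩
  · exact ⟨_, isLift_f₁_comp_push hk6 hX H H₁ hw hρ hρw⟩

end Perturbation

/-! ### Contraction and expansion along the fibers -/

theorem mul_abs_sub_le_abs_image_sub {f f' : ℝ → ℝ} {a b θ : ℝ}
    (hf : ∀ y ∈ uIcc a b, HasDerivAt f (f' y) y) (hθ : ∀ y ∈ uIcc a b, θ ≤ |f' y|) :
    θ * |b - a| ≤ |f b - f a| := by
  wlog hab : a ≤ b generalizing a b
  · rw [abs_sub_comm b, abs_sub_comm (f b)]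
    exact this (fun y hy => hf y (uIcc_comm a b ▸ hy)) (fun y hy => hθ y (uIcc_comm a b ▸ hy))
      (le_of_not_ge hab)
  rw [uIcc_of_le hab] at hf hθ
  rcases hab.eq_or_lt with rfl | hlt
  · simp
  obtain ⟨y, hy, e⟩ := exists_hasDerivAt_eq_slope f f' hlt
    (fun y hy => (hf y hy).continuousAt.continuousWithinAt)
    fun y hy => hf y (Ioo_subset_Icc_self hy)
  have := hθ y (Ioo_subset_Icc_self hy)
  rwa [e, abs_div, le_div_iff₀ (abs_pos.2 (sub_pos.2 hlt).ne')] at this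

theorem TorusDiffeo.continuous_fiberDeriv (f : TorusDiffeo) : Continuous f.fiberDeriv := by
  have hD : Continuous fun v => fderiv ℝ f.lift v := f.lift_smooth.continuous_fderiv (by simp)
  exact continuous_snd.comp (hD.clm_apply continuous_const)

theorem KanMap.exists_forall_abs_fiberDeriv_mem {k : ℕ} (K : KanMap k) {v : E2} {j : ℤ}
    {O : Set ℝ} (hO : IsOpen O) (hv : |K.f₀.fiberDeriv (v, K.τ j)| ∈ O) :
    ∃ κ > 0, ∀ s u a : ℝ, |s| ≤ κ → |u| ≤ κ → |a - K.τ j| ≤ κ →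
      |K.f₀.fiberDeriv (v + u • K.N.eu + s • K.N.es, a)| ∈ O := by
  have hcont : Continuous fun p : ℝ × ℝ × ℝ =>
      |K.f₀.fiberDeriv (v + p.2.1 • K.N.eu + p.1 • K.N.es, p.2.2)| :=
    (K.f₀.continuous_fiberDeriv.comp (by fun_prop)).abs
  have hmem := hcont.continuousAt.preimage_mem_nhds (x := ((0 : ℝ), (0 : ℝ), K.τ j))
    (hO.mem_nhds (by simpa using hv))
  obtain ⟨κ, hκ, hsub⟩ := Metric.nhds_basis_closedBall.mem_iff.1 hmem
  refine ⟨κ, hκ, fun s u a hs hu ha => hsub (show (s, u, a) ∈ _ from ?_)⟩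
  simp only [Metric.mem_closedBall, Prod.dist_eq, Real.dist_eq, sub_zero]
  exact max_le hs (max_le hu ha)

namespace IsFiberLift

variable {k : ℕ} {K : KanMap k} {h : T2 × ℝ → ℝ}

theorem abs_sub_le (H : IsFiberLift K h) (x : T2) (a : ℝ) (j : ℤ) :
    |h (x, a) - K.τ j| ≤ 3 / 2 * |a - K.τ j| := by
  obtain ⟨v, rfl⟩ := isOpenQuotientMap_proj2.surjective x
  have := Convex.norm_image_sub_le_of_norm_hasDerivWithin_le (s := univ)
    (fun b _ => (H.hasDerivAt v b).hasDerivWithinAt)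
    (fun b _ => (K.fiberDeriv_bounds (v, b)).2.le) convex_univ (mem_univ (K.τ j)) (mem_univ a)
  simpa only [H.fix, Real.norm_eq_abs] using this

theorem exists_contraction (H : IsFiberLift K h) {c : T2} {j : ℤ}
    (hc : ∀ v, proj v = (c, K.t j) → |K.f₀.fiberDeriv v| < 1) :
    ∃ κ > 0, ∃ θ : ℝ, 0 ≤ θ ∧ θ < 1 ∧ ∀ s u a : ℝ, |s| ≤ κ → |u| ≤ κ → |a - K.τ j| ≤ κ →
      |h (K.N.along (K.N.alongU c u) s, a) - K.τ j| ≤ θ * |a - K.τ j| := by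
  obtain ⟨v, rfl⟩ := isOpenQuotientMap_proj2.surjective c
  obtain ⟨θ, hθ, hθ1⟩ := exists_between (hc (v, K.τ j) rfl)
  obtain ⟨κ, hκ, hv⟩ := K.exists_forall_abs_fiberDeriv_mem (O := Iio θ) isOpen_Iio hθ
  refine ⟨κ, hκ, θ, (abs_nonneg _).trans hθ.le, hθ1, fun s u a hs hu ha => ?_⟩
  have e : K.N.along (K.N.alongU (proj2 v) u) s = proj2 (v + u • K.N.eu + s • K.N.es) := by
    simp only [ToralAnosov.along, ToralAnosov.alongU, proj2_add]
  have := Convex.norm_image_sub_le_of_norm_hasDerivWithin_le (s := Metric.closedBall (K.τ j) κ)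
    (fun b _ => (H.hasDerivAt (v + u • K.N.eu + s • K.N.es) b).hasDerivWithinAt)
    (fun b hb => (hv s u b hs hu hb).le) (convex_closedBall _ _)
    (Metric.mem_closedBall_self hκ.le) (show a ∈ Metric.closedBall (K.τ j) κ from ha)
  rw [e]
  simpa only [H.fix, Real.norm_eq_abs] using this

theorem exists_expansion (H : IsFiberLift K h) {c : T2} {j : ℤ}
    (hc : ∀ v, proj v = (c, K.t j) → 1 < |K.f₀.fiberDeriv v|) :
    ∃ κ > 0, ∃ θ : ℝ, 1 < θ ∧ ∀ s a : ℝ, |s| ≤ κ → |a - K.τ j| ≤ κ →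
      θ * |a - K.τ j| ≤ |h (K.N.along c s, a) - K.τ j| := by
  obtain ⟨v, rfl⟩ := isOpenQuotientMap_proj2.surjective c
  obtain ⟨θ, hθ1, hθ⟩ := exists_between (hc (v, K.τ j) rfl)
  obtain ⟨κ, hκ, hv⟩ := K.exists_forall_abs_fiberDeriv_mem (O := Ioi θ) isOpen_Ioi hθ
  refine ⟨κ, hκ, θ, hθ1, fun s a hs ha => ?_⟩
  have e : K.N.along (proj2 v) s = proj2 (v + s • K.N.es) := by
    simp only [ToralAnosov.along, proj2_add]
  have hexp : ∀ b ∈ uIcc (K.τ j) a, θ ≤ |K.f₀.fiberDeriv (v + s • K.N.es, b)| := by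
    intro b hb
    have := hv s 0 b hs (by simpa using hκ.le) ((abs_sub_left_of_mem_uIcc hb).trans ha)
    rw [zero_smul, add_zero] at this
    exact (mem_Ioi.1 this).le
  have := mul_abs_sub_le_abs_image_sub (fun b _ => H.hasDerivAt (v + s • K.N.es) b) hexp
  rwa [H.fix, ← e] at this

end IsFiberLift

namespace ToralAnosov

variable (N : ToralAnosov)

theorem abs_inv_lam_pow_mul_le (n : ℕ) (s : ℝ) : |N.lam⁻¹ ^ n * s| ≤ |s| := by
  rw [abs_mul, abs_of_nonneg (pow_nonneg N.lam_inv_pos.le n)]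
  exact mul_le_of_le_one_left (abs_nonneg s)
    (pow_le_one₀ N.lam_inv_pos.le (by linarith [N.lam_inv_lt]))

theorem abs_inv_lam_mul_le (s : ℝ) : |N.lam⁻¹ * s| ≤ |s| := by
  simpa using N.abs_inv_lam_pow_mul_le 1 s

theorem tendsto_inv_lam_pow_mul (s : ℝ) :
    Tendsto (fun n : ℕ => N.lam⁻¹ ^ n * s) atTop (𝓝 0) := by
  have := (tendsto_pow_atTop_nhds_zero_of_lt_one N.lam_inv_pos.le
    (by linarith [N.lam_inv_lt])).mul_const s
  simpa using this

theorem exists_abs_inv_lam_pow_mul_le (s : ℝ) {r : ℝ} (hr : 0 < r) :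
    ∃ n : ℕ, |N.lam⁻¹ ^ n * s| ≤ r :=
  ((N.tendsto_inv_lam_pow_mul s).abs.eventually
    (ge_mem_nhds (show |(0 : ℝ)| < r by simpa using hr))).exists

theorem tendsto_along_inv_lam_pow_mul (x : T2) (s : ℝ) :
    Tendsto (fun n : ℕ => N.along x (N.lam⁻¹ ^ n * s)) atTop (𝓝 x) := by
  have := (N.continuous_along.tendsto (x, 0)).comp
    (tendsto_const_nhds.prodMk_nhds (N.tendsto_inv_lam_pow_mul s))
  rwa [N.along_zero] at this

theorem tendsto_alongU_inv_lam_pow_mul (x : T2) (u : ℝ) :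
    Tendsto (fun n : ℕ => N.alongU x (N.lam⁻¹ ^ n * u)) atTop (𝓝 x) := by
  have := (N.continuous_alongU.tendsto (x, 0)).comp
    (tendsto_const_nhds.prodMk_nhds (N.tendsto_inv_lam_pow_mul u))
  rwa [N.alongU_zero] at this

theorem exists_alongU_pow_mul_eq_along {c x : T2} (hc : N.g c = c) (hx : N.g x = x) {κ r : ℝ}
    (hκ : 0 < κ) (hr : 0 < r) :
    ∃ (n : ℕ) (u s : ℝ), |u| ≤ κ ∧ |s| ≤ r ∧ N.alongU c (N.lam ^ n * u) = N.along x s := by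
  obtain ⟨u₀, s₀, hus⟩ := N.exists_alongU_eq_along c x
  obtain ⟨m₁, hm₁⟩ := N.exists_abs_inv_lam_pow_mul_le s₀ hr
  obtain ⟨m₂, hm₂⟩ := N.exists_abs_inv_lam_pow_mul_le u₀ hκ
  refine ⟨m₁ + m₂, _, _, hm₂, hm₁, ?_⟩
  have hcancel : N.lam ^ (m₁ + m₂) * (N.lam⁻¹ ^ m₂ * u₀) = N.lam ^ m₁ * u₀ := by
    rw [pow_add, mul_assoc, ← mul_assoc (N.lam ^ m₂), ← mul_pow, mul_inv_cancel₀ N.lam_pos.ne',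
      one_pow, one_mul]
  have := N.iterate_g_alongU c u₀ m₁
  rw [hus, N.iterate_g_along, Function.iterate_fixed hx, Function.iterate_fixed hc] at this
  rw [hcancel, ← this]

end ToralAnosov

namespace IsLift

variable {k : ℕ} {K : KanMap k} {M : FirstModification K} {h : T2 × ℝ → ℝ} {f : T3 → T3}
  {F : T2 × ℝ → T2 × ℝ}

theorem cyc_iterate (L : IsLift M h f F) (n : ℕ) (z : T2 × ℝ) : cyc (F^[n] z) = f^[n] (cyc z) := by
  have : Function.Semiconj cyc F f := L.cyc_eq
  exact this.iterate_right n z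

theorem isOpen_image_iterate (L : IsLift M h f F) (n : ℕ) {U : Set T3} (hU : IsOpen U) :
    IsOpen (f^[n] '' U) := by
  induction n with
  | zero => simpa using hU
  | succ n ih => rw [Function.iterate_succ', image_comp]; exact L.isOpenMap _ ih

theorem iterate_drift (L : IsLift M h f F) (n : ℕ) (z : T2 × ℝ) :
    ∃ S : ℝ, |S| ≤ M.ε / 2 ∧ (F^[n] z).1 = K.N.along (K.N.g^[n] z.1) S := by
  induction n with
  | zero => exact ⟨0, by simpa using (half_pos M.ε_pos).le, by simp [K.N.along_zero]⟩
  | succ n ih =>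
    obtain ⟨S, hS, e⟩ := ih
    obtain ⟨d, hd, e'⟩ := L.drift (F^[n] z)
    refine ⟨K.N.lam⁻¹ * S + d, ?_, ?_⟩
    · have hcontract : |K.N.lam⁻¹ * S| ≤ 1 / 5 * (M.ε / 2) := by
        rw [abs_mul, abs_of_pos K.N.lam_inv_pos]
        have := K.N.lam_inv_lt
        gcongr
      linarith [abs_add_le (K.N.lam⁻¹ * S) d]
    · rw [Function.iterate_succ_apply', Function.iterate_succ_apply', e', e, K.N.g_along,
        K.N.along_along]

theorem iterate_above (L : IsLift M h f F) {z : T2 × ℝ} {i : ℤ} (hz : K.τ i < z.2) (n : ℕ) :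
    K.τ i < (F^[n] z).2 := by
  induction n with
  | zero => exact hz
  | succ n ih => rw [Function.iterate_succ_apply']; exact L.above _ _ ih

end IsLift

/-! ### Points that attract along their circle -/

/-- `(c, t_j)` is a fixed point that attracts along its circle and lies far from `r^j_0`. -/
structure IsSink {k : ℕ} {K : KanMap k} (M : FirstModification K) (c : T2) (j : ℤ) : Prop where
  fix : K.N.g c = c
  deriv : ∀ v, proj v = (c, K.t j) → |K.f₀.fiberDeriv v| < 1
  sep : 10 * M.ε < dist2 c (K.r0 j)

/-- On the box of radius `κ` around `(c, τ j)`, in the coordinates `(s, u, a)` along the stable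
leaf, the unstable leaf and the circle, `F` is linear in `s` and `u`, and contracts `a` towards
`τ j` by the factor `θ`. -/
def IsSinkBox {k : ℕ} (K : KanMap k) (F : T2 × ℝ → T2 × ℝ) (c : T2) (j : ℤ) (κ θ : ℝ) : Prop :=
  ∀ s u a : ℝ, |s| ≤ κ → |u| ≤ κ → |a - K.τ j| ≤ κ → ∃ b : ℝ, |b - K.τ j| ≤ θ * |a - K.τ j| ∧
    F (K.N.along (K.N.alongU c u) s, a) =
      (K.N.along (K.N.alongU c (K.N.lam * u)) (K.N.lam⁻¹ * s), b)

theorem FirstModification.far_along_alongU {k : ℕ} {K : KanMap k} (M : FirstModification K)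
    (hk6 : 6 ∣ k) {c : T2} {j : ℤ} (hsep : 10 * M.ε < dist2 c (K.r0 j)) {s u a : ℝ}
    (hs : |s| ≤ 2 * M.ε) (hu : |u| ≤ M.ε) (ha : |a - K.τ j| ≤ 5 * M.ε) :
    M.Far (cyc (K.N.along (K.N.alongU c u) s, a)) := by
  refine M.far_of_near_torus hk6 (j := j) ?_ ?_
  · have hs' := K.N.dist2_along_le (K.N.alongU c u) s
    have hu' := K.N.dist2_alongU_le c u
    have htri := dist2_triangle c (K.N.alongU c u) (K.r0 j)
    have htri' := dist2_triangle (K.N.alongU c u) (K.N.along (K.N.alongU c u) s) (K.r0 j)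
    rw [dist2_comm] at hs' hu'
    simp only [cyc]
    linarith [M.ε_pos]
  · have : (cyc (K.N.along (K.N.alongU c u) s, a)).2 - K.t j = ((a - K.τ j : ℝ) : S1) := by
      simp [cyc, KanMap.t]
    rw [this]
    exact (norm_coe_le_abs _).trans ha

section SinkBox

variable {k : ℕ} {K : KanMap k} {F : T2 × ℝ → T2 × ℝ} {c : T2} {j : ℤ} {κ θ s a : ℝ}

theorem IsSinkBox.exists_iterate_eq (hbox : IsSinkBox K F c j κ θ) (hθ0 : 0 ≤ θ) (hθ1 : θ < 1)
    (hs : |s| ≤ κ) (ha : |a - K.τ j| ≤ κ) {n : ℕ} {u : ℝ} (hu : |K.N.lam ^ n * u| ≤ κ) :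
    ∃ b : ℝ, |b - K.τ j| ≤ θ ^ n * κ ∧ F^[n] (K.N.along (K.N.alongU c u) s, a) =
      (K.N.along (K.N.alongU c (K.N.lam ^ n * u)) (K.N.lam⁻¹ ^ n * s), b) := by
  induction n with
  | zero => exact ⟨a, by simpa using ha, by simp⟩
  | succ n ih =>
    have hκ : 0 ≤ κ := (abs_nonneg s).trans hs
    have hu' : |K.N.lam ^ n * u| ≤ κ := by
      have := (K.N.abs_inv_lam_mul_le (K.N.lam ^ (n + 1) * u)).trans hu
      rwa [pow_succ', mul_assoc, inv_mul_cancel_left₀ K.N.lam_pos.ne'] at this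
    obtain ⟨b, hb, e⟩ := ih hu'
    obtain ⟨b', hb', e'⟩ := hbox (K.N.lam⁻¹ ^ n * s) (K.N.lam ^ n * u) b
      ((K.N.abs_inv_lam_pow_mul_le n s).trans hs) hu'
      (hb.trans (mul_le_of_le_one_left hκ (pow_le_one₀ hθ0 hθ1.le)))
    refine ⟨b', ?_, ?_⟩
    · rw [pow_succ', mul_assoc]
      exact hb'.trans (mul_le_mul_of_nonneg_left hb hθ0)
    · rw [Function.iterate_succ_apply', e, e', pow_succ', pow_succ', mul_assoc, mul_assoc]

theorem IsSinkBox.exists_tendsto (hbox : IsSinkBox K F c j κ θ) (hθ0 : 0 ≤ θ) (hθ1 : θ < 1)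
    (hs : |s| ≤ κ) (ha : |a - K.τ j| ≤ κ) {u : ℝ} (hu : |u| ≤ κ) :
    ∃ z : ℕ → T2 × ℝ, Tendsto z atTop (𝓝 (K.N.along c s, a)) ∧
      Tendsto (fun m => F^[m] (z m)) atTop (𝓝 (K.N.alongU c u, K.τ j)) ∧
      ∀ m, (z m).2 = a ∧ (F^[m] (z m)).1 = K.N.along (K.N.alongU c u) (K.N.lam⁻¹ ^ m * s) := by
  have hcancel (m : ℕ) : K.N.lam ^ m * (K.N.lam⁻¹ ^ m * u) = u := by
    rw [inv_pow, mul_inv_cancel_left₀ (pow_ne_zero m K.N.lam_pos.ne')]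
  have hit (m : ℕ) := hbox.exists_iterate_eq hθ0 hθ1 hs ha (n := m) (u := K.N.lam⁻¹ ^ m * u)
    (by rwa [hcancel])
  simp only [hcancel] at hit
  choose b hb e using hit
  have hblim : Tendsto b atTop (𝓝 (K.τ j)) := by
    rw [tendsto_iff_dist_tendsto_zero]
    refine squeeze_zero (fun _ => dist_nonneg) hb ?_
    simpa using (tendsto_pow_atTop_nhds_zero_of_lt_one hθ0 hθ1).mul_const κ
  refine ⟨fun m => (K.N.along (K.N.alongU c (K.N.lam⁻¹ ^ m * u)) s, a), ?_, ?_,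
    fun m => ⟨rfl, congrArg Prod.fst (e m)⟩⟩
  · have := (K.N.continuous_along.tendsto (c, s)).comp
      ((K.N.tendsto_alongU_inv_lam_pow_mul c u).prodMk_nhds tendsto_const_nhds)
    exact this.prodMk_nhds tendsto_const_nhds
  · simp only [e]
    exact (K.N.tendsto_along_inv_lam_pow_mul _ s).prodMk_nhds hblim

end SinkBox

namespace IsSink

variable {k : ℕ} {K : KanMap k} {M : FirstModification K} {c : T2} {j : ℤ}

theorem of_q (M : FirstModification K) (j : ℤ) : IsSink M (K.q j) j :=
  ⟨K.g_q j, K.deriv_q j, M.lt_dist2_q_r0 j⟩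

theorem of_rm (M : FirstModification K) (j : ℤ) : IsSink M (K.rm j) j :=
  ⟨K.g_rm j, K.deriv_rm j, M.lt_dist2_rm_r0 j⟩

theorem exists_isSinkBox {h : T2 × ℝ → ℝ} {f : T3 → T3} {F : T2 × ℝ → T2 × ℝ} (hk6 : 6 ∣ k)
    (H : IsFiberLift K h) (L : IsLift M h f F) (hc : IsSink M c j) :
    ∃ κ > 0, κ ≤ M.ε ∧ ∃ θ : ℝ, 0 ≤ θ ∧ θ < 1 ∧ IsSinkBox K F c j κ θ := by
  obtain ⟨κ₀, hκ₀, θ, hθ0, hθ1, hθ⟩ := H.exists_contraction hc.deriv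
  have hε := M.ε_pos
  have hl := K.N.lam_pos
  obtain ⟨κ, hκ, hκκ₀, hlκ⟩ : ∃ κ > 0, κ ≤ κ₀ ∧ K.N.lam * κ ≤ M.ε :=
    ⟨min κ₀ (M.ε / K.N.lam), lt_min hκ₀ (div_pos hε hl), min_le_left _ _,
      (le_div_iff₀' hl).1 (min_le_right _ _)⟩
  have hκε : κ ≤ M.ε := by nlinarith [K.N.lam_gt]
  refine ⟨κ, hκ, hκε, θ, hθ0, hθ1, fun s u a hs hu ha => ?_⟩
  have hb := hθ s u a (hs.trans hκκ₀) (hu.trans hκκ₀) (ha.trans hκκ₀)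
  have hg : K.N.g (K.N.along (K.N.alongU c u) s) =
      K.N.along (K.N.alongU c (K.N.lam * u)) (K.N.lam⁻¹ * s) := by
    rw [K.N.g_along, K.N.g_alongU, hc.fix]
  have hfar : M.Far (cyc (K.N.along (K.N.alongU c u) s, a)) :=
    M.far_along_alongU hk6 hc.sep (by linarith) (by linarith) (by linarith)
  have hfar' : M.Far (K.f₀ (cyc (K.N.along (K.N.alongU c u) s, a))) := by
    rw [← H.cyc_eq, hg]
    refine M.far_along_alongU hk6 hc.sep ?_ ?_ ?_
    · linarith [K.N.abs_inv_lam_mul_le s]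
    · rw [abs_mul, abs_of_pos hl]; nlinarith
    · linarith [mul_le_of_le_one_left (abs_nonneg (a - K.τ j)) hθ1.le]
  exact ⟨_, hb, by rw [L.far _ hfar hfar', hg]⟩

theorem symm_alongU (hk6 : 6 ∣ k) (hc : IsSink M c j) {u : ℝ} (hu : |u| ≤ M.ε) :
    M.f₁.toPerm.symm (K.N.alongU c u, K.t j) = (K.N.alongU c (K.N.lam⁻¹ * u), K.t j) := by
  have hε := M.ε_pos
  have hfar : M.Far (K.N.alongU c (K.N.lam⁻¹ * u), K.t j) := by
    have := M.far_along_alongU hk6 hc.sep (s := 0) (a := K.τ j) (by simp [hε.le])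
      ((K.N.abs_inv_lam_mul_le u).trans hu) (by simp [hε.le])
    rwa [K.N.along_zero] at this
  rw [Equiv.symm_apply_eq, M.f₁_eq hfar, K.fibered, K.N.g_alongU, hc.fix,
    mul_inv_cancel_left₀ K.N.lam_pos.ne']
  exact Prod.ext rfl (K.φ_fix _ j).symm

theorem iterate_symm_alongU (hk6 : 6 ∣ k) (hc : IsSink M c j) {u : ℝ} (hu : |u| ≤ M.ε) (n : ℕ) :
    M.f₁.toPerm.symm^[n] (K.N.alongU c u, K.t j) = (K.N.alongU c (K.N.lam⁻¹ ^ n * u), K.t j) := by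
  induction n with
  | zero => simp
  | succ n ih =>
    rw [Function.iterate_succ_apply', ih,
      hc.symm_alongU hk6 ((K.N.abs_inv_lam_pow_mul_le n u).trans hu), pow_succ', mul_assoc]

theorem alongU_notMem_unstableSet (hk6 : 6 ∣ k) (hc : IsSink M c j) {u : ℝ} (hu : |u| ≤ M.ε) :
    (K.N.alongU c u, K.t j) ∉ unstableSet M.f₁ (K.R0 j) := by
  intro hmem
  have hlim : Tendsto (fun n : ℕ => M.f₁.toPerm.symm^[n] (K.N.alongU c u, K.t j)) atTop
      (𝓝 (c, K.t j)) := by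
    simp only [hc.iterate_symm_alongU hk6 hu]
    exact (K.N.tendsto_alongU_inv_lam_pow_mul c u).prodMk_nhds tendsto_const_nhds
  have heq : c = K.r0 j := congrArg Prod.fst (tendsto_nhds_unique hlim hmem)
  have hsep := hc.sep
  rw [heq, dist2_self] at hsep
  linarith [M.ε_pos]

-- By the local normal form `V` accumulates on the local unstable leaf of the sink. That leaf lies
-- in the attractor, so its iterates stay in the torus `t_j` while they stretch up to `W^s_A(x)`.
theorem exists_iterate_mem_leaf {h : T2 × ℝ → ℝ} {f : T3 → T3} {F : T2 × ℝ → T2 × ℝ}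
    (hk6 : 6 ∣ k) (H : IsFiberLift K h) (L : IsLift M h f F) (hc : IsSink M c j) :
    ∃ κ > 0, ∀ (V : Set T3) (s a : ℝ), IsOpen V → |s| ≤ κ → |a - K.τ j| ≤ κ →
      cyc (K.N.along c s, a) ∈ V → ∀ x, K.N.g x = x → ∀ r > 0, ∃ (n : ℕ) (s' a' : ℝ),
        |s'| ≤ 2 * M.ε ∧ |a' - K.τ j| < r ∧ cyc (K.N.along x s', a') ∈ f^[n] '' V ∧
        (K.τ j < a → K.τ j < a') := by
  obtain ⟨κ, hκ, hκε, θ, hθ0, hθ1, hbox⟩ := hc.exists_isSinkBox hk6 H L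
  refine ⟨κ, hκ, fun V s a hV hs ha hmem x hx r hr => ?_⟩
  obtain ⟨n, u, s₀, hu, hs₀, hx'⟩ :=
    K.N.exists_alongU_pow_mul_eq_along hc.fix hx hκ (half_pos M.ε_pos)
  obtain ⟨z, hz, hFz, hz'⟩ := hbox.exists_tendsto hθ0 hθ1 hs ha hu
  have hheight : Tendsto (fun m => (F^[n] (F^[m] (z m))).2) atTop (𝓝 (K.τ j)) := by
    have := ((continuous_snd.comp (L.continuous.iterate n)).tendsto _).comp hFz
    rwa [Function.comp_apply,
      L.attractor j _ _ (hc.alongU_notMem_unstableSet hk6 (hu.trans hκε))] at this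
  obtain ⟨m, hm, hmV⟩ := ((hheight.eventually (Metric.ball_mem_nhds _ hr)).and
    (((continuous_cyc.tendsto _).comp hz).eventually (hV.mem_nhds hmem))).exists
  obtain ⟨S, hS, eS⟩ := L.iterate_drift n (F^[m] (z m))
  rw [(hz' m).2, K.N.iterate_g_along, K.N.iterate_g_alongU, Function.iterate_fixed hc.fix, hx',
    K.N.along_along, K.N.along_along] at eS
  refine ⟨n + m, s₀ + (K.N.lam⁻¹ ^ n * (K.N.lam⁻¹ ^ m * s) + S), (F^[n] (F^[m] (z m))).2, ?_, hm,
    ⟨cyc (z m), hmV, ?_⟩, fun hlt => L.iterate_above (L.iterate_above ?_ m) n⟩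
  · have hsum := abs_add_three s₀ (K.N.lam⁻¹ ^ n * (K.N.lam⁻¹ ^ m * s)) S
    rw [add_assoc] at hsum
    have hs' := (K.N.abs_inv_lam_pow_mul_le n (K.N.lam⁻¹ ^ m * s)).trans
      (K.N.abs_inv_lam_pow_mul_le m s)
    linarith
  · rw [← eS, Prod.mk.eta, Function.iterate_add_apply, L.cyc_iterate, L.cyc_iterate]
  · rwa [(hz' m).1]

end IsSink

/-! ### The stable strip of `q^i` -/

theorem FirstModification.far_along_q {k : ℕ} {K : KanMap k} (M : FirstModification K) (i : ℤ)
    {s : ℝ} (hs : |s| ≤ 2 * M.ε) (a : ℝ) : M.Far (cyc (K.N.along (K.q i) s, a)) := by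
  refine M.far_of_le_dist2 fun l => ?_
  have hdist := K.N.dist2_along_le (K.q i) s
  have htri := dist2_triangle (K.q i) (K.N.along (K.q i) s) (K.r0 l)
  rw [dist2_comm] at hdist
  simp only [cyc]
  linarith [M.lt_dist2_q_r0' i l, M.ε_pos]

namespace IsLift

variable {k : ℕ} {K : KanMap k} {M : FirstModification K} {h : T2 × ℝ → ℝ} {f : T3 → T3}
  {F : T2 × ℝ → T2 × ℝ} {i : ℤ} {s a : ℝ}

theorem apply_along_q (H : IsFiberLift K h) (L : IsLift M h f F) (hs : |s| ≤ 2 * M.ε) :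
    F (K.N.along (K.q i) s, a) =
      (K.N.along (K.q i) (K.N.lam⁻¹ * s), h (K.N.along (K.q i) s, a)) := by
  have hg : K.N.g (K.N.along (K.q i) s) = K.N.along (K.q i) (K.N.lam⁻¹ * s) := by
    rw [K.N.g_along, K.g_q]
  have hfar' : M.Far (K.f₀ (cyc (K.N.along (K.q i) s, a))) := by
    rw [← H.cyc_eq, hg]
    exact M.far_along_q i ((K.N.abs_inv_lam_mul_le s).trans hs) _
  rw [L.far _ (M.far_along_q i hs a) hfar', hg]

theorem fst_iterate_along_q (H : IsFiberLift K h) (L : IsLift M h f F) (hs : |s| ≤ 2 * M.ε)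
    (n : ℕ) : (F^[n] (K.N.along (K.q i) s, a)).1 = K.N.along (K.q i) (K.N.lam⁻¹ ^ n * s) := by
  induction n with
  | zero => simp
  | succ n ih =>
    rw [Function.iterate_succ_apply', ← Prod.mk.eta (p := F^[n] (K.N.along (K.q i) s, a)), ih,
      L.apply_along_q H ((K.N.abs_inv_lam_pow_mul_le n s).trans hs), pow_succ', mul_assoc]

theorem tendsto_fst_iterate_along_q (H : IsFiberLift K h) (L : IsLift M h f F)
    (hs : |s| ≤ 2 * M.ε) :
    Tendsto (fun n => (F^[n] (K.N.along (K.q i) s, a)).1) atTop (𝓝 (K.q i)) := by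
  simp only [L.fst_iterate_along_q H hs]
  exact K.N.tendsto_along_inv_lam_pow_mul (K.q i) s

theorem snd_iterate_succ_along_q (H : IsFiberLift K h) (L : IsLift M h f F)
    (hs : |s| ≤ 2 * M.ε) (n : ℕ) : (F^[n + 1] (K.N.along (K.q i) s, a)).2 =
      h (K.N.along (K.q i) (K.N.lam⁻¹ ^ n * s), (F^[n] (K.N.along (K.q i) s, a)).2) := by
  rw [Function.iterate_succ_apply', ← Prod.mk.eta (p := F^[n] (K.N.along (K.q i) s, a)),
    L.fst_iterate_along_q H hs, L.apply_along_q H ((K.N.abs_inv_lam_pow_mul_le n s).trans hs)]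

theorem iterate_q (H : IsFiberLift K h) (L : IsLift M h f F) (n : ℕ) :
    F^[n] (K.q i, a) = (K.q i, (fun a => h (K.q i, a))^[n] a) := by
  have hzero : |(0 : ℝ)| ≤ 2 * M.ε := by simpa using M.ε_pos.le
  induction n with
  | zero => rfl
  | succ n ih =>
    rw [Function.iterate_succ_apply', ih, Function.iterate_succ_apply']
    have := L.apply_along_q H (i := i) hzero (a := (fun a => h (K.q i, a))^[n] a)
    rwa [mul_zero, K.N.along_zero] at this

theorem snd_iterate_along_q_mem_Ioo (H : IsFiberLift K h) (L : IsLift M h f F)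
    (hs : |s| ≤ 2 * M.ε) {l m : ℤ} (ha : a ∈ Ioo (K.τ l) (K.τ m)) (n : ℕ) :
    (F^[n] (K.N.along (K.q i) s, a)).2 ∈ Ioo (K.τ l) (K.τ m) := by
  induction n with
  | zero => exact ha
  | succ n ih =>
    rw [L.snd_iterate_succ_along_q H hs]
    exact ⟨H.lt_of_gt (_, _) _ ih.1, H.lt_of_lt (_, _) _ ih.2⟩

theorem not_tendsto_snd_iterate_along_q (H : IsFiberLift K h) (L : IsLift M h f F) {e : ℤ}
    (he : ∀ v, proj v = (K.q i, K.t e) → 1 < |K.f₀.fiberDeriv v|) (hs : |s| ≤ 2 * M.ε)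
    (hne : ∀ n, (F^[n] (K.N.along (K.q i) s, a)).2 ≠ K.τ e) :
    ¬ Tendsto (fun n => (F^[n] (K.N.along (K.q i) s, a)).2) atTop (𝓝 (K.τ e)) := by
  intro ht
  obtain ⟨κ, hκ, θ, hθ, hexp⟩ := H.exists_expansion he
  have hsmall := (K.N.tendsto_inv_lam_pow_mul s).abs.eventually
    (ge_mem_nhds (show |(0 : ℝ)| < κ by simpa using hκ))
  obtain ⟨n₀, hn₀⟩ := eventually_atTop.1
    (hsmall.and (ht.eventually (Metric.closedBall_mem_nhds _ hκ)))
  set d : ℕ → ℝ := fun n => |(F^[n] (K.N.along (K.q i) s, a)).2 - K.τ e| with hd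
  have hpos : ∀ n, 0 < d n := fun n => abs_pos.2 (sub_ne_zero.2 (hne n))
  have hstep : ∀ n, n₀ ≤ n → d n ≤ d (n + 1) := fun n hn => by
    simp only [hd]
    rw [L.snd_iterate_succ_along_q H hs]
    exact (le_mul_of_one_le_left (hpos n).le hθ.le).trans (hexp _ _ (hn₀ n hn).1 (hn₀ n hn).2)
  have hinc : ∀ n, n₀ ≤ n → d n₀ ≤ d n := fun n hn =>
    Nat.le_induction le_rfl (fun n hn ih => ih.trans (hstep n hn)) n hn
  have hlim : Tendsto d atTop (𝓝 0) := by simpa using (ht.sub_const (K.τ e)).abs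
  exact (hpos n₀).not_ge (ge_of_tendsto hlim (eventually_atTop.2 ⟨n₀, hinc⟩))

theorem notMem_Ioo_of_mapClusterPt (hk : 1 < k) (H : IsFiberLift K h) (L : IsLift M h f F)
    (hs : |s| ≤ 2 * M.ε) {κ : ℝ} (hκ : 0 < κ)
    (hfar : ∀ᶠ n in atTop, κ < |(F^[n] (K.N.along (K.q i) s, a)).2 - K.τ i|) {y : ℝ}
    (hy : MapClusterPt y atTop fun n => (F^[n] (K.N.along (K.q i) s, a)).2) :
    y ∉ Ioo (K.τ (i - 1)) (K.τ (i + 1)) := by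
  intro hmem
  obtain ⟨m, hm⟩ := ((H.tendsto_iterate_q hk hmem).eventually
    (Metric.ball_mem_nhds _ hκ)).exists
  have hlt : |(F^[m] (K.q i, y)).2 - K.τ i| < κ := by
    rw [L.iterate_q H]; exact hm
  have hnear : {w : T2 × ℝ | |(F^[m] w).2 - K.τ i| < κ} ∈ 𝓝 (K.q i, y) :=
    ((continuous_snd.comp (L.continuous.iterate m)).sub continuous_const).abs.continuousAt
      |>.eventually_lt continuousAt_const hlt
  rw [nhds_prod_eq, mem_prod_iff] at hnear
  obtain ⟨A, hA, B, hB, hAB⟩ := hnear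
  obtain ⟨n₀, hn₀⟩ := eventually_atTop.1 hfar
  obtain ⟨n, ⟨hnB, hnA⟩, hn⟩ := ((hy.frequently hB).and_eventually
    ((L.tendsto_fst_iterate_along_q H hs).eventually hA)).and_eventually
      (eventually_ge_atTop n₀) |>.exists
  have hclose : |(F^[m] (F^[n] (K.N.along (K.q i) s, a))).2 - K.τ i| < κ := hAB ⟨hnA, hnB⟩
  rw [← Function.iterate_add_apply] at hclose
  exact hclose.not_gt (hn₀ (m + n) (by omega))

-- Otherwise the compactness of `C` would make the heights converge to the expanding level `τ e`.
theorem frequently_abs_snd_iterate_sub_le (hk : 1 < k) (H : IsFiberLift K h) (L : IsLift M h f F)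
    (hs : |s| ≤ 2 * M.ε) {κ : ℝ} (hκ : 0 < κ) {e : ℤ} (he : K.q i = K.p e) {C : Set ℝ}
    (hC : IsCompact C) (hCe : ∀ y ∈ C, y ≠ K.τ e → y ∈ Ioo (K.τ (i - 1)) (K.τ (i + 1)))
    (hmem : ∀ n, (F^[n] (K.N.along (K.q i) s, a)).2 ∈ C \ {K.τ e}) :
    ∃ᶠ n in atTop, |(F^[n] (K.N.along (K.q i) s, a)).2 - K.τ i| ≤ κ := by
  by_contra hcon
  have hfar : ∀ᶠ n in atTop, κ < |(F^[n] (K.N.along (K.q i) s, a)).2 - K.τ i| := by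
    simpa only [not_frequently, not_le] using hcon
  refine L.not_tendsto_snd_iterate_along_q H (e := e) (by rw [he]; exact K.deriv_p e) hs
    (fun n => (hmem n).2) ?_
  refine hC.tendsto_nhds_of_unique_mapClusterPt (.of_forall fun n => (hmem n).1) fun y hy hcl => ?_
  by_contra hne
  exact L.notMem_Ioo_of_mapClusterPt hk H hs hκ hfar hcl (hCe y hy hne)

theorem frequently_abs_snd_iterate_along_q_sub_le (hk : 1 < k) (H : IsFiberLift K h)
    (L : IsLift M h f F) (hs : |s| ≤ 2 * M.ε) (ha : a ∈ Ioo (K.τ (i - 1)) (K.τ (i + 1))) {κ : ℝ}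
    (hκ : 0 < κ) : ∃ᶠ n in atTop, |(F^[n] (K.N.along (K.q i) s, a)).2 - K.τ i| ≤ κ := by
  have hlow := K.τ_sub_one_lt i
  have hupp := K.τ_lt_succ i
  rcases lt_trichotomy a (K.τ i) with hlt | rfl | hgt
  · refine L.frequently_abs_snd_iterate_sub_le hk H hs hκ (K.p_sub_one i).symm
      (isCompact_Icc (a := K.τ (i - 1)) (b := K.τ i))
      (fun y hy hne => ⟨lt_of_le_of_ne hy.1 hne.symm, hy.2.trans_lt hupp⟩) fun n => ?_
    have := L.snd_iterate_along_q_mem_Ioo H hs (i := i) ⟨ha.1, hlt⟩ n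
    exact ⟨Ioo_subset_Icc_self this, this.1.ne'⟩
  · refine (Eventually.of_forall fun n => ?_).frequently
    suffices hfix : (F^[n] (K.N.along (K.q i) s, K.τ i)).2 = K.τ i by simp [hfix, hκ.le]
    induction n with
    | zero => rfl
    | succ n ih => rw [L.snd_iterate_succ_along_q H hs, ih, H.fix]
  · refine L.frequently_abs_snd_iterate_sub_le hk H hs hκ (K.q_eq_p_add_one i)
      (isCompact_Icc (a := K.τ i) (b := K.τ (i + 1)))
      (fun y hy hne => ⟨hlow.trans_le hy.1, lt_of_le_of_ne hy.2 hne⟩) fun n => ?_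
    have := L.snd_iterate_along_q_mem_Ioo H hs (i := i) ⟨hgt, ha.2⟩ n
    exact ⟨Ioo_subset_Icc_self this, this.2.ne⟩

theorem exists_iterate_along_q_mem_box (hk : 1 < k) (H : IsFiberLift K h) (L : IsLift M h f F)
    (hs : |s| ≤ 2 * M.ε) (ha : a ∈ Ioo (K.τ (i - 1)) (K.τ (i + 1))) {κ : ℝ} (hκ : 0 < κ) :
    ∃ n, |K.N.lam⁻¹ ^ n * s| ≤ κ ∧ |(F^[n] (K.N.along (K.q i) s, a)).2 - K.τ i| ≤ κ := by
  have hsmall := (K.N.tendsto_inv_lam_pow_mul s).abs.eventually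
    (ge_mem_nhds (show |(0 : ℝ)| < κ by simpa using hκ))
  obtain ⟨n, hn, hn'⟩ :=
    ((L.frequently_abs_snd_iterate_along_q_sub_le hk H hs ha hκ).and_eventually hsmall).exists
  exact ⟨n, hn', hn⟩

theorem tendsto_iterate_along_q (hk6 : 6 ∣ k) (H : IsFiberLift K h) (L : IsLift M h f F)
    (hs : |s| ≤ 2 * M.ε) (ha : a ∈ Ioo (K.τ (i - 1)) (K.τ (i + 1))) :
    Tendsto (fun n => F^[n] (K.N.along (K.q i) s, a)) atTop (𝓝 (K.q i, K.τ i)) := by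
  obtain ⟨κ, hκ, -, θ, hθ0, hθ1, hbox⟩ := (IsSink.of_q M i).exists_isSinkBox hk6 H L
  obtain ⟨n₀, hsn, han⟩ :=
    L.exists_iterate_along_q_mem_box ((K.two_lt hk6).trans' one_lt_two) H hs ha hκ
  suffices hheight : Tendsto (fun n => (F^[n] (K.N.along (K.q i) s, a)).2) atTop (𝓝 (K.τ i)) from
    (L.tendsto_fst_iterate_along_q H hs).prodMk_nhds hheight
  have hgeo (m : ℕ) : |(F^[m + n₀] (K.N.along (K.q i) s, a)).2 - K.τ i| ≤ θ ^ m * κ := by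
    obtain ⟨b, hb, e⟩ := hbox.exists_iterate_eq hθ0 hθ1 hsn han (n := m) (u := 0)
      (by simpa using hκ.le)
    rw [K.N.alongU_zero, ← L.fst_iterate_along_q H hs (a := a), Prod.mk.eta,
      ← Function.iterate_add_apply] at e
    rwa [e]
  rw [← tendsto_add_atTop_iff_nat n₀, tendsto_iff_dist_tendsto_zero]
  refine squeeze_zero (fun _ => dist_nonneg) hgeo ?_
  simpa using (tendsto_pow_atTop_nhds_zero_of_lt_one hθ0 hθ1).mul_const κ

end IsLift

/-! ### The passage from one torus to the next -/

theorem exists_le_of_forall_mul_le {d : ℕ → ℝ} {θ κ : ℝ} {n₁ : ℕ} (hθ : 1 < θ) (hpos : 0 < d n₁)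
    (hexp : ∀ m ≥ n₁, (∀ l ≤ m, d l < κ) → θ * d m ≤ d (m + 1)) : ∃ n, κ ≤ d n := by
  by_contra! hall
  have hgrow (m : ℕ) : θ ^ m * d n₁ ≤ d (n₁ + m) := by
    induction m with
    | zero => simp
    | succ m ih =>
      calc θ ^ (m + 1) * d n₁ = θ * (θ ^ m * d n₁) := by ring
        _ ≤ θ * d (n₁ + m) := mul_le_mul_of_nonneg_left ih (zero_le_one.trans hθ.le)
        _ ≤ d (n₁ + m + 1) := hexp _ (Nat.le_add_right _ _) fun l _ => hall l
  obtain ⟨m, hm⟩ := pow_unbounded_of_one_lt (κ / d n₁) hθ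
  rw [div_lt_iff₀ hpos] at hm
  exact (hm.trans_le (hgrow m)).not_gt (hall _)

theorem le_pow_mul_of_forall_lt {d : ℕ → ℝ} {C κ : ℝ} (hC : 0 ≤ C)
    (hle : ∀ m, (∀ l ≤ m, d l < κ) → d (m + 1) ≤ C * d m) {n : ℕ} (hn : ∀ m < n, d m < κ) :
    d n ≤ C ^ n * d 0 := by
  induction n with
  | zero => simp
  | succ n ih =>
    calc d (n + 1) ≤ C * d n := hle n fun l hl => hn l (by omega)
      _ ≤ C * (C ^ n * d 0) := mul_le_mul_of_nonneg_left (ih fun m hm => hn m (by omega)) hC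
      _ = C ^ (n + 1) * d 0 := by ring

theorem exists_first_exit {d : ℕ → ℝ} {C θ κ : ℝ} {n₁ : ℕ} (hpos : ∀ n, 0 < d n) (hC : 1 ≤ C)
    (hle : ∀ m, (∀ l ≤ m, d l < κ) → d (m + 1) ≤ C * d m) (hθ : 1 < θ)
    (hexp : ∀ m ≥ n₁, (∀ l ≤ m, d l < κ) → θ * d m ≤ d (m + 1)) (hd₀ : C ^ n₁ * d 0 < κ) :
    ∃ n ≥ n₁, d n ∈ Icc κ (C * κ) ∧ ∀ m < n, d m < κ := by
  classical
  have hex := exists_le_of_forall_mul_le hθ (hpos n₁) hexp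
  have hmin (m : ℕ) (hm : m < Nat.find hex) : d m < κ := not_le.1 (Nat.find_min hex hm)
  have hn₁ : n₁ < Nat.find hex := by
    by_contra! hn
    have hpow := mul_le_mul_of_nonneg_right (pow_le_pow_right₀ hC hn) (hpos 0).le
    linarith [le_pow_mul_of_forall_lt (zero_le_one.trans hC) hle hmin, Nat.find_spec hex]
  refine ⟨Nat.find hex, hn₁.le, ⟨Nat.find_spec hex, ?_⟩, hmin⟩
  obtain ⟨n, hn⟩ := Nat.exists_eq_add_one_of_ne_zero (by omega : Nat.find hex ≠ 0)
  rw [hn] at hmin ⊢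
  exact (hle n fun l hl => hmin l (by omega)).trans
    (mul_le_mul_of_nonneg_left (hmin n n.lt_succ_self).le (zero_le_one.trans hC))

theorem ToralAnosov.exists_forall_abs_inv_lam_pow_mul_lt (N : ToralAnosov) (R : ℝ) {r : ℝ}
    (hr : 0 < r) : ∃ n₁ : ℕ, ∀ n ≥ n₁, ∀ s, |s| ≤ R → |N.lam⁻¹ ^ n * s| < r := by
  obtain ⟨n₁, hn₁⟩ := eventually_atTop.1 ((N.tendsto_inv_lam_pow_mul R).eventually (gt_mem_nhds hr))
  refine ⟨n₁, fun n hn s hs => lt_of_le_of_lt ?_ (hn₁ n hn)⟩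
  have hpow := pow_nonneg N.lam_inv_pos.le n
  rw [abs_mul, abs_of_nonneg hpow]
  exact mul_le_mul_of_nonneg_left hs hpow

namespace IsLift

variable {k : ℕ} {K : KanMap k} {M : FirstModification K} {h : T2 × ℝ → ℝ} {f : T3 → T3}
  {F : T2 × ℝ → T2 × ℝ} {j : ℤ} {s a : ℝ}

theorem fst_iterate_r0_and_snd_mem_Ioo (L : IsLift M h f F)
    (ha : a ∈ Ioo (K.τ (j - 1)) (K.τ (j + 1))) (n : ℕ) :
    (F^[n] (K.r0 j, a)).1 = K.r0 j ∧
      (F^[n] (K.r0 j, a)).2 ∈ Ioo (K.τ (j - 1)) (K.τ (j + 1)) := by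
  induction n with
  | zero => exact ⟨rfl, ha⟩
  | succ n ih =>
    obtain ⟨hfst, hlt, hlt'⟩ := L.circle j _ ih.2
    rw [Function.iterate_succ_apply', ← Prod.mk.eta (p := F^[n] (K.r0 j, a)), ih.1]
    exact ⟨hfst, ih.2.1.trans hlt, hlt'⟩

theorem snd_iterate_succ_r0 (L : IsLift M h f F) (ha : a ∈ Ioo (K.τ (j - 1)) (K.τ (j + 1)))
    (n : ℕ) : (F^[n + 1] (K.r0 j, a)).2 = (F (K.r0 j, (F^[n] (K.r0 j, a)).2)).2 := by
  rw [Function.iterate_succ_apply', ← Prod.mk.eta (p := F^[n] (K.r0 j, a)),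
    (L.fst_iterate_r0_and_snd_mem_Ioo ha n).1]

theorem tendsto_snd_iterate_r0 (L : IsLift M h f F) (ha : a ∈ Ioo (K.τ (j - 1)) (K.τ (j + 1))) :
    Tendsto (fun n => (F^[n] (K.r0 j, a)).2) atTop (𝓝 (K.τ (j + 1))) := by
  set b : ℕ → ℝ := fun n => (F^[n] (K.r0 j, a)).2
  have hmem (n : ℕ) : b n ∈ Ioo (K.τ (j - 1)) (K.τ (j + 1)) :=
    (L.fst_iterate_r0_and_snd_mem_Ioo ha n).2
  have hstep (n : ℕ) : b (n + 1) = (F (K.r0 j, b n)).2 := L.snd_iterate_succ_r0 ha n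
  have hmono : Monotone b :=
    monotone_nat_of_le_succ fun n => (L.circle j _ (hmem n)).2.1.le.trans_eq (hstep n).symm
  have hbdd : BddAbove (range b) := ⟨K.τ (j + 1), forall_mem_range.2 fun n => (hmem n).2.le⟩
  have hlim := tendsto_atTop_ciSup hmono hbdd
  have hfix : (F (K.r0 j, ⨆ n, b n)).2 = ⨆ n, b n := by
    refine tendsto_nhds_unique ?_ ((tendsto_add_atTop_iff_nat 1).2 hlim)
    simp only [hstep]
    exact ((continuous_snd.comp L.continuous).tendsto _).comp
      (tendsto_const_nhds.prodMk_nhds hlim)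
  have heq : ⨆ n, b n = K.τ (j + 1) := by
    by_contra hne
    have hlt := lt_of_le_of_ne (ciSup_le fun n => (hmem n).2.le) hne
    have := (L.circle j _ ⟨(hmem 0).1.trans_le (le_ciSup hbdd 0), hlt⟩).2.1
    exact this.ne' hfix
  rwa [heq] at hlim

theorem exists_dist2_iterate_r0_lt (L : IsLift M h f F)
    (ha : a ∈ Ioo (K.τ (j - 1)) (K.τ (j + 1))) {κ : ℝ} (hκ : 0 < κ) :
    ∃ n, dist2 (F^[n] (K.r0 j, a)).1 (K.r0 j) < κ ∧
      |(F^[n] (K.r0 j, a)).2 - K.τ (j + 1)| < κ := by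
  obtain ⟨n, hn⟩ :=
    ((L.tendsto_snd_iterate_r0 ha).eventually (Metric.ball_mem_nhds _ hκ)).exists
  refine ⟨n, ?_, hn⟩
  rwa [(L.fst_iterate_r0_and_snd_mem_Ioo ha n).1, dist2_self]

theorem exists_iterate_along_eq (L : IsLift M h f F) {c : T2} (hc : K.N.g c = c)
    (hs : |s| ≤ 2 * M.ε) (n : ℕ) :
    ∃ s', |s'| ≤ 3 * M.ε ∧ (F^[n] (K.N.along c s, a)).1 = K.N.along c s' := by
  obtain ⟨S, hS, e⟩ := L.iterate_drift n (K.N.along c s, a)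
  rw [K.N.iterate_g_along, Function.iterate_fixed hc, K.N.along_along] at e
  refine ⟨_, ?_, e⟩
  linarith [abs_add_le (K.N.lam⁻¹ ^ n * s) S, K.N.abs_inv_lam_pow_mul_le n s, M.ε_pos]

theorem exists_forall_iterate_along_r0_mem_box (hk : 1 < k) (L : IsLift M h f F) {b c : ℝ}
    (hbc : Icc b c ⊆ Ioo (K.τ (j - 1)) (K.τ (j + 1))) {κ : ℝ} (hκ : 0 < κ) :
    ∃ r > 0, ∀ s a, |s| < r → a ∈ Icc b c → ∃ (n : ℕ) (s' a' : ℝ),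
      F^[n] (K.N.along (K.r0 j) s, a) = (K.N.along (K.r0 j) s', a') ∧ |s'| ≤ κ ∧
        |a' - K.τ (j + 1)| ≤ κ := by
  set W : ℕ → Set (ℝ × ℝ) := fun n =>
    {z | dist2 (F^[n] (K.N.along (K.r0 j) z.1, z.2)).1 (K.r0 j) < κ ∧
      |(F^[n] (K.N.along (K.r0 j) z.1, z.2)).2 - K.τ (j + 1)| < κ}
  have hopen (n : ℕ) : IsOpen (W n) := by
    have hcont : Continuous fun z : ℝ × ℝ => F^[n] (K.N.along (K.r0 j) z.1, z.2) :=
      (L.continuous.iterate n).comp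
        ((K.N.continuous_along.comp (continuous_const.prodMk continuous_fst)).prodMk
          continuous_snd)
    exact (isOpen_lt ((continuous_dist2 _).comp (continuous_fst.comp hcont))
      continuous_const).inter
        (isOpen_lt ((continuous_snd.comp hcont).sub continuous_const).abs continuous_const)
  have hsub : ({0} : Set ℝ) ×ˢ Icc b c ⊆ ⋃ n, W n := by
    rintro ⟨s, a⟩ ⟨rfl : s = 0, ha⟩
    obtain ⟨n, hn⟩ := L.exists_dist2_iterate_r0_lt (hbc ha) hκ
    exact mem_iUnion.2 ⟨n, by simpa only [W, mem_ofPred_eq, K.N.along_zero] using hn⟩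
  obtain ⟨A, B, hA, -, h0A, hB, hAB⟩ :=
    generalized_tube_lemma isCompact_singleton isCompact_Icc (isOpen_iUnion hopen) hsub
  obtain ⟨r, hr, hrA⟩ := Metric.isOpen_iff.1 hA 0 (h0A rfl)
  refine ⟨min r (2 * M.ε), lt_min hr (mul_pos two_pos M.ε_pos), fun s a hs ha => ?_⟩
  have hsA : s ∈ A := hrA (by simpa using hs.trans_le (min_le_left _ _))
  obtain ⟨n, hfst, hsnd⟩ := mem_iUnion.1 (@hAB (s, a) ⟨hsA, hB ha⟩)
  obtain ⟨s', hs', e⟩ := L.exists_iterate_along_eq (K.g_r0 j) (a := a)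
    (hs.le.trans (min_le_right _ _)) n
  refine ⟨n, s', _, Prod.ext e rfl, ?_, hsnd.le⟩
  simp only at hfst
  rw [e, K.N.dist2_along _ (by linarith [M.ε_lt hk])] at hfst
  exact hfst.le

theorem apply_along_r1 (hk6 : 6 ∣ k) (H : IsFiberLift K h) (L : IsLift M h f F)
    (hs : |s| ≤ 2 * M.ε) (ha : |a - K.τ j| ≤ M.ε) :
    F (K.N.along (K.r1 j) s, a) =
      (K.N.along (K.r1 j) (K.N.lam⁻¹ * s), h (K.N.along (K.r1 j) s, a)) := by
  have hfar {s a : ℝ} (hs : |s| ≤ 2 * M.ε) (ha : |a - K.τ j| ≤ 5 * M.ε) :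
      M.Far (cyc (K.N.along (K.r1 j) s, a)) := by
    simpa only [K.N.alongU_zero] using
      M.far_along_alongU hk6 (M.lt_dist2_r1_r0 j) (u := 0) hs (by simpa using M.ε_pos.le) ha
  have hg : K.N.g (K.N.along (K.r1 j) s) = K.N.along (K.r1 j) (K.N.lam⁻¹ * s) := by
    rw [K.N.g_along, K.g_r1]
  have hfar' : M.Far (K.f₀ (cyc (K.N.along (K.r1 j) s, a))) := by
    rw [← H.cyc_eq, hg]
    refine hfar ((K.N.abs_inv_lam_mul_le s).trans hs) ?_
    linarith [H.abs_sub_le (K.N.along (K.r1 j) s) a j, M.ε_pos]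
  rw [L.far _ (hfar hs (by linarith [M.ε_pos])) hfar', hg]

theorem fst_iterate_along_r1 (hk6 : 6 ∣ k) (H : IsFiberLift K h) (L : IsLift M h f F)
    (hs : |s| ≤ 2 * M.ε) {n : ℕ}
    (hn : ∀ m < n, |(F^[m] (K.N.along (K.r1 j) s, a)).2 - K.τ j| ≤ M.ε) :
    (F^[n] (K.N.along (K.r1 j) s, a)).1 = K.N.along (K.r1 j) (K.N.lam⁻¹ ^ n * s) := by
  induction n with
  | zero => simp
  | succ n ih =>
    rw [Function.iterate_succ_apply', ← Prod.mk.eta (p := F^[n] (K.N.along (K.r1 j) s, a)),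
      ih fun m hm => hn m (by omega), L.apply_along_r1 hk6 H
        ((K.N.abs_inv_lam_pow_mul_le n s).trans hs) (hn n n.lt_succ_self), pow_succ', mul_assoc]

theorem snd_iterate_succ_along_r1 (hk6 : 6 ∣ k) (H : IsFiberLift K h) (L : IsLift M h f F)
    (hs : |s| ≤ 2 * M.ε) {n : ℕ}
    (hn : ∀ m ≤ n, |(F^[m] (K.N.along (K.r1 j) s, a)).2 - K.τ j| ≤ M.ε) :
    (F^[n + 1] (K.N.along (K.r1 j) s, a)).2 =
      h (K.N.along (K.r1 j) (K.N.lam⁻¹ ^ n * s), (F^[n] (K.N.along (K.r1 j) s, a)).2) := by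
  rw [Function.iterate_succ_apply', ← Prod.mk.eta (p := F^[n] (K.N.along (K.r1 j) s, a)),
    L.fst_iterate_along_r1 hk6 H hs fun m hm => hn m hm.le,
    L.apply_along_r1 hk6 H ((K.N.abs_inv_lam_pow_mul_le n s).trans hs) (hn n le_rfl)]

-- The height above the torus grows at most by the factor `3 / 2`, so the leaf coordinate has time
-- to become small before the expansion at `r^j_1` carries the orbit away from the torus.
theorem exists_forall_iterate_along_r1_mem (hk6 : 6 ∣ k) (H : IsFiberLift K h)
    (L : IsLift M h f F) (j : ℤ) :
    ∃ κ > 0, κ ≤ M.ε ∧ ∀ r₁ > 0, ∃ r > 0, ∀ s a, |s| ≤ 2 * M.ε →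
      a ∈ Ioo (K.τ j) (K.τ j + r) → ∃ (n : ℕ) (s' a' : ℝ),
        F^[n] (K.N.along (K.r1 j) s, a) = (K.N.along (K.r1 j) s', a') ∧ |s'| < r₁ ∧
          a' ∈ Icc (K.τ j + κ) (K.τ j + 3 / 2 * κ) := by
  obtain ⟨κ₀, hκ₀, θ, hθ, hexpand⟩ := H.exists_expansion (K.deriv_r1 j)
  have hκ : 0 < min κ₀ M.ε := lt_min hκ₀ M.ε_pos
  refine ⟨min κ₀ M.ε, hκ, min_le_right _ _, fun r₁ hr₁ => ?_⟩
  obtain ⟨n₁, hn₁⟩ := K.N.exists_forall_abs_inv_lam_pow_mul_lt (2 * M.ε) (lt_min hr₁ hκ₀)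
  refine ⟨min κ₀ M.ε / (3 / 2) ^ n₁, by positivity, fun s a hs ha => ?_⟩
  set z := (K.N.along (K.r1 j) s, a)
  set d : ℕ → ℝ := fun n => (F^[n] z).2 - K.τ j
  have hpos (n : ℕ) : 0 < d n := sub_pos.2 (L.iterate_above (z := z) ha.1 n)
  have hclose {m : ℕ} (hm : d m < min κ₀ M.ε) : |(F^[m] z).2 - K.τ j| ≤ min κ₀ M.ε := by
    rw [abs_of_pos (hpos m)]
    exact hm.le
  have hsucc {m : ℕ} (hm : ∀ l ≤ m, d l < min κ₀ M.ε) :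
      d (m + 1) = |h (K.N.along (K.r1 j) (K.N.lam⁻¹ ^ m * s), (F^[m] z).2) - K.τ j| := by
    rw [← L.snd_iterate_succ_along_r1 hk6 H hs fun l hl =>
      (hclose (hm l hl)).trans (min_le_right _ _)]
    exact (abs_of_pos (hpos (m + 1))).symm
  have hle (m : ℕ) (hm : ∀ l ≤ m, d l < min κ₀ M.ε) : d (m + 1) ≤ 3 / 2 * d m := by
    rw [hsucc hm, ← abs_of_pos (hpos m)]
    exact H.abs_sub_le _ _ j
  have hexp (m : ℕ) (hmn : m ≥ n₁) (hm : ∀ l ≤ m, d l < min κ₀ M.ε) : θ * d m ≤ d (m + 1) := by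
    rw [hsucc hm, ← abs_of_pos (hpos m)]
    exact hexpand _ _ ((hn₁ m hmn s hs).le.trans (min_le_right _ _))
      ((hclose (hm m le_rfl)).trans (min_le_left _ _))
  have hd₀ : (3 / 2) ^ n₁ * d 0 < min κ₀ M.ε := by
    rw [mul_comm, ← lt_div_iff₀ (by positivity)]
    exact sub_lt_iff_lt_add'.2 ha.2
  obtain ⟨n, hn, hdn, hlt⟩ := exists_first_exit hpos (by norm_num) hle hθ hexp hd₀
  refine ⟨n, _, _, Prod.ext (L.fst_iterate_along_r1 hk6 H hs fun m hm =>
    (hclose (hlt m hm)).trans (min_le_right _ _)) rfl,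
    (hn₁ n hn s hs).trans_le (min_le_left _ _), ?_, ?_⟩
  · exact le_sub_iff_add_le'.1 hdn.1
  · exact sub_le_iff_le_add'.1 hdn.2

theorem exists_forall_iterate_along_r1_mem_box (hk6 : 6 ∣ k) (H : IsFiberLift K h)
    (L : IsLift M h f F) (j : ℤ) {κ : ℝ} (hκ : 0 < κ) :
    ∃ r > 0, ∀ s a, |s| ≤ 2 * M.ε → a ∈ Ioo (K.τ j) (K.τ j + r) → ∃ (n : ℕ) (s' a' : ℝ),
      F^[n] (K.N.along (K.r1 j) s, a) = (K.N.along (K.rm (j + 2)) s', a') ∧ |s'| ≤ κ ∧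
        |a' - K.τ (j + 2)| ≤ κ := by
  obtain ⟨κ₁, hκ₁, hκ₁ε, hexit⟩ := L.exists_forall_iterate_along_r1_mem hk6 H j
  have hj : j + 1 + 1 = j + 2 := by ring
  have hsub : Icc (K.τ j + κ₁) (K.τ j + 3 / 2 * κ₁) ⊆
      Ioo (K.τ (j + 1 - 1)) (K.τ (j + 1 + 1)) := by
    rw [add_sub_cancel_right]
    rintro a ⟨hlow, hupp⟩
    exact ⟨by linarith, by linarith [M.ε_tori j, K.τ_lt_succ (j + 1)]⟩
  obtain ⟨r₁, hr₁, hcross⟩ := L.exists_forall_iterate_along_r0_mem_box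
    ((K.two_lt hk6).trans' one_lt_two) hsub hκ
  rw [← K.r1_r0 j, hj] at hcross
  obtain ⟨r, hr, hexit⟩ := hexit r₁ hr₁
  refine ⟨r, hr, fun s a hs ha => ?_⟩
  obtain ⟨n, s₁, a₁, e₁, hs₁, ha₁⟩ := hexit s a hs ha
  obtain ⟨m, s₂, a₂, e₂, hs₂, ha₂⟩ := hcross s₁ a₁ hs₁ ha₁
  refine ⟨m + n, s₂, a₂, ?_, hs₂, ha₂⟩
  rw [Function.iterate_add_apply, e₁, e₂, ← hj, K.rm_add_one, K.r1_r0]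

end IsLift

/-! ### Iterates of open sets -/

/-- Some iterate of `U` under `f` meets the part at heights in `I` of the strip of half-width `2ε`
over the stable leaf of `x`. -/
def Reaches {k : ℕ} {K : KanMap k} (M : FirstModification K) (f : T3 → T3) (U : Set T3) (x : T2)
    (I : Set ℝ) : Prop :=
  ∃ (n : ℕ) (s a : ℝ), |s| ≤ 2 * M.ε ∧ a ∈ I ∧ cyc (K.N.along x s, a) ∈ f^[n] '' U

section Reaches

variable {k : ℕ} {K : KanMap k} {M : FirstModification K} {h : T2 × ℝ → ℝ} {f : T3 → T3}
  {F : T2 × ℝ → T2 × ℝ} {U : Set T3} {x : T2} {I J : Set ℝ} {j : ℤ}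

theorem Reaches.mono (hIJ : I ⊆ J) (hR : Reaches M f U x I) : Reaches M f U x J := by
  obtain ⟨n, s, a, hs, ha, hmem⟩ := hR
  exact ⟨n, s, a, hs, hIJ ha, hmem⟩

theorem Reaches.of_image_iterate {m : ℕ} (hR : Reaches M f (f^[m] '' U) x I) :
    Reaches M f U x I := by
  obtain ⟨n, s, a, hs, ha, hmem⟩ := hR
  refine ⟨n + m, s, a, hs, ha, ?_⟩
  rwa [Function.iterate_add, image_comp]

theorem Reaches.Ioo_of_Ico (L : IsLift M h f F) (hU : IsOpen U) {b c : ℝ}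
    (hR : Reaches M f U x (Ico b c)) : Reaches M f U x (Ioo b c) := by
  obtain ⟨n, s, a, hs, ha, hmem⟩ := hR
  have hcont : Continuous fun a : ℝ => cyc (K.N.along x s, a) :=
    continuous_cyc.comp (Continuous.prodMk_right _)
  have hnear : ∀ᶠ a' in 𝓝[>] a, cyc (K.N.along x s, a') ∈ f^[n] '' U ∧ a' < c :=
    ((hcont.continuousAt.eventually ((L.isOpen_image_iterate n hU).mem_nhds hmem)).and
      (gt_mem_nhds ha.2)).filter_mono nhdsWithin_le_nhds
  obtain ⟨a', ⟨hmem', hlt⟩, hgt⟩ := (hnear.and self_mem_nhdsWithin).exists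
  exact ⟨n, s, a', hs, ⟨ha.1.trans_lt hgt, hlt⟩, hmem'⟩

-- The sink `q^j` attracts a point of `U`, so iterates of `U` accumulate on its unstable leaf, which
-- meets the stable leaf of every fixed point.
theorem Reaches.of_q (hk6 : 6 ∣ k) (H : IsFiberLift K h) (L : IsLift M h f F) (hU : IsOpen U)
    (hI : I ⊆ Ioo (K.τ (j - 1)) (K.τ (j + 1))) (hR : Reaches M f U (K.q j) I)
    (hx : K.N.g x = x) {r : ℝ} (hr : 0 < r) :
    Reaches M f U x {a' | |a' - K.τ j| < r ∧ (I ⊆ Ioi (K.τ j) → K.τ j < a')} := by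
  obtain ⟨κ, hκ, hleaf⟩ := (IsSink.of_q M j).exists_iterate_mem_leaf hk6 H L
  obtain ⟨n, s, a, hs, ha, hmem⟩ := hR
  obtain ⟨m, hsm, ham⟩ :=
    L.exists_iterate_along_q_mem_box ((K.two_lt hk6).trans' one_lt_two) H hs (hI ha) hκ
  have hmem' : cyc (K.N.along (K.q j) (K.N.lam⁻¹ ^ m * s), (F^[m] (K.N.along (K.q j) s, a)).2) ∈
      f^[m] '' (f^[n] '' U) := by
    rw [← L.fst_iterate_along_q H hs (a := a), Prod.mk.eta, L.cyc_iterate]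
    exact mem_image_of_mem _ hmem
  obtain ⟨n', s', a', hs', ha', hmem'', hlt⟩ := hleaf _ _ _
    (L.isOpen_image_iterate m (L.isOpen_image_iterate n hU)) hsm ham hmem' x hx r hr
  exact .of_image_iterate (m := n) (.of_image_iterate (m := m)
    ⟨n', s', a', hs', ⟨ha', fun hI' => hlt (L.iterate_above (hI' ha) m)⟩, hmem''⟩)

theorem Reaches.of_r1 (hk6 : 6 ∣ k) (H : IsFiberLift K h) (L : IsLift M h f F) (hU : IsOpen U)
    (hR : ∀ r > 0, Reaches M f U (K.r1 j) (Ioo (K.τ j) (K.τ j + r))) (hx : K.N.g x = x) {r : ℝ}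
    (hr : 0 < r) : Reaches M f U x {a' | |a' - K.τ (j + 2)| < r} := by
  obtain ⟨κ, hκ, hleaf⟩ := (IsSink.of_rm M (j + 2)).exists_iterate_mem_leaf hk6 H L
  obtain ⟨r₁, hr₁, hcross⟩ := L.exists_forall_iterate_along_r1_mem_box hk6 H j hκ
  obtain ⟨n, s, a, hs, ha, hmem⟩ := hR r₁ hr₁
  obtain ⟨m, s₁, a₁, e, hs₁, ha₁⟩ := hcross s a hs ha
  have hmem₁ : cyc (K.N.along (K.rm (j + 2)) s₁, a₁) ∈ f^[m] '' (f^[n] '' U) := by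
    rw [← e, L.cyc_iterate]
    exact mem_image_of_mem _ hmem
  obtain ⟨n', s', a', hs', ha', hmem', -⟩ := hleaf _ _ _
    (L.isOpen_image_iterate m (L.isOpen_image_iterate n hU)) hs₁ ha₁ hmem₁ x hx r hr
  exact .of_image_iterate (m := n) (.of_image_iterate (m := m) ⟨n', s', a', hs', ha', hmem'⟩)

theorem FirstModification.mem_Ioo_of_abs_sub_lt (M : FirstModification K) {a : ℝ}
    (ha : |a - K.τ j| < 10 * M.ε) : a ∈ Ioo (K.τ (j - 1)) (K.τ (j + 1)) := by
  rw [abs_lt] at ha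
  have hgap := M.ε_tori (j - 1)
  rw [sub_add_cancel] at hgap
  exact ⟨by linarith, by linarith [M.ε_tori j]⟩

theorem Reaches.q_add_two (hk6 : 6 ∣ k) (H : IsFiberLift K h) (L : IsLift M h f F)
    (hU : IsOpen U) (hR : Reaches M f U (K.q j) (Ioo (K.τ j) (K.τ (j + 1)))) :
    Reaches M f U (K.q (j + 2)) (Ioo (K.τ (j + 2 - 1)) (K.τ (j + 2 + 1))) := by
  have hr1 : ∀ r > 0, Reaches M f U (K.r1 j) (Ioo (K.τ j) (K.τ j + r)) := fun r hr =>
    (hR.of_q hk6 H L hU (Ioo_subset_Ioo_left (K.τ_sub_one_lt j).le) (K.g_r1 j) hr).mono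
      fun a ha => ⟨ha.2 Ioo_subset_Ioi_self, sub_lt_iff_lt_add'.1 (abs_lt.1 ha.1).2⟩
  exact (Reaches.of_r1 hk6 H L hU hr1 (K.g_q _) (mul_pos (by norm_num) M.ε_pos)).mono
    fun a ha => M.mem_Ioo_of_abs_sub_lt ha

-- The points `p^j`, `q^{j-1}` and `q^{j+1}` have the same projection to `T²`, so a point of the
-- leaf of `p^j` near the torus lies in the strip of `q^{j+1}` if above it, of `q^{j-1}` if below.
theorem Reaches.q_add_one (hk6 : 6 ∣ k) (H : IsFiberLift K h) (L : IsLift M h f F)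
    (hU : IsOpen U) (hR : Reaches M f U (K.q j) (Ioo (K.τ (j - 1)) (K.τ (j + 1)))) :
    Reaches M f U (K.q (j + 1)) (Ioo (K.τ (j + 1 - 1)) (K.τ (j + 1 + 1))) := by
  obtain ⟨n, s, a, hs, ha, hmem⟩ :=
    hR.of_q hk6 H L hU subset_rfl (K.g_p j) (mul_pos (by norm_num : (0 : ℝ) < 10) M.ε_pos)
  have hnear := M.mem_Ioo_of_abs_sub_lt ha.1
  rcases lt_or_ge a (K.τ j) with hlt | hge
  · have hp : K.p j = K.q (j - 1) := by rw [K.q_eq_p_add_one, sub_add_cancel]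
    have hbelow : Reaches M f U (K.q (j - 1)) (Ioo (K.τ (j - 1)) (K.τ (j - 1 + 1))) :=
      ⟨n, s, a, hs, ⟨hnear.1, by rwa [sub_add_cancel]⟩, hp ▸ hmem⟩
    have := hbelow.q_add_two hk6 H L hU
    rwa [show j - 1 + 2 = j + 1 by ring] at this
  · have habove : Reaches M f U (K.q (j + 1)) (Ico (K.τ j) (K.τ (j + 1))) :=
      ⟨n, s, a, hs, ⟨hge, hnear.2⟩, K.p_q j ▸ hmem⟩
    rw [add_sub_cancel_right]
    exact (habove.Ioo_of_Ico L hU).mono (Ioo_subset_Ioo_right (K.τ_lt_succ (j + 1)).le)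

theorem exists_reaches_Ico (L : IsLift M h f F) (hU : IsOpen U) (hne : U.Nonempty)
    (hx : K.N.g x = x) : ∃ j, Reaches M f U x (Ico (K.τ j) (K.τ (j + 1))) := by
  obtain ⟨⟨y, t⟩, hyt⟩ := hne
  obtain ⟨a, rfl⟩ := isOpenQuotientMap_coe.surjective t
  obtain ⟨s, hs⟩ := K.N.exists_along_mem hx (hU.preimage (Continuous.prodMk_left _)) ⟨y, hyt⟩
  obtain ⟨n, hn⟩ := K.N.exists_abs_inv_lam_pow_mul_le s M.ε_pos
  obtain ⟨S, hS, e⟩ := L.iterate_drift n (K.N.along x s, a)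
  rw [K.N.iterate_g_along, Function.iterate_fixed hx, K.N.along_along] at e
  obtain ⟨j, hj⟩ := K.exists_mem_Ico_τ (F^[n] (K.N.along x s, a)).2
  refine ⟨j, n, K.N.lam⁻¹ ^ n * s + S, _, ?_, hj, cyc (K.N.along x s, a), hs, ?_⟩
  · linarith [abs_add_le (K.N.lam⁻¹ ^ n * s) S, M.ε_pos]
  · rw [← e, Prod.mk.eta, L.cyc_iterate]

theorem exists_reaches_q (L : IsLift M h f F) (hU : IsOpen U) (hne : U.Nonempty) :
    ∃ j, Reaches M f U (K.q j) (Ioo (K.τ (j - 1)) (K.τ (j + 1))) := by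
  obtain ⟨j, hj⟩ := exists_reaches_Ico L hU hne (K.g_q 0)
  have hR := hj.Ioo_of_Ico L hU
  rcases K.q_eq_q_or_eq_p 0 j with hq | hq
  · exact ⟨j, hq ▸ hR.mono (Ioo_subset_Ioo_left (K.τ_sub_one_lt j).le)⟩
  · refine ⟨j + 1, ?_⟩
    rw [hq, K.p_q] at hR
    rw [add_sub_cancel_right]
    exact hR.mono (Ioo_subset_Ioo_right (K.τ_lt_succ (j + 1)).le)

theorem exists_reaches_q_add_mul (hk6 : 6 ∣ k) (H : IsFiberLift K h) (L : IsLift M h f F)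
    (hU : IsOpen U) (hne : U.Nonempty) (i : ℤ) : ∃ l : ℤ, Reaches M f U (K.q (i + l * k))
      (Ioo (K.τ (i + l * k - 1)) (K.τ (i + l * k + 1))) := by
  obtain ⟨j, hj⟩ := exists_reaches_q L hU hne
  have hall (m : ℤ) (hm : j ≤ m) : Reaches M f U (K.q m) (Ioo (K.τ (m - 1)) (K.τ (m + 1))) := by
    induction m, hm using Int.leInduction with
    | base => exact hj
    | succ m _ ih => exact ih.q_add_one hk6 H L hU
  refine ⟨|j - i|, hall _ ?_⟩
  have hk1 : (1 : ℤ) ≤ k := by exact_mod_cast (K.two_lt hk6).le.trans' one_le_two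
  linarith [le_abs_self (j - i), le_mul_of_one_le_right (abs_nonneg (j - i)) hk1]

theorem Reaches.inter_stableSet_nonempty (hk6 : 6 ∣ k) (H : IsFiberLift K h)
    (L : IsLift M h f F) (hR : Reaches M f U (K.q j) (Ioo (K.τ (j - 1)) (K.τ (j + 1)))) :
    (U ∩ stableSet f (K.Q j)).Nonempty := by
  obtain ⟨n, s, a, hs, ha, z, hz, e⟩ := hR
  refine ⟨z, hz, ?_⟩
  change Tendsto (fun m => f^[m] z) atTop (𝓝 (K.Q j))
  rw [← tendsto_add_atTop_iff_nat n]
  refine ((continuous_cyc.tendsto _).comp (L.tendsto_iterate_along_q hk6 H hs ha)).congr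
    fun m => ?_
  rw [Function.comp_apply, L.cyc_iterate, ← e, Function.iterate_add_apply]

theorem IsLift.dense_stableSet (hk6 : 6 ∣ k) (H : IsFiberLift K h) (L : IsLift M h f F) (i : ℤ) :
    Dense (stableSet f (K.Q i)) := by
  refine dense_iff_inter_open.2 fun U hU hne => ?_
  obtain ⟨l, hl⟩ := exists_reaches_q_add_mul hk6 H L hU hne i
  rw [← K.Q_add_mul hk6 i l]
  exact hl.inter_stableSet_nonempty hk6 H L

end Reaches

end IntermingledBasins

end

theorem mainTheorem3_general {k : ℕ} (hk6 : 6 ∣ k) {K : IntermingledBasins.KanMap k}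
    {M : IntermingledBasins.FirstModification K} {X : IntermingledBasins.T3 → ℝ}
    (hX : IntermingledBasins.IsUpwardField M X)
    {ρ : IntermingledBasins.T3 → IntermingledBasins.T3}
    (hρ : IntermingledBasins.IsVerticalTimeOneMap X ρ)
    {f : IntermingledBasins.T3 → IntermingledBasins.T3}
    (hf : f = ρ ∘ M.f₁ ∨ f = M.f₁ ∘ ρ) (i : ℤ) :
    Dense (IntermingledBasins.stableSet f (K.Q i)) := by
  obtain ⟨h, H⟩ := K.exists_isFiberLift (K.two_lt hk6)
  obtain ⟨F, L⟩ := hX.exists_isLift hk6 hρ hf H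
  exact L.dense_stableSet hk6 H i

theorem mainTheorem3 {k : ℕ} (hk : 0 < k) (hk6 : 6 ∣ k)
    (K : IntermingledBasins.KanMap k) (M : IntermingledBasins.FirstModification K)
    (η : Fin k → IntermingledBasins.T3 → ℝ)
    (hη : ∀ j : Fin k, IntermingledBasins.IsBump (K.R0 (j : ℕ)) M.ε' (η j)) :
    ∃ δ₀ > 0, ∀ δ : ℝ, 0 < δ → δ < δ₀ →
      ∀ ρ : IntermingledBasins.T3 → IntermingledBasins.T3,
        IntermingledBasins.IsVerticalTimeOneMap (fun z => δ * ∑ j, η j z) ρ →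
      ∀ f : IntermingledBasins.T3 → IntermingledBasins.T3,
        (f = ρ ∘ M.f₁ ∨ f = M.f₁ ∘ ρ) →
      ∀ i : ℤ, Dense (IntermingledBasins.stableSet f (K.Q i)) :=
  ⟨1, one_pos, fun _ hδ _ _ hρ _ hf =>
    mainTheorem3_general hk6 (IntermingledBasins.isUpwardField_sum_bump hk6 hη hδ) hρ hf⟩
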